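/- Let $q,t$ be elements of a field $K$ of characteristic $0$ that are algebraically independent over $\mathbb{Q}$ (e.g. indeterminates, $K=\mathbb{Q}(q,t)$). **Macdonald polynomials.** Let $\Lambda_K=K[p_1,p_2,\dots]$ be the ring of symmetric functions, with the Macdonald inner product $\langle p_\rho,p_\tau\rangle=\delta_{\rho\tau}\prod_{k\ge1}k^{m_k}m_k!\prod_i\frac{1-q^{\rho_i}}{1-t^{\rho_i}}$, where $m_k$ is the number of parts of $\rho$ equal to $k$. There is a unique family $(P_\lambda)$ in $\Lambda_K$, indexed by all partitions, with $P_\lambda=m_\lambda+\sum_{\mu<\lambda}c_{\lambda,\mu}m_\mu$ ($m_\mu$ the monomial symmetric functions, $<$ the dominance order on the partitions of $|\lambda|$, $c_{\lambda,\mu}\in K$) and $\langle P_\lambda,P_\mu\rangle=0$ for $\lambda\ne\mu$. Let $P_\lambda(x_1,\dots,x_n;q,t)$ be its specialization to $n$ variables. **Notation.** A composition is $\mu=(\mu_1,\dots,\mu_n)\in\mathbb{Z}_{\ge0}^n$; a partition is a weakly decreasing composition. For a partition $\lambda=(\lambda_1\ge\dots\ge\lambda_n\ge0)$ let $\ell(\lambda)$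 be the number of nonzero parts, $x_\lambda=\prod_{i=1}^{\ell(\lambda)}x_i$, $\lambda'_i=\#\{k:\lambda_k\ge i\}$, and let $\lambda[k]$ be obtained from $\lambda$ by replacing all parts of size $\le k$ by $0$. The group $S_n$ acts on compositions by $(\sigma\circ\mu)_k=\mu_{\sigma^{-1}(k)}$; let $S_\mu\subset S_n$ be the set of the shortest representatives of the left cosets of the stabilizer of $\mu$, so that $\sigma\mapsto\sigma\circ\mu$ is a bijection from $S_\mu$ onto the orbit of $\mu$. On $K[x_1,\dots,x_n]$ let $$T_i=t-\frac{tx_i-x_{i+1}}{x_i-x_{i+1}}(1-s_i),\qquad 1\le i\le n-1,$$ where $s_i$ exchanges $x_i$ and $x_{i+1}$, and $T_\sigma=T_{i_1}\cdots T_{i_k}$ for a reduced word $\sigma=s_{i_1}\cdots s_{i_k}$. For compositions $\lambda,\mu$ let $a_j(\lambda,\mu)=\#\{k:\lambda_k=0,\ \mu_k=j\}$ and $b_j(\lambda,\mu)=\#\{k:j=\lambda_k>\mu_k\}$. **Theorem.** Let $\lambda=(\lambda_1,\dots,\lambda_n)$ be a partition with largest part $r$. Then $$P_\lambda(x_1,\dots,x_n;q,t)=\sum_{\sigma\in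 S_\lambda}T_\sigma\circ x_\lambda\circ\prod_{i=1}^{r-1}\Bigl(\sum_{\sigma\in S_{\lambda[i]}}C_i\bigl(\lambda[i-1],\,\sigma\circ\lambda[i]\bigr)\,T_\sigma\circ x_{\lambda[i]}\circ\Bigr)1,$$ where the factors of the product of operators are ordered from left ($i=1$, applied last) to right ($i=r-1$, applied first), $x_{\lambda[i]}$ acts by multiplication, and the coefficients are $C_i(\lambda,\mu)=0$ if $0<\lambda_k<\mu_k$ for some $k$, and otherwise $$C_i(\lambda,\mu)=\prod_{j=i+1}^{r}\left(q^{(j-i)a_j(\lambda,\mu)}\prod_{k=1}^{b_j(\lambda,\mu)}\frac{1-t^k}{1-q^{j-i}t^{\lambda'_i-\lambda'_j+k}}\right)$$ (in which $r$ is the largest part of the argument $\lambda$ of $C_i$; for $\lambda[i-1]$, $1\le i\le r-1$, it is the same $r$). -/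

import Mathlib

namespace MacdonaldFormula

open MvPolynomial

/-! ## Symmetric functions and Macdonald polynomials -/

/-- The ring of symmetric functions in infinitely many variables over a field `K` of
characteristic zero, presented as the polynomial ring on the power sums:
the variable `X k` stands for the power sum `p_{k+1} = ∑ x_j ^ (k+1)`. -/
abbrev SymFun (K : Type*) [Field K] : Type _ := MvPolynomial ℕ K

/-- The specialization `F ↦ F(x_1, …, x_N)` of a symmetric function to `N` variables
(all other variables are set to `0`). -/
noncomputable def toVars {K : Type*} [Field K] (N : ℕ) :
    SymFun K →ₐ[K] MvPolynomial (Fin N) K :=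
  aeval fun k : ℕ => psum (Fin N) K (k + 1)

/-- `z_ρ(q,t) = ∏_{k ≥ 1} k^{m_k} m_k! ∏_i (1 - q^{ρ_i}) / (1 - t^{ρ_i})` for the partition `ρ`
which has `e k` parts equal to `k + 1`. -/
noncomputable def zqt {K : Type*} [Field K] (q t : K) (e : ℕ →₀ ℕ) : K :=
  e.prod fun k m =>
    ((k + 1 : ℕ) : K) ^ m * (m.factorial : K) * ((1 - q ^ (k + 1)) / (1 - t ^ (k + 1))) ^ m

/-- The Macdonald inner product on symmetric functions: the `K`-bilinear form with
`⟨p_ρ, p_τ⟩ = δ_{ρ,τ} z_ρ(q,t)`. -/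
noncomputable def macInner {K : Type*} [Field K] (q t : K) (F G : SymFun K) : K :=
  ∑ e ∈ F.support, F.coeff e * G.coeff e * zqt q t e

/-- The sum of the `k` largest parts of a partition. -/
def partialSum {d : ℕ} (mu : d.Partition) (k : ℕ) : ℕ :=
  ((mu.parts.sort (· ≥ ·)).take k).sum

/-- The strict dominance order `mu < lam` on the partitions of `d`. -/
def DomLT {d : ℕ} (mu lam : d.Partition) : Prop :=
  mu ≠ lam ∧ ∀ k : ℕ, partialSum mu k ≤ partialSum lam k

open Classical in
/-- `P` is the family of the Macdonald symmetric functions `P_λ(q,t)`, indexed by all partitions: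
`P_λ = m_λ + ∑_{μ < λ} c_{λ,μ} m_μ`, and the `P_λ` are pairwise orthogonal for the Macdonald
inner product. (A symmetric function is determined by its specializations to `N` variables
for all `N`, and in `N` variables `m_μ` is `0` if `μ` has more than `N` parts.) -/
structure IsMacdonaldFamily {K : Type*} [Field K] (q t : K)
    (P : (Σ d : ℕ, d.Partition) → SymFun K) : Prop where
  triangular : ∀ (d : ℕ) (lam : d.Partition), ∃ c : d.Partition → K, ∀ N : ℕ,
    toVars N (P ⟨d, lam⟩) = msymm (Fin N) K lam +
      ∑ mu : d.Partition with DomLT mu lam, c mu • msymm (Fin N) K mu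
  orthogonal : ∀ lam mu : Σ d : ℕ, d.Partition, lam ≠ mu → macInner q t (P lam) (P mu) = 0

/-- The partition underlying a composition `mu = (mu_1, …, mu_n)`: its nonzero parts. -/
def toPartition {n : ℕ} (mu : Fin n → ℕ) : Σ d : ℕ, d.Partition :=
  ⟨_, Nat.Partition.ofMultiset ((Finset.univ : Finset (Fin n)).val.map mu)⟩

/-! ## The Hecke operators -/

/-- The position `i` of the `i`-th pair of neighbours `(i, i+1)` in `Fin n`. -/
def lft {n : ℕ} (i : Fin (n - 1)) : Fin n := ⟨i.1, by omega⟩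

/-- The position `i + 1` of the `i`-th pair of neighbours `(i, i+1)` in `Fin n`. -/
def rgt {n : ℕ} (i : Fin (n - 1)) : Fin n := ⟨i.1 + 1, by omega⟩

theorem lft_ne_rgt {n : ℕ} (i : Fin (n - 1)) : lft i ≠ rgt i := by
  simp [lft, rgt]

/-- The simple transposition `s_i` which exchanges `i` and `i + 1`. -/
def simpleSwap {n : ℕ} (i : Fin (n - 1)) : Equiv.Perm (Fin n) := Equiv.swap (lft i) (rgt i)

theorem sub_dvd_sub_swap {K : Type*} [Field K] {n : ℕ} (i : Fin (n - 1))
    (f : MvPolynomial (Fin n) K) :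
    (X (lft i) - X (rgt i) : MvPolynomial (Fin n) K) ∣ f - rename (simpleSwap i) f := by
  rw [← Ideal.mem_span_singleton, ← Ideal.Quotient.mk_eq_mk_iff_sub_mem]
  set I : Ideal (MvPolynomial (Fin n) K) := Ideal.span {X (lft i) - X (rgt i)} with hI
  have hx : Ideal.Quotient.mk I (X (lft i)) = Ideal.Quotient.mk I (X (rgt i)) := by
    rw [Ideal.Quotient.mk_eq_mk_iff_sub_mem, hI]
    exact Ideal.mem_span_singleton_self _
  have h : Ideal.Quotient.mkₐ K I =
      (Ideal.Quotient.mkₐ K I).comp (rename (simpleSwap i)) := by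
    apply MvPolynomial.algHom_ext
    intro j
    simp only [AlgHom.comp_apply, rename_X, Ideal.Quotient.mkₐ_eq_mk, simpleSwap]
    by_cases h1 : j = lft i
    · subst h1; rw [Equiv.swap_apply_left, hx]
    · by_cases h2 : j = rgt i
      · subst h2; rw [Equiv.swap_apply_right, hx]
      · rw [Equiv.swap_apply_of_ne_of_ne h1 h2]
  exact DFunLike.congr_fun h f

theorem X_sub_X_ne_zero {K : Type*} [Field K] {n : ℕ} (i : Fin (n - 1)) :
    (X (lft i) - X (rgt i) : MvPolynomial (Fin n) K) ≠ 0 := by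
  rw [sub_ne_zero]
  exact fun h => lft_ne_rgt i (X_injective h)

/-- The divided difference `(f - s_i f) / (x_i - x_{i+1})`. -/
noncomputable def divDiff {K : Type*} [Field K] {n : ℕ} (i : Fin (n - 1))
    (f : MvPolynomial (Fin n) K) : MvPolynomial (Fin n) K :=
  Classical.choose (sub_dvd_sub_swap i f)

theorem mul_divDiff {K : Type*} [Field K] {n : ℕ} (i : Fin (n - 1))
    (f : MvPolynomial (Fin n) K) :
    (X (lft i) - X (rgt i)) * divDiff i f = f - rename (simpleSwap i) f :=
  (Classical.choose_spec (sub_dvd_sub_swap i f)).symm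

/-- The Hecke generator
`T_i = t - (t x_i - x_{i+1}) / (x_i - x_{i+1}) (1 - s_i)` on polynomials. -/
noncomputable def heckeGen {K : Type*} [Field K] (t : K) {n : ℕ} (i : Fin (n - 1)) :
    Module.End K (MvPolynomial (Fin n) K) where
  toFun f := t • f - (t • X (lft i) - X (rgt i)) * divDiff i f
  map_add' f g := by
    have h : divDiff i (f + g) = divDiff i f + divDiff i g := by
      apply mul_left_cancel₀ (X_sub_X_ne_zero (K := K) i)
      rw [mul_add, mul_divDiff, mul_divDiff, mul_divDiff, map_add]
      ring
    rw [h, smul_add]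
    ring
  map_smul' c f := by
    have h : divDiff i (c • f) = c • divDiff i f := by
      apply mul_left_cancel₀ (X_sub_X_ne_zero (K := K) i)
      rw [mul_smul_comm, mul_divDiff, mul_divDiff, map_smul, smul_sub]
    rw [h, RingHom.id_apply, smul_sub, smul_comm t c, mul_smul_comm]

theorem exists_word {n : ℕ} (s : Equiv.Perm (Fin n)) :
    ∃ w : List (Fin (n - 1)), (w.map simpleSwap).prod = s := by
  cases n with
  | zero => exact ⟨[], Subsingleton.elim _ _⟩
  | succ m =>
    have hs : s ∈ Submonoid.closure
        (Set.range fun i : Fin m => Equiv.swap i.castSucc i.succ) := by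
      rw [Equiv.Perm.mclosure_swap_castSucc_succ]
      exact Submonoid.mem_top s
    induction hs using Submonoid.closure_induction with
    | mem x hx =>
      obtain ⟨i, rfl⟩ := hx
      exact ⟨[i], by simp only [List.map_cons, List.map_nil, List.prod_singleton]; rfl⟩
    | one => exact ⟨[], rfl⟩
    | mul x y _ _ hx hy =>
      obtain ⟨w, rfl⟩ := hx
      obtain ⟨v, rfl⟩ := hy
      exact ⟨w ++ v, by simp⟩

/-- `w = [i_1, …, i_k]` is a reduced word of `s`: `s = s_{i_1} ⋯ s_{i_k}`, with `k` minimal. -/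
def IsReducedWord {n : ℕ} (w : List (Fin (n - 1))) (s : Equiv.Perm (Fin n)) : Prop :=
  (w.map simpleSwap).prod = s ∧
    ∀ v : List (Fin (n - 1)), (v.map simpleSwap).prod = s → w.length ≤ v.length

theorem exists_isReducedWord {n : ℕ} (s : Equiv.Perm (Fin n)) :
    ∃ w : List (Fin (n - 1)), IsReducedWord w s := by
  classical
  have h : ∃ k : ℕ, ∃ w : List (Fin (n - 1)),
      (w.map simpleSwap).prod = s ∧ w.length = k := by
    obtain ⟨w, hw⟩ := exists_word s
    exact ⟨_, w, hw, rfl⟩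
  obtain ⟨w, hw, hk⟩ := Nat.find_spec h
  exact ⟨w, hw, fun v hv => hk ▸ Nat.find_min' h ⟨v, hv, rfl⟩⟩

/-- A reduced word of `s`. -/
noncomputable def reducedWord {n : ℕ} (s : Equiv.Perm (Fin n)) : List (Fin (n - 1)) :=
  Classical.choose (exists_isReducedWord s)

/-- The Coxeter length of a permutation. -/
noncomputable def permLength {n : ℕ} (s : Equiv.Perm (Fin n)) : ℕ := (reducedWord s).length

/-- `T_σ = T_{i_1} ∘ ⋯ ∘ T_{i_k}` for a reduced word `σ = s_{i_1} ⋯ s_{i_k}` (by the braid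
relations the choice of the reduced word does not matter). -/
noncomputable def heckeT {K : Type*} [Field K] (t : K) {n : ℕ} (s : Equiv.Perm (Fin n)) :
    Module.End K (MvPolynomial (Fin n) K) :=
  ((reducedWord s).map (heckeGen t)).prod

/-! ## Compositions and the coefficients -/

/-- The left action of permutations on compositions by place permutation:
`act s_i` exchanges the entries at the places `i` and `i + 1`. -/
def act {n : ℕ} (s : Equiv.Perm (Fin n)) (mu : Fin n → ℕ) : Fin n → ℕ :=
  fun k => mu (s⁻¹ k)

open Classical in
/-- `S_μ = S_n / Stab(μ)`, each coset being represented by its shortest element. -/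
noncomputable def distinctPerms {n : ℕ} (mu : Fin n → ℕ) : Finset (Equiv.Perm (Fin n)) :=
  {s | ∀ u : Equiv.Perm (Fin n), act u mu = act s mu → permLength s ≤ permLength u}

/-- `λ[k]`: all parts of size at most `k` are replaced by `0`. -/
def trunc {n : ℕ} (lam : Fin n → ℕ) (k : ℕ) : Fin n → ℕ :=
  fun m => if lam m ≤ k then 0 else lam m

/-- The largest part. -/
def largest {n : ℕ} (lam : Fin n → ℕ) : ℕ := Finset.univ.sup lam

/-- The number `ℓ(λ)` of nonzero parts. -/
def len {n : ℕ} (lam : Fin n → ℕ) : ℕ := Finset.card {k : Fin n | 0 < lam k}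

/-- The part `λ'_i` (`i ≥ 1`) of the conjugate partition. -/
def conj {n : ℕ} (lam : Fin n → ℕ) (i : ℕ) : ℕ := Finset.card {k : Fin n | i ≤ lam k}

/-- `x_λ = x_1 ⋯ x_{ℓ(λ)}`. -/
noncomputable def xMon (K : Type*) [Field K] {n : ℕ} (lam : Fin n → ℕ) :
    MvPolynomial (Fin n) K :=
  ∏ k : Fin n with k.1 < len lam, X k

/-- `a_i(λ,μ) = #{k : λ_k = 0, μ_k = i}`. -/
def aNum {n : ℕ} (i : ℕ) (lam mu : Fin n → ℕ) : ℕ :=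
  Finset.card {k : Fin n | lam k = 0 ∧ mu k = i}

/-- `b_i(λ,μ) = #{k : i = λ_k > μ_k}`. -/
def bNum {n : ℕ} (i : ℕ) (lam mu : Fin n → ℕ) : ℕ :=
  Finset.card {k : Fin n | lam k = i ∧ mu k < lam k}

open Classical in
/-- The coefficient `C_i(λ,μ)`. -/
noncomputable def coeffC {K : Type*} [Field K] (q t : K) {n : ℕ} (i : ℕ)
    (lam mu : Fin n → ℕ) : K :=
  if ∃ k : Fin n, 0 < lam k ∧ lam k < mu k then 0
  else ∏ j ∈ Finset.Icc (i + 1) (largest lam),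
    (q ^ ((j - i) * aNum j lam mu) *
      ∏ k ∈ Finset.Icc 1 (bNum j lam mu),
        (1 - t ^ k) / (1 - q ^ (j - i) * t ^ (conj lam i - conj lam j + k)))

/-- The operator `∑_{σ ∈ S_{λ[i]}} C_i(λ[i-1], σ∘λ[i]) T_σ ∘ x_{λ[i]}` of level `i ≥ 1`. -/
noncomputable def levelOp {K : Type*} [Field K] (q t : K) {n : ℕ} (lam : Fin n → ℕ) (i : ℕ) :
    Module.End K (MvPolynomial (Fin n) K) :=
  ∑ s ∈ distinctPerms (trunc lam i),
    coeffC q t i (trunc lam (i - 1)) (act s (trunc lam i)) •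
      (heckeT t s * LinearMap.mulLeft K (xMon K (trunc lam i)))

/-- The outermost operator `∑_{σ ∈ S_λ} T_σ ∘ x_λ`. -/
noncomputable def topOp {K : Type*} [Field K] (t : K) {n : ℕ} (lam : Fin n → ℕ) :
    Module.End K (MvPolynomial (Fin n) K) :=
  ∑ s ∈ distinctPerms lam, heckeT t s * LinearMap.mulLeft K (xMon K lam)

end MacdonaldFormula

/-! For each rearrangement μ of λ one constructs a polynomial f_μ such that the family solves the
exchange relations of the q-deformed Knizhnik–Zamolodchikov equations (`IsQKZ`): T_i f_μ = f_{s_i μ}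
at a descent, T_i f_μ = t f_μ at equal neighbours, and f_μ(q x_n, x_1, …, x_{n-1}) = q^{μ_1}
f_{(μ_2,…,μ_n,μ_1)}. The sum of the f_μ (`orbitPoly`) is P_λ, and the operator formula is the
construction of the f_μ unwound.

Construction. Lower every nonzero part of λ by one and let the f_ν be the family of the result. Put
f_λ = x_λ Σ_ν c(λ,ν) f_ν (`recBase`) and reach the other f_μ by bubble sort with the T_i; the
commutation and braid relations make the result independent of the path (`heckeFamily_spec`). For a
shortest coset representative σ the operator T_σ carries f_λ to f_{σ∘λ}, so one factor of the
operator product is one step of the recursion (`coeffC_trunc`, `xMon_mul_prod_levelOp`,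
`topOp_apply_eq_orbitPoly`).

The heart is that the cyclic relation is inherited by λ (`isQKZ_heckeFamily_recBase`). Think of
labelled columns, column k having height λ_k and carrying the entry ν_k. One compares two positions
of a column s: moved to the first place and hit by the cyclic operator ω, and moved to the last
place. Each crossing is one T_i and changes only the coefficients in the sum over ν, by explicit
factors (`leftFactor`, `rightFactor`). The denominators 1 - q^v t^k are made so that a complete pass
yields exactly the required power of q (`one_sub_fillRatio_mul`, `leftFactor_full`,
`rightFactor_full`); crossing an empty column also moves a variable, by T_i x_i T_i = t x_{i+1}.

Identification. The orbit sum is a t-eigenvector of every T_i, hence symmetric. It has leading term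
x^λ (`recBase_sub_xPow`), and the exchange relations make it an eigenvector of Σ_m T_m ⋯ T_{n-1} ω
(`diffOp_orbitPoly`). On symmetric polynomials this operator is, up to an affine change, the
specialization of an operator `macOp` on Λ_K which does not depend on n (`diffOp_toVars`). That
operator is Σ_k t^{-k} β_k β_k^*, with β_k^* adjoint to multiplication by β_k
(`macForm_coeff_shiftHom`), so it is self-adjoint. By algebraic independence its eigenvalues are
distinct (`macEigVal_injective`). Hence the symmetric functions lifted from the orbit sums in
sufficiently many variables are orthogonal and unitriangular, and these two properties determine
them. In an arbitrary number of variables the orbit sum and the specialized P_λ belong to the same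
eigenvalue, and the coefficient of x^λ makes them equal (`toVars_macdonald_succ`). -/

namespace MacdonaldFormula

open MvPolynomial

/-! ### Relations of the affine Hecke algebra on polynomials. -/

section Hecke

variable {K : Type*} [Field K] {n : ℕ}

theorem heckeGen_apply (t : K) (i : Fin (n - 1)) (f : MvPolynomial (Fin n) K) :
    heckeGen t i f = t • f - (t • X (lft i) - X (rgt i)) * divDiff i f := rfl

/-- With the denominator cleared, T_i is a combination of 1 and s_i. All relations below are
verified in this form, by cancelling the factors x_i - x_{i+1} at the end. -/
theorem sub_mul_heckeGen (t : K) (i : Fin (n - 1)) (f : MvPolynomial (Fin n) K) :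
    (X (lft i) - X (rgt i)) * heckeGen t i f =
      (1 - C t) * X (rgt i) * f + (C t * X (lft i) - X (rgt i)) * rename (simpleSwap i) f := by
  rw [heckeGen_apply, smul_eq_C_mul, smul_eq_C_mul]
  linear_combination (-(C t * X (lft i) - X (rgt i))) * mul_divDiff i f

theorem eq_of_sub_mul_eq {i : Fin (n - 1)} {f g : MvPolynomial (Fin n) K}
    (h : (X (lft i) - X (rgt i)) * f = (X (lft i) - X (rgt i)) * g) : f = g :=
  mul_left_cancel₀ (X_sub_X_ne_zero i) h

theorem X_sub_X_ne_zero' {a b : Fin n} (h : a ≠ b) :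
    (X a - X b : MvPolynomial (Fin n) K) ≠ 0 := by
  rw [sub_ne_zero]
  exact fun e => h (X_injective e)

@[simp]
theorem simpleSwap_lft (i : Fin (n - 1)) : simpleSwap i (lft i) = rgt i := Equiv.swap_apply_left _ _

@[simp]
theorem simpleSwap_rgt (i : Fin (n - 1)) : simpleSwap i (rgt i) = lft i := Equiv.swap_apply_right _ _

theorem simpleSwap_of_ne {i : Fin (n - 1)} {k : Fin n} (h1 : k ≠ lft i) (h2 : k ≠ rgt i) :
    simpleSwap i k = k := Equiv.swap_apply_of_ne_of_ne h1 h2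

@[simp]
theorem simpleSwap_simpleSwap (i : Fin (n - 1)) (k : Fin n) :
    simpleSwap i (simpleSwap i k) = k := by simp [simpleSwap]

theorem simpleSwap_mul_self (i : Fin (n - 1)) : simpleSwap i * simpleSwap i = 1 :=
  Equiv.swap_mul_self _ _

@[simp]
theorem simpleSwap_inv (i : Fin (n - 1)) : (simpleSwap i)⁻¹ = simpleSwap i := Equiv.swap_inv _ _

@[simp]
theorem rename_simpleSwap_rename (i : Fin (n - 1)) (f : MvPolynomial (Fin n) K) :
    rename (simpleSwap i) (rename (simpleSwap i) f) = f := by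
  rw [rename_rename]
  have : (simpleSwap i ∘ simpleSwap i : Fin n → Fin n) = id := by ext k; simp
  rw [this, rename_id_apply]

theorem heckeGen_mul_of_rename_eq (t : K) {i : Fin (n - 1)} {g : MvPolynomial (Fin n) K}
    (hg : rename (simpleSwap i) g = g) (f : MvPolynomial (Fin n) K) :
    heckeGen t i (g * f) = g * heckeGen t i f := by
  apply eq_of_sub_mul_eq (i := i)
  rw [mul_left_comm, sub_mul_heckeGen, sub_mul_heckeGen, map_mul, hg]
  ring

theorem heckeGen_eq_smul_of_rename_eq (t : K) {i : Fin (n - 1)} {f : MvPolynomial (Fin n) K}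
    (hf : rename (simpleSwap i) f = f) : heckeGen t i f = t • f := by
  apply eq_of_sub_mul_eq (i := i)
  rw [sub_mul_heckeGen, hf, smul_eq_C_mul]
  ring

/-- T_i - t is the divided difference followed by multiplication with the nonzero polynomial -(t x_i
- x_{i+1}), so its kernel consists of s_i-invariants. The symmetry of the orbit sum is detected in
this way. -/
theorem rename_eq_of_heckeGen_eq_smul (t : K) (ht : t ≠ 0) {i : Fin (n - 1)}
    {f : MvPolynomial (Fin n) K}
    (hf : heckeGen t i f = t • f) : rename (simpleSwap i) f = f := by
  have h := sub_mul_heckeGen t i f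
  rw [hf, smul_eq_C_mul] at h
  have h0 : (C t * X (lft i) - X (rgt i) : MvPolynomial (Fin n) K) ≠ 0 := by
    intro e
    have := congrArg (eval fun k => if k = lft i then (1 : K) else 0) e
    simp [(lft_ne_rgt i).symm, ht] at this
  apply mul_left_cancel₀ h0
  linear_combination -h

theorem heckeGen_one (t : K) (i : Fin (n - 1)) :
    heckeGen t i (1 : MvPolynomial (Fin n) K) = t • (1 : MvPolynomial (Fin n) K) :=
  heckeGen_eq_smul_of_rename_eq t (map_one _)

theorem heckeGen_quadratic (t : K) (i : Fin (n - 1)) (f : MvPolynomial (Fin n) K) :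
    heckeGen t i (heckeGen t i f) = (t - 1) • heckeGen t i f + t • f := by
  have h1 := sub_mul_heckeGen t i f
  have h2 := congrArg (rename (simpleSwap i)) h1
  simp only [map_mul, map_sub, map_add, rename_X, rename_C, simpleSwap_lft, simpleSwap_rgt,
    rename_simpleSwap_rename, map_one] at h2
  apply eq_of_sub_mul_eq (i := i)
  apply eq_of_sub_mul_eq (i := i)
  rw [sub_mul_heckeGen, smul_eq_C_mul, smul_eq_C_mul, map_sub, map_one]
  linear_combination ((1 - C t) * X (rgt i) - (C t - 1) * (X (lft i) - X (rgt i))) * h1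
    - (C t * X (lft i) - X (rgt i)) * h2

/-- `T_i x_i T_i = t x_{i+1}`. -/
theorem heckeGen_X_mul_heckeGen (t : K) (i : Fin (n - 1)) (f : MvPolynomial (Fin n) K) :
    heckeGen t i (X (lft i) * heckeGen t i f) = t • (X (rgt i) * f) := by
  have h1 := sub_mul_heckeGen t i f
  have h2 := congrArg (rename (simpleSwap i)) h1
  simp only [map_mul, map_sub, map_add, rename_X, rename_C, simpleSwap_lft, simpleSwap_rgt,
    rename_simpleSwap_rename, map_one] at h2
  apply eq_of_sub_mul_eq (i := i)
  apply eq_of_sub_mul_eq (i := i)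
  rw [sub_mul_heckeGen, smul_eq_C_mul]
  simp only [map_mul, rename_X, simpleSwap_lft]
  linear_combination ((1 - C t) * X (rgt i) * X (lft i)) * h1
    - (C t * X (lft i) - X (rgt i)) * X (rgt i) * h2

theorem simpleSwap_comm {i j : Fin (n - 1)} (h : i.1 + 1 < j.1) (k : Fin n) :
    simpleSwap i (simpleSwap j k) = simpleSwap j (simpleSwap i k) := by
  have hd : Equiv.Perm.Disjoint (simpleSwap i) (simpleSwap j) := by
    apply Equiv.Perm.disjoint_swap_swap
    simp [lft, rgt, Fin.ext_iff]
    omega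
  exact DFunLike.congr_fun hd.commute.eq k

theorem lft_ne_lft {i j : Fin (n - 1)} (h : i.1 ≠ j.1) : lft i ≠ lft j := by
  simpa [lft] using h

theorem rgt_ne_rgt {i j : Fin (n - 1)} (h : i.1 ≠ j.1) : rgt i ≠ rgt j := by
  simpa [rgt] using h

theorem lft_ne_rgt' {i j : Fin (n - 1)} (h : i.1 ≠ j.1 + 1) : lft i ≠ rgt j := by
  simpa [rgt, lft] using h

theorem heckeGen_comm (t : K) {i j : Fin (n - 1)} (h : i.1 + 1 < j.1)
    (f : MvPolynomial (Fin n) K) :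
    heckeGen t i (heckeGen t j f) = heckeGen t j (heckeGen t i f) := by
  have hil : simpleSwap j (lft i) = lft i :=
    simpleSwap_of_ne (lft_ne_lft (by omega)) (lft_ne_rgt' (by omega))
  have hir : simpleSwap j (rgt i) = rgt i :=
    simpleSwap_of_ne (lft_ne_rgt' (by omega)).symm (rgt_ne_rgt (by omega))
  have hjl : simpleSwap i (lft j) = lft j :=
    simpleSwap_of_ne (lft_ne_lft (by omega)) (lft_ne_rgt' (by omega))
  have hjr : simpleSwap i (rgt j) = rgt j :=
    simpleSwap_of_ne (lft_ne_rgt' (by omega)).symm (rgt_ne_rgt (by omega))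
  have hc : rename (simpleSwap i) (rename (simpleSwap j) f)
      = rename (simpleSwap j) (rename (simpleSwap i) f) := by
    rw [rename_rename, rename_rename]
    congr 1
    ext k
    simp [simpleSwap_comm h]
  have h1 := sub_mul_heckeGen t i f
  have h2 := sub_mul_heckeGen t j f
  have h1' := congrArg (rename (simpleSwap j)) h1
  have h2' := congrArg (rename (simpleSwap i)) h2
  simp only [map_mul, map_sub, map_add, rename_X, rename_C, map_one, hil, hir, hjl, hjr, hc]
    at h1' h2'
  apply eq_of_sub_mul_eq (i := i)
  apply eq_of_sub_mul_eq (i := j)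
  rw [sub_mul_heckeGen, mul_left_comm _ _ (heckeGen t j _), sub_mul_heckeGen]
  linear_combination ((1 - C t) * X (rgt i)) * h2 + (C t * X (lft i) - X (rgt i)) * h2'
    - ((1 - C t) * X (rgt j)) * h1 - (C t * X (lft j) - X (rgt j)) * h1'

theorem heckeGen_braid (t : K) {i j : Fin (n - 1)} (h : i.1 + 1 = j.1)
    (f : MvPolynomial (Fin n) K) :
    heckeGen t i (heckeGen t j (heckeGen t i f)) = heckeGen t j (heckeGen t i (heckeGen t j f)) := by
  have hb : lft j = rgt i := by simp [lft, rgt, h]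
  have hac : lft i ≠ rgt j := lft_ne_rgt' (by omega)
  have hl : simpleSwap j (lft i) = lft i :=
    simpleSwap_of_ne (lft_ne_lft (by omega)) hac
  have hr : simpleSwap i (rgt j) = rgt j :=
    simpleSwap_of_ne hac.symm (rgt_ne_rgt (by omega))
  have hj1 : simpleSwap j (rgt i) = rgt j := by rw [← hb, simpleSwap_lft]
  have hj2 : simpleSwap j (rgt j) = rgt i := by rw [← hb, simpleSwap_rgt]
  have hc : ∀ g : MvPolynomial (Fin n) K,
      rename (simpleSwap i) (rename (simpleSwap j) (rename (simpleSwap i) g))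
      = rename (simpleSwap j) (rename (simpleSwap i) (rename (simpleSwap j) g)) := by
    intro g
    rw [rename_rename, rename_rename, rename_rename, rename_rename]
    refine congrArg (fun φ : Fin n → Fin n => rename φ g) (funext fun k => ?_)
    change simpleSwap i (simpleSwap j (simpleSwap i k)) =
      simpleSwap j (simpleSwap i (simpleSwap j k))
    by_cases h1 : k = lft i
    · subst h1; simp [hl, hr, hj1]
    by_cases h2 : k = rgt i
    · subst h2; simp [hl, hr, hj1, hj2]
    by_cases h3 : k = rgt j
    · subst h3; simp [hl, hr, hj2]
    have e1 : simpleSwap i k = k := simpleSwap_of_ne h1 h2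
    have e2 : simpleSwap j k = k := simpleSwap_of_ne (hb ▸ h2) h3
    rw [e1, e2, e1, e2]
  set a : MvPolynomial (Fin n) K := X (lft i)
  set b : MvPolynomial (Fin n) K := X (rgt i)
  set c : MvPolynomial (Fin n) K := X (rgt j)
  set σ : MvPolynomial (Fin n) K →ₐ[K] MvPolynomial (Fin n) K := rename (simpleSwap i)
  set τ : MvPolynomial (Fin n) K →ₐ[K] MvPolynomial (Fin n) K := rename (simpleSwap j)
  have σa : σ a = b := by simp [σ, a, b]
  have σb : σ b = a := by simp [σ, a, b]
  have σc : σ c = c := by simp [σ, c, hr]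
  have τa : τ a = a := by simp [τ, a, hl]
  have τb : τ b = c := by simp [τ, b, c, hj1]
  have τc : τ c = b := by simp [τ, b, c, hj2]
  have σC : σ (C t) = C t := rename_C _ _
  have τC : τ (C t) = C t := rename_C _ _
  have σσ : ∀ g, σ (σ g) = g := fun g => rename_simpleSwap_rename i g
  have ττ : ∀ g, τ (τ g) = g := fun g => rename_simpleSwap_rename j g
  have HI : ∀ g, (a - b) * heckeGen t i g = (1 - C t) * b * g + (C t * a - b) * σ g :=
    fun g => sub_mul_heckeGen t i g
  have HJ : ∀ g, (b - c) * heckeGen t j g = (1 - C t) * c * g + (C t * b - c) * τ g := by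
    intro g; have := sub_mul_heckeGen t j g; rwa [hb] at this
  have hab : a - b ≠ 0 := X_sub_X_ne_zero i
  have hbc : b - c ≠ 0 := by have := X_sub_X_ne_zero (K := K) j; rwa [hb] at this
  have hac' : a - c ≠ 0 := X_sub_X_ne_zero' hac

  -- The denominators of T_i T_j T_i f are cleared from the inside out (A, B, C), together with the
  -- images of these identities under the two swaps; the primed versions do the same for T_j T_i T_j
  -- f.
  have A0 := HI f
  have A1 := congrArg σ A0
  have A2 := congrArg τ A0
  have A3 := congrArg σ A2
  have B0 := HJ (heckeGen t i f)
  have B1 := congrArg σ B0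
  have C0 := HI (heckeGen t j (heckeGen t i f))
  have A0' := HJ f
  have A1' := congrArg τ A0'
  have A2' := congrArg σ A0'
  have A3' := congrArg τ A2'
  have B0' := HI (heckeGen t j f)
  have B1' := congrArg τ B0'
  have C0' := HJ (heckeGen t i (heckeGen t j f))
  simp only [map_mul, map_sub, map_add, map_one, σa, σb, σc, τa, τb, τc, σC, τC]
    at A0 A1 A2 A3 B0 B1 C0 A0' A1' A2' A3' B0' B1' C0'
  rw [σσ] at A1
  rw [ττ] at A1'
  have hM : (a - b) ^ 2 * (b - c) ^ 2 * (a - c) ≠ 0 := by positivity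
  apply mul_left_cancel₀ hM
  linear_combination (b - c) * ((a - b) * (b - c) * (a - c) * C0
      + (1 - C t) * b * (a - c) * (a - b) * B0 + (C t * a - b) * (b - c) * (a - b) * B1
      + (1 - C t) * b * (a - c) * (1 - C t) * c * A0 + (1 - C t) * b * (C t * b - c) * (a - b) * A2
      - (C t * a - b) * (b - c) * (1 - C t) * c * A1
      + (C t * a - b) * (C t * a - c) * (a - b) * A3)
    - (a - b) * ((b - c) * (a - b) * (a - c) * C0'
      + (1 - C t) * c * (b - c) * (a - c) * B0' + (C t * b - c) * (a - b) * (b - c) * B1'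
      + (1 - C t) * c * (1 - C t) * b * (a - c) * A0' + (1 - C t) * c * (C t * a - b) * (b - c) * A2'
      - (C t * b - c) * (1 - C t) * c * (a - b) * A1'
      + (C t * b - c) * (C t * a - c) * (b - c) * A3')
    + (C t * a - b) * (C t * a - c) * (a - b) * (b - c) * (C t * b - c) * hc f

end Hecke

/-! ### The cyclic operator ω. -/

section Cyclic

variable {K : Type*} [Field K] {N : ℕ}

/-- The cyclic substitution `f ↦ f(q x_n, x_1, …, x_{n-1})`. -/
noncomputable def cycOp (q : K) : MvPolynomial (Fin (N + 1)) K →ₐ[K] MvPolynomial (Fin (N + 1)) K :=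
  aeval fun p => Fin.cases (C q * X (Fin.last N)) (fun j : Fin N => X j.castSucc) p

@[simp]
theorem cycOp_X_zero (q : K) :
    cycOp q (X 0 : MvPolynomial (Fin (N + 1)) K) = C q * X (Fin.last N) := by
  simp [cycOp]

@[simp]
theorem cycOp_X_succ (q : K) (j : Fin N) :
    cycOp q (X j.succ : MvPolynomial (Fin (N + 1)) K) = X j.castSucc := by
  simp [cycOp]

theorem cycOp_C (q c : K) : cycOp q (C c : MvPolynomial (Fin (N + 1)) K) = C c := by
  simp [cycOp]

theorem lft_eq_castSucc (i : Fin N) : lft (n := N + 1) i = i.castSucc := rfl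

theorem rgt_eq_succ (i : Fin N) : rgt (n := N + 1) i = i.succ := rfl

/-- Since j is at least 1, ω only shifts the indices of the two variables which T_j involves; the
variable multiplied by q is not one of them. -/
theorem cycOp_heckeGen (q t : K) {i j : Fin (N + 1 - 1)} (h : j.1 = i.1 + 1)
    (f : MvPolynomial (Fin (N + 1)) K) :
    cycOp q (heckeGen t j f) = heckeGen t i (cycOp q f) := by
  have hl : cycOp q (X (lft j)) = (X (lft i) : MvPolynomial (Fin (N + 1)) K) := by
    have e : lft j = Fin.succ (n := N) i := by simp [lft, Fin.ext_iff, h]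
    rw [e, cycOp_X_succ]; rfl
  have hr : cycOp q (X (rgt j)) = (X (rgt i) : MvPolynomial (Fin (N + 1)) K) := by
    have e : rgt j = Fin.succ (n := N) j := rfl
    rw [e, cycOp_X_succ]
    congr 1
    simp [rgt, Fin.ext_iff, h]
  have hs : ∀ f : MvPolynomial (Fin (N + 1)) K,
      cycOp q (rename (simpleSwap j) f) = rename (simpleSwap i) (cycOp q f) := by
    intro f
    refine DFunLike.congr_fun (?_ : (cycOp q).comp (rename (simpleSwap j)) =
      (rename (simpleSwap i)).comp (cycOp q)) f
    apply algHom_ext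
    intro k
    simp only [AlgHom.comp_apply, rename_X]
    by_cases h1 : k = lft j
    · subst h1; rw [simpleSwap_lft, hl, hr, rename_X, simpleSwap_lft]
    by_cases h2 : k = rgt j
    · subst h2; rw [simpleSwap_rgt, hl, hr, rename_X, simpleSwap_rgt]
    rw [simpleSwap_of_ne h1 h2]
    induction k using Fin.cases with
    | zero =>
      rw [cycOp_X_zero, map_mul, rename_C, rename_X, simpleSwap_of_ne]
      · simp [lft, Fin.ext_iff]; have := j.2; omega
      · simp [rgt, Fin.ext_iff]; have := j.2; omega
    | succ k =>
      rw [cycOp_X_succ, rename_X, simpleSwap_of_ne]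
      · simp [lft, Fin.ext_iff] at h1 ⊢; omega
      · simp [rgt, Fin.ext_iff] at h2 ⊢; omega
  have e := congrArg (cycOp q) (sub_mul_heckeGen t j f)
  simp only [map_mul, map_sub, map_add, map_one, hl, hr, hs, cycOp_C] at e
  apply eq_of_sub_mul_eq (i := i)
  rw [e, sub_mul_heckeGen]

end Cyclic

/-! ### Inversions of compositions as the distance from the antitone rearrangement. -/

section Inversions

variable {n : ℕ}

/-- The number of pairs of places `a < b` with `mu a < mu b`. -/
def invs (mu : Fin n → ℕ) : ℕ :=
  Finset.card {p : Fin n × Fin n | p.1 < p.2 ∧ mu p.1 < mu p.2}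

theorem simpleSwap_lt_iff {i : Fin (n - 1)} {a b : Fin n} (h : ¬(a = lft i ∧ b = rgt i))
    (h' : ¬(a = rgt i ∧ b = lft i)) :
    simpleSwap i a < simpleSwap i b ↔ a < b := by
  unfold simpleSwap
  rw [Equiv.swap_apply_def, Equiv.swap_apply_def]
  simp only [lft, rgt, Fin.ext_iff, Fin.lt_def] at *
  split_ifs <;> simp_all <;> omega

theorem lft_lt_rgt (i : Fin (n - 1)) : lft i < rgt i := by simp [lft, rgt]

/-- s_i permutes the pairs of places other than (i, i+1) and preserves their order, so only that one
pair can change the inversion number. -/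
theorem card_inversions_erase (mu : Fin n → ℕ) (i : Fin (n - 1)) :
    Finset.card {p : Fin n × Fin n | (p.1 < p.2 ∧ (mu ∘ simpleSwap i) p.1 < (mu ∘ simpleSwap i) p.2) ∧
      p ≠ (lft i, rgt i)} =
    Finset.card {p : Fin n × Fin n | (p.1 < p.2 ∧ mu p.1 < mu p.2) ∧ p ≠ (lft i, rgt i)} := by
  apply Finset.card_nbij' (Prod.map (simpleSwap i) (simpleSwap i))
    (Prod.map (simpleSwap i) (simpleSwap i))
  · rintro ⟨a, b⟩ h
    simp only [Finset.coe_filter, Finset.mem_univ, true_and, Set.mem_ofPred_eq, ne_eq,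
      Prod.mk.injEq, Function.comp_apply, Prod.map] at h ⊢
    have hc : ¬(a = rgt i ∧ b = lft i) := by
      rintro ⟨rfl, rfl⟩; exact absurd h.1.1 (lft_lt_rgt i).asymm
    refine ⟨⟨(simpleSwap_lt_iff h.2 hc).2 h.1.1, h.1.2⟩, fun e => hc ⟨?_, ?_⟩⟩
    · rw [← simpleSwap_lft, ← e.1]; simp
    · rw [← simpleSwap_rgt, ← e.2]; simp
  · rintro ⟨a, b⟩ h
    simp only [Finset.coe_filter, Finset.mem_univ, true_and, Set.mem_ofPred_eq, ne_eq,
      Prod.mk.injEq, Function.comp_apply, Prod.map, simpleSwap_simpleSwap] at h ⊢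
    have hc : ¬(a = rgt i ∧ b = lft i) := by
      rintro ⟨rfl, rfl⟩; exact absurd h.1.1 (lft_lt_rgt i).asymm
    refine ⟨⟨(simpleSwap_lt_iff h.2 hc).2 h.1.1, h.1.2⟩, fun e => hc ⟨?_, ?_⟩⟩
    · rw [← simpleSwap_lft, ← e.1]; simp
    · rw [← simpleSwap_rgt, ← e.2]; simp
  · rintro ⟨a, b⟩ _; simp
  · rintro ⟨a, b⟩ _; simp

theorem invs_eq_card_erase_add (mu : Fin n → ℕ) (i : Fin (n - 1)) :
    invs mu = Finset.card {p : Fin n × Fin n | (p.1 < p.2 ∧ mu p.1 < mu p.2) ∧ p ≠ (lft i, rgt i)}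
      + if mu (lft i) < mu (rgt i) then 1 else 0 := by
  rw [invs]
  rw [← Finset.card_filter_add_card_filter_not (fun p => p ≠ (lft i, rgt i)), Finset.filter_filter]
  congr 1
  rw [Finset.filter_filter]
  split_ifs with h
  · rw [Finset.card_eq_one]
    refine ⟨(lft i, rgt i), ?_⟩
    ext p
    simp only [ne_eq, not_not, Finset.mem_filter, Finset.mem_univ, true_and, Finset.mem_singleton]
    constructor
    · exact fun h => h.2
    · rintro rfl; exact ⟨⟨lft_lt_rgt i, h⟩, rfl⟩
  · rw [Finset.card_eq_zero, Finset.filter_eq_empty_iff]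
    rintro p - ⟨h1, h2⟩
    rw [not_not] at h2
    subst h2
    exact h h1.2

theorem invs_comp_simpleSwap (mu : Fin n → ℕ) (i : Fin (n - 1)) (h : mu (lft i) < mu (rgt i)) :
    invs mu = invs (mu ∘ simpleSwap i) + 1 := by
  rw [invs_eq_card_erase_add mu i, invs_eq_card_erase_add (mu ∘ simpleSwap i) i,
    card_inversions_erase]
  simp [h, h.le]

theorem comp_simpleSwap_of_eq {mu : Fin n → ℕ} {i : Fin (n - 1)} (h : mu (lft i) = mu (rgt i)) :
    mu ∘ simpleSwap i = mu := by
  ext k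
  simp only [Function.comp_apply]
  by_cases h1 : k = lft i
  · subst h1; simp [h]
  by_cases h2 : k = rgt i
  · subst h2; simp [h]
  rw [simpleSwap_of_ne h1 h2]

@[simp]
theorem comp_simpleSwap_comp_simpleSwap (mu : Fin n → ℕ) (i : Fin (n - 1)) :
    (mu ∘ simpleSwap i) ∘ simpleSwap i = mu := by
  ext k; simp

theorem antitone_of_forall_le {mu : Fin n → ℕ} (h : ∀ i : Fin (n - 1), mu (rgt i) ≤ mu (lft i)) :
    Antitone mu := by
  cases n with
  | zero => intro a; exact a.elim0
  | succ m => exact Fin.antitone_iff_succ_le.2 h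

end Inversions

/-! ### Bubble sort with Hecke generators: independence of the path. -/

section Family

variable {K : Type*} [Field K] {n : ℕ}

/-- The polynomials obtained from `g` (placed at the antitone composition) by bubble sort with
the Hecke generators. -/
noncomputable def heckeFamily (t : K) (g : MvPolynomial (Fin n) K) (mu : Fin n → ℕ) :
    MvPolynomial (Fin n) K :=
  open Classical in
  if h : ∃ i : Fin (n - 1), mu (lft i) < mu (rgt i) then
    heckeGen t h.choose (heckeFamily t g (mu ∘ simpleSwap h.choose))
  else g
termination_by invs mu
decreasing_by
  rw [invs_comp_simpleSwap mu h.choose h.choose_spec]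
  omega

/-- The Hecke part of the exchange relations, for the compositions in the orbit of `lam`. -/
structure IsHeckeFamily (t : K) (lam : Fin n → ℕ) (f : (Fin n → ℕ) → MvPolynomial (Fin n) K) :
    Prop where
  desc : ∀ (s : Equiv.Perm (Fin n)) (i : Fin (n - 1)), lam (s (rgt i)) < lam (s (lft i)) →
    heckeGen t i (f (lam ∘ s)) = f ((lam ∘ s) ∘ simpleSwap i)
  eq : ∀ (s : Equiv.Perm (Fin n)) (i : Fin (n - 1)), lam (s (lft i)) = lam (s (rgt i)) →
    heckeGen t i (f (lam ∘ s)) = t • f (lam ∘ s)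

theorem heckeFamily_of_antitone (t : K) (g : MvPolynomial (Fin n) K) {lam : Fin n → ℕ}
    (h : Antitone lam) : heckeFamily t g lam = g := by
  rw [heckeFamily, dif_neg]
  push Not
  exact fun i => h (lft_lt_rgt i).le

theorem comp_perm_eq_of_antitone {lam : Fin n → ℕ} (hl : Antitone lam) {s : Equiv.Perm (Fin n)}
    (hs : Antitone (lam ∘ s)) : lam ∘ s = lam := by
  have := Tuple.unique_monotone (f := OrderDual.toDual ∘ lam) (σ := s) (τ := 1)
    (fun a b h => hs h) (fun a b h => hl h)
  exact this

theorem simpleSwap_comp_comm {i j : Fin (n - 1)} (h : i.1 + 1 < j.1) (mu : Fin n → ℕ) :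
    (mu ∘ simpleSwap i) ∘ simpleSwap j = (mu ∘ simpleSwap j) ∘ simpleSwap i := by
  ext k
  simp [simpleSwap_comm h]

theorem comp_simpleSwap_lft_rgt_of_far {i j : Fin (n - 1)} (h : i.1 + 1 < j.1 ∨ j.1 + 1 < i.1)
    (mu : Fin n → ℕ) : (mu ∘ simpleSwap i) (lft j) = mu (lft j) ∧
      (mu ∘ simpleSwap i) (rgt j) = mu (rgt j) := by
  constructor
  · rw [Function.comp_apply, simpleSwap_of_ne (lft_ne_lft (by omega)) (lft_ne_rgt' (by omega))]
  · rw [Function.comp_apply, simpleSwap_of_ne (lft_ne_rgt' (by omega)).symm (rgt_ne_rgt (by omega))]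

theorem comp_simpleSwap_adj {i j : Fin (n - 1)} (h : i.1 + 1 = j.1) (mu : Fin n → ℕ) :
    (mu ∘ simpleSwap i) (lft i) = mu (lft j) ∧ (mu ∘ simpleSwap i) (lft j) = mu (lft i) ∧
    (mu ∘ simpleSwap i) (rgt j) = mu (rgt j) ∧ (mu ∘ simpleSwap j) (lft i) = mu (lft i) ∧
    (mu ∘ simpleSwap j) (lft j) = mu (rgt j) ∧ (mu ∘ simpleSwap j) (rgt j) = mu (lft j) := by
  have hb : rgt i = lft j := by simp [lft, rgt, h]
  refine ⟨by simp [hb], by simp [← hb], ?_, ?_, by simp, by simp⟩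
  · rw [Function.comp_apply, simpleSwap_of_ne (lft_ne_rgt' (by omega)).symm (rgt_ne_rgt (by omega))]
  · rw [Function.comp_apply, simpleSwap_of_ne (lft_ne_lft (by omega)) (lft_ne_rgt' (by omega))]

theorem simpleSwap_comp_braid {i j : Fin (n - 1)} (h : i.1 + 1 = j.1) (mu : Fin n → ℕ) :
    ((mu ∘ simpleSwap i) ∘ simpleSwap j) ∘ simpleSwap i =
      ((mu ∘ simpleSwap j) ∘ simpleSwap i) ∘ simpleSwap j := by
  have hb : rgt i = lft j := by simp [lft, rgt, h]
  have hl : simpleSwap j (lft i) = lft i :=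
    simpleSwap_of_ne (lft_ne_lft (by omega)) (lft_ne_rgt' (by omega))
  have hr : simpleSwap i (rgt j) = rgt j :=
    simpleSwap_of_ne (lft_ne_rgt' (by omega)).symm (rgt_ne_rgt (by omega))
  have hj : simpleSwap i (lft j) = lft i := by rw [← hb, simpleSwap_rgt]
  ext k
  simp only [Function.comp_apply]
  by_cases h1 : k = lft i
  · subst h1; simp [hl, hr, hb]
  by_cases h2 : k = rgt i
  · subst h2; simp [hl, hr, hj, hb]
  by_cases h3 : k = rgt j
  · subst h3; simp [hl, hr, hj]
  have e1 : simpleSwap i k = k := simpleSwap_of_ne h1 h2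
  have e2 : simpleSwap j k = k := simpleSwap_of_ne (hb ▸ h2) h3
  rw [e1, e2, e1, e2]

/-- Path independence: the value of the family can be computed from any ascent, and the family is
an eigenvector where neighbours are equal. -/
theorem heckeFamily_spec (t : K) {g : MvPolynomial (Fin n) K} {lam : Fin n → ℕ} (hl : Antitone lam)
    (hg : ∀ i : Fin (n - 1), lam (lft i) = lam (rgt i) → heckeGen t i g = t • g) (d : ℕ) :
    ∀ mu : Fin n → ℕ, invs mu = d → (∃ s : Equiv.Perm (Fin n), lam ∘ s = mu) →
      (∀ i : Fin (n - 1), mu (lft i) < mu (rgt i) →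
        heckeFamily t g mu = heckeGen t i (heckeFamily t g (mu ∘ simpleSwap i))) ∧
      (∀ i : Fin (n - 1), mu (lft i) = mu (rgt i) →
        heckeGen t i (heckeFamily t g mu) = t • heckeFamily t g mu) := by
  induction d using Nat.strong_induction_on with
  | _ d ih =>
  have IH1 : ∀ mu : Fin n → ℕ, invs mu < d → (∃ s : Equiv.Perm (Fin n), lam ∘ s = mu) →
      ∀ i : Fin (n - 1), mu (lft i) < mu (rgt i) →
        heckeFamily t g mu = heckeGen t i (heckeFamily t g (mu ∘ simpleSwap i)) :=
    fun mu h hs => (ih _ h mu rfl hs).1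
  have IH2 : ∀ mu : Fin n → ℕ, invs mu < d → (∃ s : Equiv.Perm (Fin n), lam ∘ s = mu) →
      ∀ i : Fin (n - 1), mu (lft i) = mu (rgt i) →
        heckeGen t i (heckeFamily t g mu) = t • heckeFamily t g mu :=
    fun mu h hs => (ih _ h mu rfl hs).2
  have orb : ∀ (mu : Fin n → ℕ) (i : Fin (n - 1)), (∃ s : Equiv.Perm (Fin n), lam ∘ s = mu) →
      ∃ s : Equiv.Perm (Fin n), lam ∘ s = mu ∘ simpleSwap i := by
    rintro _ i ⟨s, rfl⟩
    exact ⟨s * simpleSwap i, rfl⟩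
  rintro mu rfl hmu
  have step : ∀ i : Fin (n - 1), mu (lft i) < mu (rgt i) → invs (mu ∘ simpleSwap i) < invs mu :=
    fun i h => by rw [invs_comp_simpleSwap mu i h]; omega
  have step' : ∀ (nu : Fin n → ℕ) (i : Fin (n - 1)), invs nu < invs mu → nu (lft i) < nu (rgt i) →
      invs (nu ∘ simpleSwap i) < invs mu :=
    fun nu i h h' => by rw [invs_comp_simpleSwap nu i h'] at h; omega
  -- the two one-step computations agree
  have far : ∀ i j : Fin (n - 1), i.1 + 1 < j.1 → mu (lft i) < mu (rgt i) →
      mu (lft j) < mu (rgt j) → heckeGen t i (heckeFamily t g (mu ∘ simpleSwap i)) =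
        heckeGen t j (heckeFamily t g (mu ∘ simpleSwap j)) := by
    intro i j hij hi hj
    obtain ⟨a1, a2⟩ := comp_simpleSwap_lft_rgt_of_far (Or.inl hij) mu
    obtain ⟨b1, b2⟩ := comp_simpleSwap_lft_rgt_of_far (i := j) (j := i) (Or.inr hij) mu
    rw [IH1 _ (step i hi) (orb _ _ hmu) j (by rw [a1, a2]; exact hj),
      IH1 _ (step j hj) (orb _ _ hmu) i (by rw [b1, b2]; exact hi),
      heckeGen_comm t hij, simpleSwap_comp_comm hij]
  -- Here three consecutive entries increase. Either first step can be continued by two more ascents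
  -- to the same composition, and the two words are the two sides of the braid relation.
  have adj : ∀ i j : Fin (n - 1), i.1 + 1 = j.1 → mu (lft i) < mu (rgt i) →
      mu (lft j) < mu (rgt j) → heckeGen t i (heckeFamily t g (mu ∘ simpleSwap i)) =
        heckeGen t j (heckeFamily t g (mu ∘ simpleSwap j)) := by
    intro i j hij hi hj
    have hb : rgt i = lft j := by simp [lft, rgt, hij]
    rw [hb] at hi
    obtain ⟨a1, a2, a3, a4, a5, a6⟩ := comp_simpleSwap_adj hij mu
    obtain ⟨b1, b2, b3, b4, b5, b6⟩ := comp_simpleSwap_adj hij (mu ∘ simpleSwap i)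
    obtain ⟨c1, c2, c3, c4, c5, c6⟩ := comp_simpleSwap_adj hij (mu ∘ simpleSwap j)
    have hi' : mu (lft i) < mu (rgt i) := by rwa [hb]
    have e1 : (mu ∘ simpleSwap i) (lft j) < (mu ∘ simpleSwap i) (rgt j) := by
      rw [a2, a3]; omega
    have e2 : (mu ∘ simpleSwap j) (lft i) < (mu ∘ simpleSwap j) (rgt i) := by
      rw [hb, a4, a5]; omega
    have e3 : ((mu ∘ simpleSwap i) ∘ simpleSwap j) (lft i) <
        ((mu ∘ simpleSwap i) ∘ simpleSwap j) (rgt i) := by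
      rw [hb, b4, b5, a1, a3]; omega
    have e4 : ((mu ∘ simpleSwap j) ∘ simpleSwap i) (lft j) <
        ((mu ∘ simpleSwap j) ∘ simpleSwap i) (rgt j) := by
      rw [c2, c3, a4, a6]; omega
    rw [IH1 _ (step i hi') (orb _ _ hmu) j e1,
      IH1 _ (step' _ j (step i hi') e1) (orb _ _ (orb _ _ hmu)) i e3,
      IH1 _ (step j hj) (orb _ _ hmu) i e2,
      IH1 _ (step' _ i (step j hj) e2) (orb _ _ (orb _ _ hmu)) j e4,
      heckeGen_braid t hij, simpleSwap_comp_braid hij]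
  have indep : ∀ i j : Fin (n - 1), mu (lft i) < mu (rgt i) →
      mu (lft j) < mu (rgt j) → heckeGen t i (heckeFamily t g (mu ∘ simpleSwap i)) =
        heckeGen t j (heckeFamily t g (mu ∘ simpleSwap j)) := by
    intro i j hi hj
    rcases lt_trichotomy i.1 j.1 with h | h | h
    · rcases Nat.lt_or_ge (i.1 + 1) j.1 with h' | h'
      · exact far i j h' hi hj
      · exact adj i j (by omega) hi hj
    · rw [Fin.ext h]
    · rcases Nat.lt_or_ge (j.1 + 1) i.1 with h' | h'
      · exact (far j i h' hj hi).symm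
      · exact (adj j i (by omega) hj hi).symm
  have asc : ∀ i : Fin (n - 1), mu (lft i) < mu (rgt i) →
        heckeFamily t g mu = heckeGen t i (heckeFamily t g (mu ∘ simpleSwap i)) := by
    intro i hi
    have hex : ∃ i : Fin (n - 1), mu (lft i) < mu (rgt i) := ⟨i, hi⟩
    rw [heckeFamily, dif_pos hex]
    exact indep _ _ hex.choose_spec hi
  refine ⟨asc, fun j hj => ?_⟩
  by_cases hex : ∃ i : Fin (n - 1), mu (lft i) < mu (rgt i)
  · obtain ⟨i, hi⟩ := hex
    rcases lt_trichotomy i.1 j.1 with h | h | h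
    · rcases Nat.lt_or_ge (i.1 + 1) j.1 with h' | h'
      · obtain ⟨a1, a2⟩ := comp_simpleSwap_lft_rgt_of_far (Or.inl h') mu
        rw [asc i hi, ← heckeGen_comm t h', IH2 _ (step i hi) (orb _ _ hmu) j (by rw [a1, a2, hj]),
          map_smul]
      -- The equal pair at j, j+1 is moved to i, i+1 by unfolding T_i T_j; the braid relation turns
      -- T_j T_i T_j into T_i T_j T_i, whose innermost factor acts by t.
      · have hij : i.1 + 1 = j.1 := by omega
        have hb : rgt i = lft j := by simp [lft, rgt, hij]
        obtain ⟨a1, a2, a3, a4, a5, a6⟩ := comp_simpleSwap_adj hij mu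
        obtain ⟨b1, b2, b3, b4, b5, b6⟩ := comp_simpleSwap_adj hij (mu ∘ simpleSwap i)
        have hi' := hi
        rw [hb] at hi'
        have e1 : (mu ∘ simpleSwap i) (lft j) < (mu ∘ simpleSwap i) (rgt j) := by
          rw [a2, a3]; omega
        have e2 : ((mu ∘ simpleSwap i) ∘ simpleSwap j) (lft i) =
          ((mu ∘ simpleSwap i) ∘ simpleSwap j) (rgt i) := by rw [hb, b4, b5, a1, a3, hj]
        rw [asc i hi, IH1 _ (step i hi) (orb _ _ hmu) j e1, ← heckeGen_braid t hij,
          IH2 _ (step' _ j (step i hi) e1) (orb _ _ (orb _ _ hmu)) i e2, map_smul, map_smul]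
    · rw [Fin.ext h] at hi; omega
    · rcases Nat.lt_or_ge (j.1 + 1) i.1 with h' | h'
      · obtain ⟨a1, a2⟩ := comp_simpleSwap_lft_rgt_of_far (Or.inr h') mu
        rw [asc i hi, heckeGen_comm t h', IH2 _ (step i hi) (orb _ _ hmu) j (by rw [a1, a2, hj]),
          map_smul]
      · have hij : j.1 + 1 = i.1 := by omega
        have hb : rgt j = lft i := by simp [lft, rgt, hij]
        obtain ⟨a1, a2, a3, a4, a5, a6⟩ := comp_simpleSwap_adj hij mu
        obtain ⟨b1, b2, b3, b4, b5, b6⟩ := comp_simpleSwap_adj hij (mu ∘ simpleSwap i)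
        obtain ⟨c1, c2, c3, c4, c5, c6⟩ := comp_simpleSwap_adj hij (mu ∘ simpleSwap i)
        rw [hb] at hj
        have e1 : (mu ∘ simpleSwap i) (lft j) < (mu ∘ simpleSwap i) (rgt j) := by
          rw [hb, a4, a5]; omega
        obtain ⟨d1, d2, d3, d4, d5, d6⟩ := comp_simpleSwap_adj hij ((mu ∘ simpleSwap i))
        have e2 : ((mu ∘ simpleSwap i) ∘ simpleSwap j) (lft i) =
          ((mu ∘ simpleSwap i) ∘ simpleSwap j) (rgt i) := by
          rw [d2, d3, a4, a6, hj]
        rw [asc i hi, IH1 _ (step i hi) (orb _ _ hmu) j e1, heckeGen_braid t hij,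
          IH2 _ (step' _ j (step i hi) e1) (orb _ _ (orb _ _ hmu)) i e2, map_smul, map_smul]
  · push Not at hex
    have ha := antitone_of_forall_le hex
    obtain ⟨s, rfl⟩ := hmu
    rw [comp_perm_eq_of_antitone hl ha] at hj ⊢
    rw [heckeFamily_of_antitone t g hl]
    exact hg j hj

theorem isHeckeFamily_heckeFamily (t : K) {g : MvPolynomial (Fin n) K} {lam : Fin n → ℕ}
    (hl : Antitone lam)
    (hg : ∀ i : Fin (n - 1), lam (lft i) = lam (rgt i) → heckeGen t i g = t • g) :
    IsHeckeFamily t lam (heckeFamily t g) where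
  desc s i h := by
    have := (heckeFamily_spec t hl hg _ ((lam ∘ s) ∘ simpleSwap i) rfl ⟨s * simpleSwap i, rfl⟩).1 i
      (by simpa using h)
    rw [this, comp_simpleSwap_comp_simpleSwap]
  eq s i h := (heckeFamily_spec t hl hg _ (lam ∘ s) rfl ⟨s, rfl⟩).2 i h

end Family

/-! ### Shortest coset representatives and reduced words. -/

section Words

variable {n : ℕ}

theorem act_eq_comp (s : Equiv.Perm (Fin n)) (mu : Fin n → ℕ) : act s mu = mu ∘ ⇑(s⁻¹) := rfl

@[simp]
theorem act_one (mu : Fin n → ℕ) : act 1 mu = mu := rfl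

theorem act_simpleSwap_mul (i : Fin (n - 1)) (s : Equiv.Perm (Fin n)) (mu : Fin n → ℕ) :
    act (simpleSwap i * s) mu = act s mu ∘ simpleSwap i := by
  ext k
  simp [act]

theorem invs_comp_simpleSwap_le (mu : Fin n → ℕ) (i : Fin (n - 1)) :
    invs (mu ∘ simpleSwap i) ≤ invs mu + 1 := by
  rcases lt_trichotomy (mu (lft i)) (mu (rgt i)) with h | h | h
  · rw [invs_comp_simpleSwap mu i h]; omega
  · rw [comp_simpleSwap_of_eq h]; omega
  · rw [invs_comp_simpleSwap (mu ∘ simpleSwap i) i (by simpa using h),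
      comp_simpleSwap_comp_simpleSwap]

theorem invs_eq_zero_of_antitone {lam : Fin n → ℕ} (hl : Antitone lam) : invs lam = 0 := by
  rw [invs, Finset.card_eq_zero, Finset.filter_eq_empty_iff]
  rintro ⟨a, b⟩ - ⟨h1, h2⟩
  exact absurd (hl h1.le) (not_le.2 h2)

theorem invs_act_prod_le_length {lam : Fin n → ℕ} (hl : Antitone lam) (w : List (Fin (n - 1))) :
    invs (act (w.map simpleSwap).prod lam) ≤ w.length := by
  induction w with
  | nil => simp [invs_eq_zero_of_antitone hl]
  | cons i w ih =>
    rw [List.map_cons, List.prod_cons, act_simpleSwap_mul, List.length_cons]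
    exact (invs_comp_simpleSwap_le _ i).trans (by omega)

/-- Each letter adds at most one inversion. If the number of inversions equals the length, every
letter is applied at a descent, where T_i merely relabels the member of the family. -/
theorem IsHeckeFamily.prod_apply {K : Type*} [Field K] {t : K} {lam : Fin n → ℕ}
    {f : (Fin n → ℕ) → MvPolynomial (Fin n) K} (hf : IsHeckeFamily t lam f) (hl : Antitone lam)
    (w : List (Fin (n - 1)))
    (hw : invs (act (w.map simpleSwap).prod lam) = w.length) :
    (w.map (heckeGen t)).prod (f lam) = f (act (w.map simpleSwap).prod lam) := by
  induction w with
  | nil => simp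
  | cons i w ih =>
    rw [List.map_cons, List.prod_cons, act_simpleSwap_mul, List.length_cons] at *
    have h1 := invs_act_prod_le_length hl w
    set mu := act (w.map simpleSwap).prod lam with hmu
    have hd : mu (rgt i) < mu (lft i) := by
      by_contra hc
      rcases (not_lt.1 hc).lt_or_eq with h | h
      · rw [invs_comp_simpleSwap mu i h] at h1; omega
      · rw [comp_simpleSwap_of_eq h] at hw; omega
    have h2 := invs_comp_simpleSwap_le mu i
    rw [List.map_cons, List.prod_cons, Module.End.mul_apply, ih (by omega), hmu, act_eq_comp]
    exact hf.desc _ i hd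

theorem exists_word_of_orbit {lam : Fin n → ℕ} (hl : Antitone lam) (d : ℕ) :
    ∀ mu : Fin n → ℕ, invs mu = d → (∃ s : Equiv.Perm (Fin n), lam ∘ s = mu) →
      ∃ w : List (Fin (n - 1)), act (w.map simpleSwap).prod lam = mu ∧ w.length = d := by
  induction d with
  | zero =>
    rintro _ h ⟨s, rfl⟩
    refine ⟨[], ?_, rfl⟩
    have ha : Antitone (lam ∘ s) := by
      apply antitone_of_forall_le
      intro i
      by_contra hc
      rw [invs_comp_simpleSwap _ i (not_le.1 hc)] at h
      omega
    rw [comp_perm_eq_of_antitone hl ha]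
    simp
  | succ d ih =>
    rintro mu h ⟨s, hs⟩
    by_cases hex : ∃ i : Fin (n - 1), mu (lft i) < mu (rgt i)
    · obtain ⟨i, hi⟩ := hex
      rw [invs_comp_simpleSwap mu i hi] at h
      obtain ⟨w, hw, hwl⟩ := ih (mu ∘ simpleSwap i) (by omega) ⟨s * simpleSwap i, by rw [← hs]; rfl⟩
      refine ⟨i :: w, ?_, by simp [hwl]⟩
      rw [List.map_cons, List.prod_cons, act_simpleSwap_mul, hw, comp_simpleSwap_comp_simpleSwap]
    · push Not at hex
      rw [invs_eq_zero_of_antitone (antitone_of_forall_le hex)] at h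
      omega

theorem prod_reducedWord (s : Equiv.Perm (Fin n)) :
    ((reducedWord s).map simpleSwap).prod = s :=
  (Classical.choose_spec (exists_isReducedWord s)).1

theorem permLength_le (w : List (Fin (n - 1))) :
    permLength (w.map simpleSwap).prod ≤ w.length :=
  (Classical.choose_spec (exists_isReducedWord _)).2 w rfl

theorem invs_act_le_permLength {lam : Fin n → ℕ} (hl : Antitone lam) (s : Equiv.Perm (Fin n)) :
    invs (act s lam) ≤ permLength s := by
  have := invs_act_prod_le_length hl (reducedWord s)
  rwa [prod_reducedWord] at this

theorem mem_distinctPerms {mu : Fin n → ℕ} {s : Equiv.Perm (Fin n)} :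
    s ∈ distinctPerms mu ↔
      ∀ u : Equiv.Perm (Fin n), act u mu = act s mu → permLength s ≤ permLength u := by
  simp [distinctPerms]

/-- Bubble sort gives a word whose length is the inversion number of the rearranged composition, and
no word reaching that composition is shorter. -/
theorem mem_distinctPerms_iff {lam : Fin n → ℕ} (hl : Antitone lam) {s : Equiv.Perm (Fin n)} :
    s ∈ distinctPerms lam ↔ permLength s = invs (act s lam) := by
  rw [mem_distinctPerms]
  constructor
  · intro h
    obtain ⟨w, hw, hwl⟩ := exists_word_of_orbit hl _ (act s lam) rfl ⟨s⁻¹, rfl⟩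
    exact ((h _ hw).trans ((permLength_le w).trans hwl.le)).antisymm (invs_act_le_permLength hl s)
  · intro h u hu
    rw [h, ← hu]
    exact invs_act_le_permLength hl u

theorem IsHeckeFamily.heckeT_apply {K : Type*} [Field K] {t : K} {lam : Fin n → ℕ}
    {f : (Fin n → ℕ) → MvPolynomial (Fin n) K} (hf : IsHeckeFamily t lam f) (hl : Antitone lam)
    {s : Equiv.Perm (Fin n)} (hs : s ∈ distinctPerms lam) :
    heckeT t s (f lam) = f (act s lam) := by
  have := hf.prod_apply hl (reducedWord s)
  rw [prod_reducedWord] at this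
  exact this ((mem_distinctPerms_iff hl).1 hs).symm

/-- A shortest coset representative preserves the order of the places of equal parts. -/
theorem lt_of_mem_distinctPerms {lam : Fin n → ℕ} (hl : Antitone lam) {s : Equiv.Perm (Fin n)}
    (hs : s ∈ distinctPerms lam) {a b : Fin n} (hab : a < b) (he : act s lam a = act s lam b) :
    s⁻¹ a < s⁻¹ b := by
  by_contra hc
  have hlt : s⁻¹ b < s⁻¹ a := lt_of_le_of_ne (not_lt.1 hc) (fun e => hab.ne' (s⁻¹.injective e))
  -- The inversions of a strictly decreasing composition under s are all inversions of s. They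
  -- include those seen by `lam`, and an inverted pair of equal parts would be an additional one,
  -- exceeding the length of s.
  set st : Fin n → ℕ := fun k => n - k.1 with hst
  have hsta : Antitone st := by
    intro x y hxy
    have : x.1 ≤ y.1 := hxy
    simp only [hst]; omega
  have h1 := invs_act_le_permLength hsta s
  rw [(mem_distinctPerms_iff hl).1 hs] at h1
  have hsub : (Finset.univ.filter fun p : Fin n × Fin n =>
      p.1 < p.2 ∧ act s lam p.1 < act s lam p.2) ⊂
      (Finset.univ.filter fun p : Fin n × Fin n =>
      p.1 < p.2 ∧ act s st p.1 < act s st p.2) := by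
    rw [Finset.ssubset_iff_of_subset]
    · refine ⟨(a, b), ?_, ?_⟩
      · simp only [Finset.mem_filter, Finset.mem_univ, true_and]
        refine ⟨hab, ?_⟩
        have : (s⁻¹ b).1 < (s⁻¹ a).1 := hlt
        have := (s⁻¹ a).2
        simp only [act, hst]; omega
      · simp only [Finset.mem_filter, Finset.mem_univ, true_and, not_and]
        intro _
        exact he.not_lt
    · rintro ⟨x, y⟩ h
      simp only [Finset.mem_filter, Finset.mem_univ, true_and] at h ⊢
      refine ⟨h.1, ?_⟩
      have hxy : s⁻¹ y < s⁻¹ x := by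
        by_contra hc
        exact absurd (hl (not_lt.1 hc)) (not_le.2 h.2)
      have : (s⁻¹ y).1 < (s⁻¹ x).1 := hxy
      have := (s⁻¹ x).2
      simp only [act, hst]; omega
  exact absurd (Finset.card_lt_card hsub) (not_lt.2 h1)

/-- On the places where the rearranged composition has a given value, s⁻¹ is increasing, and its
image is the set of places where `lam` has that value. An increasing enumeration is determined by
its image. -/
theorem act_injOn_distinctPerms {lam : Fin n → ℕ} (hl : Antitone lam) :
    Set.InjOn (fun s => act s lam) (distinctPerms lam : Set (Equiv.Perm (Fin n))) := by
  intro s hs u hu hsu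
  have hsu : act s lam = act u lam := hsu
  suffices h : s⁻¹ = u⁻¹ from inv_injective h
  ext a : 1
  set v := act s lam a with hv
  have mono : ∀ w ∈ distinctPerms lam, act w lam = act s lam →
      StrictMono (fun x : {x // act s lam x = v} => w⁻¹ x.1) := by
    intro w hw he x y hxy
    exact lt_of_mem_distinctPerms hl hw hxy (by rw [he, x.2, y.2])
  have rng : ∀ w : Equiv.Perm (Fin n), act w lam = act s lam →
      Set.range (fun x : {x // act s lam x = v} => w⁻¹ x.1) = {y | lam y = v} := by
    intro w he
    ext y
    constructor
    · rintro ⟨x, rfl⟩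
      exact (congrFun he x.1).trans x.2
    · intro hy
      refine ⟨⟨w y, ?_⟩, by simp⟩
      rw [← congrFun he]
      simpa [act] using hy
  have := ((mono s hs rfl).range_inj (mono u hu hsu.symm)).1 (by rw [rng s rfl, rng u hsu.symm])
  exact congrFun this ⟨a, rfl⟩

/-- The orbit of a composition under the permutations of the places. -/
def orbit (mu : Fin n → ℕ) : Finset (Fin n → ℕ) :=
  Finset.univ.image fun s : Equiv.Perm (Fin n) => mu ∘ s

theorem mem_orbit {mu nu : Fin n → ℕ} :
    nu ∈ orbit mu ↔ ∃ s : Equiv.Perm (Fin n), mu ∘ s = nu := by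
  simp [orbit]

theorem comp_mem_orbit {mu nu : Fin n → ℕ} (h : nu ∈ orbit mu) (s : Equiv.Perm (Fin n)) :
    nu ∘ s ∈ orbit mu := by
  obtain ⟨u, rfl⟩ := mem_orbit.1 h
  exact mem_orbit.2 ⟨u * s, rfl⟩

theorem self_mem_orbit (mu : Fin n → ℕ) : mu ∈ orbit mu := mem_orbit.2 ⟨1, rfl⟩

theorem image_act_distinctPerms {lam : Fin n → ℕ} (hl : Antitone lam) :
    (distinctPerms lam).image (fun s => act s lam) = orbit lam := by
  ext mu
  simp only [Finset.mem_image]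
  constructor
  · rintro ⟨s, -, rfl⟩
    exact mem_orbit.2 ⟨s⁻¹, rfl⟩
  · intro h
    obtain ⟨w, hw, hwl⟩ := exists_word_of_orbit hl _ mu rfl (mem_orbit.1 h)
    refine ⟨_, (mem_distinctPerms_iff hl).2 (le_antisymm ?_ (invs_act_le_permLength hl _)), hw⟩
    rw [hw, ← hwl]
    exact permLength_le w

theorem sum_distinctPerms {M : Type*} [AddCommMonoid M] {lam : Fin n → ℕ} (hl : Antitone lam)
    (G : (Fin n → ℕ) → M) :
    ∑ s ∈ distinctPerms lam, G (act s lam) = ∑ nu ∈ orbit lam, G nu := by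
  rw [← image_act_distinctPerms hl, Finset.sum_image (act_injOn_distinctPerms hl)]

theorem sum_orbit_comp {M : Type*} [AddCommMonoid M] (mu : Fin n → ℕ) (s : Equiv.Perm (Fin n))
    (G : (Fin n → ℕ) → M) :
    ∑ nu ∈ orbit mu, G (nu ∘ s) = ∑ nu ∈ orbit mu, G nu := by
  refine Finset.sum_nbij' (fun nu => nu ∘ s) (fun nu => nu ∘ ⇑(s⁻¹)) ?_ ?_ ?_ ?_ ?_
  · exact fun nu h => comp_mem_orbit h s
  · exact fun nu h => comp_mem_orbit h _
  · intro nu _; ext k; simp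
  · intro nu _; ext k; simp
  · intro nu _; rfl

end Words

/-! ### The Hecke action transferred to coefficient functions on an orbit. -/

section OrbitSums

variable {K : Type*} [Field K] {n : ℕ}

/-- The combination `∑_ν h(ν) f(ν ∘ ρ)` over the orbit of `kap`. -/
noncomputable def orbitSum (kap : Fin n → ℕ) (f : (Fin n → ℕ) → MvPolynomial (Fin n) K)
    (r : Equiv.Perm (Fin n)) (h : (Fin n → ℕ) → K) : MvPolynomial (Fin n) K :=
  ∑ nu ∈ orbit kap, h nu • f (nu ∘ r)

theorem orbitSum_congr {kap : Fin n → ℕ} {f : (Fin n → ℕ) → MvPolynomial (Fin n) K}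
    {r : Equiv.Perm (Fin n)} {h h' : (Fin n → ℕ) → K} (H : ∀ nu ∈ orbit kap, h nu = h' nu) :
    orbitSum kap f r h = orbitSum kap f r h' :=
  Finset.sum_congr rfl fun nu hnu => by rw [H nu hnu]

theorem orbitSum_smul (kap : Fin n → ℕ) (f : (Fin n → ℕ) → MvPolynomial (Fin n) K)
    (r : Equiv.Perm (Fin n)) (c : K) (h : (Fin n → ℕ) → K) :
    orbitSum kap f r (fun nu => c * h nu) = c • orbitSum kap f r h := by
  simp only [orbitSum, Finset.smul_sum, smul_smul]

theorem orbitSum_mul (kap : Fin n → ℕ) (f : (Fin n → ℕ) → MvPolynomial (Fin n) K)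
    (p r : Equiv.Perm (Fin n)) (h : (Fin n → ℕ) → K) :
    orbitSum kap f (p * r) h = orbitSum kap f r (fun nu => h (nu ∘ ⇑(p⁻¹))) := by
  rw [orbitSum, orbitSum, ← sum_orbit_comp kap p⁻¹]
  refine Finset.sum_congr rfl fun nu _ => ?_
  congr 2
  ext k
  simp

/-- The entries of ν belong to labelled columns and r tells which column stands at which place. T_i
exchanges the neighbouring columns a and b; the extra term (t - 1) f, which the quadratic relation
produces at an ascent, is brought to the new arrangement by exchanging the entries of a and b. -/
theorem IsHeckeFamily.heckeGen_orbitSum {t : K} {kap : Fin n → ℕ}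
    {f : (Fin n → ℕ) → MvPolynomial (Fin n) K} (hf : IsHeckeFamily t kap f)
    (r : Equiv.Perm (Fin n)) (i : Fin (n - 1)) (h : (Fin n → ℕ) → K) :
    heckeGen t i (orbitSum kap f r h) = orbitSum kap f (r * simpleSwap i) fun nu =>
      if nu (r (lft i)) ≤ nu (r (rgt i)) then t * h nu
      else h nu + (t - 1) * h (nu ∘ Equiv.swap (r (lft i)) (r (rgt i))) := by
  set a := r (lft i)
  set b := r (rgt i)
  have key : ∀ nu ∈ orbit kap, heckeGen t i (f (nu ∘ r)) =
      (if nu b < nu a then (1 : K) else t) • f (nu ∘ ⇑(r * simpleSwap i)) +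
      (if nu a < nu b then t - 1 else 0) • f (nu ∘ r) := by
    intro nu hnu
    obtain ⟨s, rfl⟩ := mem_orbit.1 hnu
    have e : (kap ∘ s) ∘ ⇑(r * simpleSwap i) = (kap ∘ ⇑(s * r)) ∘ simpleSwap i := rfl
    have e' : (kap ∘ s) ∘ r = kap ∘ ⇑(s * r) := rfl
    rw [e, e']
    rcases lt_trichotomy ((kap ∘ s) a) ((kap ∘ s) b) with h | h | h
    · have h' := hf.desc (s * r * simpleSwap i) i (by simpa using h)
      have e3 : kap ∘ ⇑(s * r * simpleSwap i) = (kap ∘ ⇑(s * r)) ∘ simpleSwap i := rfl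
      rw [e3, comp_simpleSwap_comp_simpleSwap] at h'
      rw [← h', heckeGen_quadratic, if_neg h.asymm, if_pos h, add_comm]
    · rw [if_neg (by omega), if_neg (by omega), zero_smul, add_zero, hf.eq (s * r) i h,
        comp_simpleSwap_of_eq]
      exact h
    · rw [if_pos h, if_neg h.asymm, zero_smul, one_smul, add_zero]
      exact hf.desc _ i h
  have hsw : ∀ nu : Fin n → ℕ, (nu ∘ Equiv.swap a b) ∘ ⇑(r * simpleSwap i) = nu ∘ r := by
    intro nu
    have : Equiv.swap a b * (r * simpleSwap i) = r := by
      rw [simpleSwap, Equiv.mul_swap_eq_swap_mul, ← mul_assoc, Equiv.swap_mul_self, one_mul]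
    change nu ∘ ⇑(Equiv.swap a b * (r * simpleSwap i)) = _
    rw [this]
  have h1 : heckeGen t i (orbitSum kap f r h) =
      ∑ nu ∈ orbit kap, (h nu * if nu b < nu a then (1 : K) else t) •
        f (nu ∘ ⇑(r * simpleSwap i)) +
      ∑ nu ∈ orbit kap, (h nu * if nu a < nu b then t - 1 else 0) •
        f ((nu ∘ Equiv.swap a b) ∘ ⇑(r * simpleSwap i)) := by
    rw [orbitSum, map_sum, ← Finset.sum_add_distrib]
    refine Finset.sum_congr rfl fun nu hnu => ?_
    rw [map_smul, key nu hnu, smul_add, smul_smul, smul_smul, hsw]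
  have h2 := sum_orbit_comp kap (Equiv.swap a b) (fun nu =>
    (h (nu ∘ Equiv.swap a b) * if nu b < nu a then t - 1 else 0) • f (nu ∘ ⇑(r * simpleSwap i)))
  have h3 : ∀ nu : Fin n → ℕ, (nu ∘ Equiv.swap a b) ∘ Equiv.swap a b = nu := by
    intro nu; ext k; simp
  simp only [h3, Function.comp_apply, Equiv.swap_apply_left, Equiv.swap_apply_right] at h2
  simp only [Function.comp_def] at h2 h1 ⊢
  rw [h1, h2, orbitSum, ← Finset.sum_add_distrib]
  refine Finset.sum_congr rfl fun nu _ => ?_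
  rw [← add_smul]
  congr 1
  by_cases hab : nu a ≤ nu b
  · rw [if_pos hab, if_neg (not_lt.2 hab), if_neg (not_lt.2 hab)]; ring
  · rw [if_neg hab, if_pos (not_le.1 hab), if_pos (not_le.1 hab)]; ring

end OrbitSums

/-! ### Moving one column through the others. -/

section Arrangements

variable {N : ℕ}

/-- The arrangement of the columns in which column `s` is moved to the place `m`, the order of
the other columns being kept. -/
def arr (s m : Fin (N + 1)) : Equiv.Perm (Fin (N + 1)) :=
  (finSuccEquiv' m).trans (finSuccEquiv' s).symm

@[simp]
theorem arr_self (s m : Fin (N + 1)) : arr s m m = s := by simp [arr]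

@[simp]
theorem arr_succAbove (s m : Fin (N + 1)) (j : Fin N) : arr s m (m.succAbove j) = s.succAbove j := by
  simp [arr]

theorem arr_same (s : Fin (N + 1)) : arr s s = 1 := by
  ext k : 1; simp [arr]

theorem arr_castSucc_succ (s : Fin (N + 1)) (i : Fin N) :
    arr s i.castSucc i.succ = s.succAbove i := by
  conv_lhs => rw [← Fin.succAbove_castSucc_self i]
  exact arr_succAbove _ _ _

theorem arr_succ_castSucc (s : Fin (N + 1)) (i : Fin N) :
    arr s i.succ i.castSucc = s.succAbove i := by
  conv_lhs => rw [← Fin.succAbove_succ_self i]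
  exact arr_succAbove _ _ _

theorem arr_castSucc_mul (s : Fin (N + 1)) (i : Fin N) :
    arr s i.castSucc * simpleSwap (n := N + 1) i = arr s i.succ := by
  ext k : 1
  rw [Equiv.Perm.mul_apply]
  by_cases h1 : k = i.castSucc
  · subst h1
    rw [arr_succ_castSucc, ← lft_eq_castSucc, simpleSwap_lft, rgt_eq_succ, lft_eq_castSucc,
      arr_castSucc_succ]
  by_cases h2 : k = i.succ
  · subst h2
    rw [arr_self, ← rgt_eq_succ, simpleSwap_rgt, lft_eq_castSucc, arr_self]
  rw [simpleSwap_of_ne h1 h2]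
  obtain ⟨j, rfl⟩ := Fin.exists_succAbove_eq h1
  have hj : (i.castSucc.succAbove j) = i.succ.succAbove j := by
    rcases lt_trichotomy j i with h | h | h
    · rw [Fin.succAbove_of_castSucc_lt _ _ (Fin.castSucc_lt_castSucc_iff.2 h),
        Fin.succAbove_of_castSucc_lt _ _ (Fin.castSucc_lt_succ_iff.2 h.le)]
    · subst h; simp at h2
    · rw [Fin.succAbove_of_le_castSucc _ _ (Fin.castSucc_le_castSucc_iff.2 h.le),
        Fin.succAbove_of_le_castSucc _ _ (by simpa [Fin.le_def] using h)]
  rw [arr_succAbove, hj, arr_succAbove]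

theorem arr_succ_mul (s : Fin (N + 1)) (i : Fin N) :
    arr s i.succ * simpleSwap (n := N + 1) i = arr s i.castSucc := by
  rw [← arr_castSucc_mul, mul_assoc, simpleSwap_mul_self, mul_one]

theorem finRotate_castSucc (j : Fin N) : finRotate (N + 1) j.castSucc = j.succ := by
  rw [finRotate_apply]; simp

/-- This matches the cyclic relation: the rotation takes the first column to the end and keeps the
order of the rest. -/
theorem arr_zero_mul_finRotate (s : Fin (N + 1)) :
    arr s 0 * finRotate (N + 1) = arr s (Fin.last N) := by
  ext k : 1
  rw [Equiv.Perm.mul_apply]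
  induction k using Fin.lastCases with
  | last => rw [finRotate_last, arr_self, arr_self]
  | cast j =>
    rw [finRotate_castSucc, ← Fin.succAbove_zero_apply, arr_succAbove,
      ← Fin.succAbove_last_apply, arr_succAbove]

/-- All columns between s and m have the same height, because `lam` is antitone. -/
theorem comp_arr_of_le {lam : Fin (N + 1) → ℕ} (hl : Antitone lam) {s m : Fin (N + 1)}
    (h : lam s = lam m) : lam ∘ arr s m = lam := by
  ext k
  simp only [Function.comp_apply]
  by_cases hk : k = m
  · subst hk; rw [arr_self, h]
  obtain ⟨j, rfl⟩ := Fin.exists_succAbove_eq hk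
  rw [arr_succAbove]
  rcases lt_or_ge j.castSucc s with h1 | h1 <;> rcases lt_or_ge j.castSucc m with h2 | h2
  · rw [Fin.succAbove_of_castSucc_lt _ _ h1, Fin.succAbove_of_castSucc_lt _ _ h2]
  · rw [Fin.succAbove_of_castSucc_lt _ _ h1, Fin.succAbove_of_le_castSucc _ _ h2]
    have h1' : j.succ ≤ s := Fin.castSucc_lt_iff_succ_le.1 h1
    exact le_antisymm ((hl h2).trans (h ▸ hl h1')) (hl (Fin.castSucc_lt_succ).le)
  · rw [Fin.succAbove_of_le_castSucc _ _ h1, Fin.succAbove_of_castSucc_lt _ _ h2]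
    have h2' : j.succ ≤ m := Fin.castSucc_lt_iff_succ_le.1 h2
    exact le_antisymm (hl (Fin.castSucc_lt_succ).le) ((hl h1).trans (h ▸ hl h2'))
  · rw [Fin.succAbove_of_le_castSucc _ _ h1, Fin.succAbove_of_le_castSucc _ _ h2]

end Arrangements

/-! ### Recursion coefficients under the exchange of two entries. -/

section SwapSums

variable {ι : Type*} [Fintype ι] [DecidableEq ι]

/-- Balanced by additions on both sides, so that no truncated subtraction occurs. -/
theorem sum_comp_swap_add (F : ι → ℕ → ℕ) (nu : ι → ℕ) {s j : ι} (h : s ≠ j) :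
    ∑ k, F k ((nu ∘ Equiv.swap s j) k) + F s (nu s) + F j (nu j) =
      ∑ k, F k (nu k) + F s (nu j) + F j (nu s) := by
  have hj : j ∈ Finset.univ.erase s := by simp [h.symm]
  rw [← Finset.add_sum_erase _ _ (Finset.mem_univ s), ← Finset.add_sum_erase _ _ hj,
    ← Finset.add_sum_erase _ (fun k => F k (nu k)) (Finset.mem_univ s),
    ← Finset.add_sum_erase _ (fun k => F k (nu k)) hj]
  have : ∑ k ∈ (Finset.univ.erase s).erase j, F k ((nu ∘ Equiv.swap s j) k) =
      ∑ k ∈ (Finset.univ.erase s).erase j, F k (nu k) := by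
    refine Finset.sum_congr rfl fun k hk => ?_
    simp only [Finset.mem_erase, Finset.mem_univ, and_true] at hk
    rw [Function.comp_apply, Equiv.swap_apply_of_ne_of_ne hk.2 hk.1]
  rw [this]
  simp only [Function.comp_apply, Equiv.swap_apply_left, Equiv.swap_apply_right]
  omega

end SwapSums

section Coefficients

variable {K : Type*} [Field K] {n : ℕ}

/-- Every part of `lam` dominates strictly the entry of `nu` above it. -/
def Fits (lam nu : Fin n → ℕ) : Prop := ∀ k, lam k = 0 ∨ nu k < lam k

/-- The number of columns of height `v + 1` with an entry smaller than `v`. -/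
def defect (lam nu : Fin n → ℕ) (v : ℕ) : ℕ :=
  Finset.card {k : Fin n | lam k = v + 1 ∧ nu k + 1 < lam k}

/-- The number of parts between `1` and `v`. -/
def below (lam : Fin n → ℕ) (v : ℕ) : ℕ := Finset.card {k : Fin n | 0 < lam k ∧ lam k ≤ v}

/-- The sum of the entries of `nu` over the empty columns of `lam`. -/
def excess (lam nu : Fin n → ℕ) : ℕ := ∑ k, if lam k = 0 then nu k else 0

/-- The factor of the recursion coefficient for the `b` deficient columns of height `v + 1`. -/
noncomputable def defectFactor (q t : K) (lam : Fin n → ℕ) (v b : ℕ) : K :=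
  ∏ k ∈ Finset.Icc 1 b, (1 - t ^ k) / (1 - q ^ v * t ^ (below lam v + k))

open Classical in
/-- The coefficient of `f_ν` in the recursion for the family of `lam`. -/
noncomputable def recCoeff (q t : K) (lam nu : Fin n → ℕ) : K :=
  if Fits lam nu then q ^ excess lam nu *
    ∏ v ∈ Finset.Icc 1 (largest lam), defectFactor q t lam v (defect lam nu v) else 0

/-- The ratio by which the recursion coefficient changes when a deficient column is filled. -/
noncomputable def fillRatio (q t : K) (lam nu : Fin n → ℕ) (v : ℕ) : K :=
  (1 - q ^ v * t ^ (below lam v + defect lam nu v)) / (1 - t ^ defect lam nu v)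

/-- The genericity of the parameters which is used by the recursion. -/
structure Generic (q t : K) : Prop where
  q_ne : q ≠ 0
  t_ne : t ≠ 0
  one_sub_t : ∀ k : ℕ, 0 < k → 1 - t ^ k ≠ 0
  one_sub_qt : ∀ v k : ℕ, 0 < v → 1 - q ^ v * t ^ k ≠ 0

theorem recCoeff_of_not_fits {q t : K} {lam nu : Fin n → ℕ} (h : ¬Fits lam nu) :
    recCoeff q t lam nu = 0 := by rw [recCoeff, if_neg h]

theorem fits_comp_swap {lam nu : Fin n → ℕ} {s j : Fin n} (h : Fits lam nu)
    (hs : lam s = 0 ∨ nu j < lam s) (hj : lam j = 0 ∨ nu s < lam j) :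
    Fits lam (nu ∘ Equiv.swap s j) := by
  intro k
  rw [Function.comp_apply]
  by_cases h1 : k = s
  · subst h1; simpa using hs
  by_cases h2 : k = j
  · subst h2; simpa using hj
  rw [Equiv.swap_apply_of_ne_of_ne h1 h2]
  exact h k

theorem comp_swap_comp_swap (nu : Fin n → ℕ) (s j : Fin n) :
    (nu ∘ Equiv.swap s j) ∘ Equiv.swap s j = nu := by
  ext k; simp

theorem fits_comp_swap_iff {lam nu : Fin n → ℕ} {s j : Fin n}
    (hs : lam s = 0 ∨ nu j < lam s) (hj : lam j = 0 ∨ nu s < lam j)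
    (hs' : lam s = 0 ∨ nu s < lam s) (hj' : lam j = 0 ∨ nu j < lam j) :
    Fits lam (nu ∘ Equiv.swap s j) ↔ Fits lam nu := by
  refine ⟨fun h => ?_, fun h => fits_comp_swap h hs hj⟩
  have := fits_comp_swap h (s := s) (j := j) (by simpa using hs') (by simpa using hj')
  rwa [comp_swap_comp_swap] at this

theorem excess_comp_swap (lam nu : Fin n → ℕ) {s j : Fin n} (h : s ≠ j) :
    excess lam (nu ∘ Equiv.swap s j) + (if lam s = 0 then nu s else 0) +
      (if lam j = 0 then nu j else 0) =
    excess lam nu + (if lam s = 0 then nu j else 0) + (if lam j = 0 then nu s else 0) :=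
  sum_comp_swap_add (fun k x => if lam k = 0 then x else 0) nu h

theorem defect_comp_swap (lam nu : Fin n → ℕ) {s j : Fin n} (h : s ≠ j) (v : ℕ) :
    defect lam (nu ∘ Equiv.swap s j) v + (if lam s = v + 1 ∧ nu s + 1 < lam s then 1 else 0) +
      (if lam j = v + 1 ∧ nu j + 1 < lam j then 1 else 0) =
    defect lam nu v + (if lam s = v + 1 ∧ nu j + 1 < lam s then 1 else 0) +
      (if lam j = v + 1 ∧ nu s + 1 < lam j then 1 else 0) := by
  simp only [defect, Finset.card_filter]
  exact sum_comp_swap_add (fun k x => if lam k = v + 1 ∧ x + 1 < lam k then 1 else 0) nu h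

/-- Exchanging two entries which both fit and change no deficiency. -/
theorem recCoeff_swap_same (q t : K) {lam nu : Fin n → ℕ} {s j : Fin n} (h : s ≠ j)
    (hs : lam s = 0 ∨ nu j < lam s) (hj : lam j = 0 ∨ nu s < lam j)
    (hs' : lam s = 0 ∨ nu s < lam s) (hj' : lam j = 0 ∨ nu j < lam j)
    (fs : nu j + 1 < lam s ↔ nu s + 1 < lam s) (fj : nu j + 1 < lam j ↔ nu s + 1 < lam j) :
    recCoeff q t lam (nu ∘ Equiv.swap s j) *
        q ^ ((if lam s = 0 then nu s else 0) + (if lam j = 0 then nu j else 0)) =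
      recCoeff q t lam nu *
        q ^ ((if lam s = 0 then nu j else 0) + (if lam j = 0 then nu s else 0)) ∧
    ∀ v, fillRatio q t lam (nu ∘ Equiv.swap s j) v = fillRatio q t lam nu v := by
  have hd : ∀ v, defect lam (nu ∘ Equiv.swap s j) v = defect lam nu v := by
    intro v
    have := defect_comp_swap lam nu h v
    simp only [fs, fj] at this
    omega
  refine ⟨?_, fun v => by rw [fillRatio, fillRatio, hd]⟩
  have hiff := fits_comp_swap_iff hs hj hs' hj'
  by_cases hf : Fits lam nu
  · have he := excess_comp_swap lam nu h
    rw [recCoeff, recCoeff, if_pos (hiff.2 hf), if_pos hf]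
    simp only [hd]
    rw [mul_right_comm, mul_right_comm (q ^ excess lam nu), ← pow_add, ← pow_add]
    congr 2
    omega
  · rw [recCoeff_of_not_fits hf, recCoeff_of_not_fits (hiff.not.2 hf), zero_mul, zero_mul]

/-- The entry v enters the deficient column s of height v + 1. The defect at v drops by exactly one,
so the product loses its last factor, the inverse of `fillRatio`. The powers of q account for column
j being empty. -/
theorem recCoeff_swap_fill {q t : K} (H : Generic q t) {lam nu : Fin n → ℕ} {s j : Fin n}
    (h : s ≠ j) {v : ℕ} (hsv : lam s = v + 1) (hv : nu j = v) (hlt : nu s < v)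
    (hj' : lam j = 0 ∨ nu j < lam j) (fj : nu j + 1 < lam j ↔ nu s + 1 < lam j) :
    recCoeff q t lam (nu ∘ Equiv.swap s j) *
        q ^ (if lam j = 0 then nu j else 0) =
      fillRatio q t lam nu v * (recCoeff q t lam nu *
        q ^ (if lam j = 0 then nu s else 0)) := by
  have hd : ∀ w, defect lam (nu ∘ Equiv.swap s j) w + (if w = v then 1 else 0) =
      defect lam nu w := by
    intro w
    have := defect_comp_swap lam nu h w
    simp only [fj] at this
    rw [if_neg (c := lam s = w + 1 ∧ nu j + 1 < lam s) (by omega)] at this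
    by_cases hw : w = v
    · rw [if_pos (c := lam s = w + 1 ∧ nu s + 1 < lam s) (by omega)] at this
      rw [if_pos hw]; omega
    · rw [if_neg (c := lam s = w + 1 ∧ nu s + 1 < lam s) (by omega)] at this
      rw [if_neg hw]; omega
  have hdv := hd v
  rw [if_pos rfl] at hdv
  have he := excess_comp_swap lam nu h
  rw [if_neg (c := lam s = 0) (by omega), if_neg (c := lam s = 0) (by omega)] at he
  have hmem : v ∈ Finset.Icc 1 (largest lam) := by
    rw [Finset.mem_Icc]
    refine ⟨by omega, ?_⟩
    have : lam s ≤ largest lam := Finset.le_sup (f := lam) (Finset.mem_univ s)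
    omega
  have hiff := fits_comp_swap_iff (lam := lam) (nu := nu) (s := s) (j := j)
    (by omega) (by omega) (by omega) hj'
  by_cases hf : Fits lam nu
  swap
  · rw [recCoeff_of_not_fits hf, recCoeff_of_not_fits (hiff.not.2 hf), zero_mul, zero_mul, mul_zero]
  rw [recCoeff, recCoeff, if_pos (hiff.2 hf), if_pos hf, ← Finset.mul_prod_erase _ _ hmem,
    ← Finset.mul_prod_erase _ _ hmem]
  have hp : ∏ x ∈ (Finset.Icc 1 (largest lam)).erase v,
      defectFactor q t lam x (defect lam (nu ∘ Equiv.swap s j) x) =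
      ∏ x ∈ (Finset.Icc 1 (largest lam)).erase v, defectFactor q t lam x (defect lam nu x) := by
    refine Finset.prod_congr rfl fun w hw => ?_
    have := hd w
    rw [if_neg (Finset.ne_of_mem_erase hw)] at this
    rw [← this, add_zero]
  have hr : defectFactor q t lam v (defect lam (nu ∘ Equiv.swap s j) v) =
      fillRatio q t lam nu v * defectFactor q t lam v (defect lam nu v) := by
    rw [fillRatio, ← hdv, defectFactor, defectFactor, Finset.prod_Icc_succ_top (by omega)]
    have h1 := H.one_sub_t (defect lam (nu ∘ Equiv.swap s j) v + 1) (by omega)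
    have h2 := H.one_sub_qt v (below lam v + (defect lam (nu ∘ Equiv.swap s j) v + 1)) (by omega)
    field_simp
  rw [hp, hr]
  have he' : q ^ excess lam (nu ∘ Equiv.swap s j) * q ^ (if lam j = 0 then nu j else 0) =
      q ^ excess lam nu * q ^ (if lam j = 0 then nu s else 0) := by
    rw [← pow_add, ← pow_add]; congr 1
  linear_combination fillRatio q t lam nu v * defectFactor q t lam v (defect lam nu v) *
    (∏ x ∈ (Finset.Icc 1 (largest lam)).erase v, defectFactor q t lam x (defect lam nu x)) * he'

/-- The coefficient is invariant under the stabilizer of `lam`. -/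
theorem recCoeff_comp_perm (q t : K) {lam : Fin n → ℕ} {p : Equiv.Perm (Fin n)}
    (hp : lam ∘ p = lam) (nu : Fin n → ℕ) : recCoeff q t lam (nu ∘ p) = recCoeff q t lam nu := by
  have hp' : ∀ k, lam (p k) = lam k := congrFun hp
  have h1 : Fits lam (nu ∘ p) ↔ Fits lam nu := by
    unfold Fits
    rw [← p.forall_congr_right (q := fun k => lam k = 0 ∨ nu k < lam k)]
    simp only [hp', Function.comp_apply]
  have h2 : ∀ v, defect lam (nu ∘ p) v = defect lam nu v := by
    intro v
    simp only [defect, Finset.card_filter]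
    rw [← Equiv.sum_comp p (fun k => if lam k = v + 1 ∧ nu k + 1 < lam k then 1 else 0)]
    simp only [hp', Function.comp_apply]
  have h3 : excess lam (nu ∘ p) = excess lam nu := by
    unfold excess
    rw [← Equiv.sum_comp p (fun k => if lam k = 0 then nu k else 0)]
    simp only [hp', Function.comp_apply]
  by_cases hf : Fits lam nu
  · rw [recCoeff, recCoeff, if_pos hf, if_pos (h1.2 hf)]
    simp only [h2, h3]
  · rw [recCoeff_of_not_fits hf, recCoeff_of_not_fits (h1.not.2 hf)]

end Coefficients

/-! ### Factors acquired by a column that crosses other columns. -/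

section Passes

variable {K : Type*} [Field K] {n : ℕ}

/-- The factor acquired by a column `s` of height `p + 1` which has been moved to the left across
the columns in `S`. -/
noncomputable def leftFactor (q t : K) (lam : Fin n → ℕ) (p : ℕ) (s : Fin n) (S : Finset (Fin n))
    (nu : Fin n → ℕ) : K :=
  if nu s = p then t ^ (S.filter fun j => nu j ≤ p).card
  else t ^ (S.filter fun j => nu j < p).card *
    (1 - fillRatio q t lam nu p * (1 - t ^ (S.filter fun j => nu j = p).card))

/-- The factor acquired by a column `s` which has been moved to the right across the columns
in `S`. -/
noncomputable def rightFactor (q t : K) (lam : Fin n → ℕ) (s : Fin n) (S : Finset (Fin n))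
    (nu : Fin n → ℕ) : K :=
  t ^ ((S.filter fun j => nu s + 1 < lam j).card +
      (S.filter fun j => lam j = nu s + 1 ∧ nu s ≤ nu j).card) *
    (1 - fillRatio q t lam nu (nu s) *
      (1 - t ^ (S.filter fun j => lam j = nu s + 1 ∧ nu j < nu s).card))

theorem leftFactor_empty (q t : K) (lam : Fin n → ℕ) (p : ℕ) (s : Fin n) (nu : Fin n → ℕ) :
    leftFactor q t lam p s ∅ nu = 1 := by
  simp [leftFactor]

theorem rightFactor_empty (q t : K) (lam : Fin n → ℕ) (s : Fin n) (nu : Fin n → ℕ) :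
    rightFactor q t lam s ∅ nu = 1 := by
  simp [rightFactor]

theorem card_filter_insert {S : Finset (Fin n)} {j : Fin n} (hj : j ∉ S) (P : Fin n → Prop)
    [DecidablePred P] : ((insert j S).filter P).card = (S.filter P).card + if P j then 1 else 0 := by
  rw [Finset.filter_insert]
  split_ifs with h
  · rw [Finset.card_insert_of_notMem (by simp [hj])]
  · simp

theorem filter_comp_swap {S : Finset (Fin n)} {j s : Fin n} (hj : j ∉ S) (hs : s ∉ S)
    (nu : Fin n → ℕ) (P : Fin n → ℕ → Prop) [∀ k x, Decidable (P k x)] :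
    (S.filter fun k => P k ((nu ∘ Equiv.swap j s) k)) = S.filter fun k => P k (nu k) := by
  refine Finset.filter_congr fun k hk => ?_
  rw [Function.comp_apply, Equiv.swap_apply_of_ne_of_ne]
  · rintro rfl; exact hj hk
  · rintro rfl; exact hs hk

/-- The hypotheses on G record what exchanging the entries of s and j does: `h0` and `h1` are
misfits, `h2` is invariance, `h3` fills a deficient column. In the last case, with φ the fill ratio,
the step is t^a (1 - φ(1 - t^b)) + (t - 1) φ t^{a+b} = t^a (1 - φ(1 - t^{b+1})). G is left abstract
because crossing an empty column needs an additional power of q. -/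
theorem left_step (q t : K) (lam : Fin n → ℕ) {p : ℕ} {s j : Fin n} {S : Finset (Fin n)}
    (hj : j ∉ S) (hs : s ∉ S) {G : (Fin n → ℕ) → K} (nu : Fin n → ℕ)
    (h0 : p < nu s → G nu = 0)
    (h1 : nu s < nu j → p < nu j → G (nu ∘ Equiv.swap j s) = 0)
    (h2 : nu s < nu j → nu j < p → G (nu ∘ Equiv.swap j s) = G nu ∧
      fillRatio q t lam (nu ∘ Equiv.swap j s) p = fillRatio q t lam nu p)
    (h3 : nu s < nu j → nu j = p → G (nu ∘ Equiv.swap j s) = fillRatio q t lam nu p * G nu) :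
    (if nu j ≤ nu s then t * (G nu * leftFactor q t lam p s S nu)
      else G nu * leftFactor q t lam p s S nu + (t - 1) * (G (nu ∘ Equiv.swap j s) *
        leftFactor q t lam p s S (nu ∘ Equiv.swap j s))) =
    G nu * leftFactor q t lam p s (insert j S) nu := by
  simp only [leftFactor, card_filter_insert hj, Function.comp_apply, Equiv.swap_apply_right]
  have e1 := filter_comp_swap hj hs nu (fun _ x => x ≤ p)
  have e2 := filter_comp_swap hj hs nu (fun _ x => x < p)
  have e3 := filter_comp_swap hj hs nu (fun _ x => x = p)
  simp only [Function.comp_apply] at e1 e2 e3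
  rw [e1, e2, e3]
  have hsum : (S.filter fun k => nu k ≤ p).card =
      (S.filter fun k => nu k < p).card + (S.filter fun k => nu k = p).card := by
    rw [← Finset.card_union_of_disjoint, ← Finset.filter_or]
    · congr 1; ext k; simp [le_iff_lt_or_eq]
    · rw [Finset.disjoint_filter]; intro k _ h h'; omega
  rcases lt_trichotomy (nu s) p with hu | hu | hu
  · rw [if_neg hu.ne, if_neg hu.ne]
    rcases le_or_gt (nu j) (nu s) with hx | hx
    · rw [if_pos hx, if_pos (by omega), if_neg (by omega)]
      ring
    · rw [if_neg (by omega)]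
      rcases lt_trichotomy (nu j) p with hxp | hxp | hxp
      · rw [if_neg hxp.ne, if_pos hxp, if_neg hxp.ne, (h2 hx hxp).1, (h2 hx hxp).2]
        ring
      · rw [if_pos hxp, if_neg (by omega), if_pos hxp, h3 hx hxp, hsum]
        ring
      · rw [h1 hx hxp, zero_mul, mul_zero, if_neg (c := nu j < p) (by omega),
          if_neg (c := nu j = p) (by omega)]
        ring
  · rw [if_pos hu, if_pos hu]
    rcases le_or_gt (nu j) (nu s) with hx | hx
    · rw [if_pos hx, if_pos (by omega)]
      ring
    · rw [if_neg (by omega), h1 hx (by omega), if_neg (c := nu j ≤ p) (by omega)]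
      ring
  · rcases le_or_gt (nu j) (nu s) with hx | hx
    · rw [if_pos hx, h0 hu]; ring
    · rw [if_neg (by omega), h1 hx (by omega), h0 hu]; ring

/-- The mirror image of `left_step`. By `hS` the columns are crossed in order of decreasing height,
so whenever the exchanged configuration contributes, all columns crossed before are higher than its
entry at s and its factor is a pure power of t. -/
theorem right_step (q t : K) (lam : Fin n → ℕ) {s j : Fin n} {S : Finset (Fin n)}
    (hj : j ∉ S) {G : (Fin n → ℕ) → K} (nu : Fin n → ℕ)
    (hS : ∀ k ∈ S, lam j ≤ lam k)
    (h0 : lam j ≤ nu j → G nu = 0)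
    (h1 : nu j < nu s → lam j < nu s + 1 → G (nu ∘ Equiv.swap s j) = 0)
    (h2 : nu j < nu s → nu s + 1 < lam j → G (nu ∘ Equiv.swap s j) = G nu)
    (h3 : nu j < nu s → lam j = nu s + 1 →
      G (nu ∘ Equiv.swap s j) = fillRatio q t lam nu (nu s) * G nu) :
    (if nu s ≤ nu j then t * (G nu * rightFactor q t lam s S nu)
      else G nu * rightFactor q t lam s S nu + (t - 1) * (G (nu ∘ Equiv.swap s j) *
        rightFactor q t lam s S (nu ∘ Equiv.swap s j))) =
    G nu * rightFactor q t lam s (insert j S) nu := by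
  -- the factor of a configuration whose passed columns are all higher than the entry
  have hbig : ∀ mu : Fin n → ℕ, mu s + 1 < lam j → rightFactor q t lam s S mu = t ^ S.card := by
    intro mu hmu
    have a1 : (S.filter fun j => mu s + 1 < lam j) = S :=
      Finset.filter_true_of_mem fun k hk => hmu.trans_le (hS k hk)
    have a2 : (S.filter fun j => lam j = mu s + 1 ∧ mu s ≤ mu j) = ∅ :=
      Finset.filter_false_of_mem fun k hk => by have := hS k hk; omega
    have a3 : (S.filter fun j => lam j = mu s + 1 ∧ mu j < mu s) = ∅ :=
      Finset.filter_false_of_mem fun k hk => by have := hS k hk; omega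
    simp [rightFactor, a1, a2, a3]
  rcases lt_trichotomy (nu s + 1) (lam j) with hu | hu | hu
  · have hins : rightFactor q t lam s (insert j S) nu = t * rightFactor q t lam s S nu := by
      simp only [rightFactor, card_filter_insert hj]
      rw [if_pos hu, if_neg (by omega), if_neg (by omega)]
      ring
    rw [hins]
    rcases le_or_gt (nu s) (nu j) with hx | hx
    · rw [if_pos hx]; ring
    · rw [if_neg (by omega), hbig nu hu, hbig (nu ∘ Equiv.swap s j) (by simp; omega), h2 hx hu]
      ring
  · rcases le_or_gt (nu s) (nu j) with hx | hx
    · rw [if_pos hx]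
      simp only [rightFactor, card_filter_insert hj]
      rw [if_neg (by omega), if_pos (by omega), if_neg (by omega)]
      ring
    · rw [if_neg (by omega), hbig (nu ∘ Equiv.swap s j) (by simp; omega), h3 hx hu.symm]
      simp only [rightFactor, card_filter_insert hj]
      rw [if_neg (by omega), if_neg (by omega), if_pos (by omega)]
      have hc : S.card = (S.filter fun j => nu s + 1 < lam j).card +
          (S.filter fun j => lam j = nu s + 1 ∧ nu s ≤ nu j).card +
          (S.filter fun j => lam j = nu s + 1 ∧ nu j < nu s).card := by
        rw [← Finset.card_union_of_disjoint, ← Finset.filter_or, ← Finset.card_union_of_disjoint,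
          ← Finset.filter_or, Finset.filter_true_of_mem]
        · intro k hk; have := hS k hk; omega
        · rw [Finset.disjoint_filter]; intro k _ h h'; omega
        · rw [Finset.disjoint_filter]; intro k _ h h'; omega
      rw [hc]
      ring
  · rcases le_or_gt (nu s) (nu j) with hx | hx
    · rw [if_pos hx, h0 (by omega)]; ring
    · rw [if_neg (by omega), h1 hx hu]
      simp only [rightFactor, card_filter_insert hj]
      rw [if_neg (by omega), if_neg (by omega), if_neg (by omega)]
      ring

/-! ### The factors after a complete pass -/

theorem card_filter_orbit {kap nu : Fin n → ℕ} (h : nu ∈ orbit kap) (P : ℕ → Prop)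
    [DecidablePred P] : Finset.card {k : Fin n | P (nu k)} = Finset.card {k : Fin n | P (kap k)} := by
  obtain ⟨s, rfl⟩ := mem_orbit.1 h
  simp only [Finset.card_filter]
  exact Equiv.sum_comp s (fun k => if P (kap k) then 1 else 0)

/-- The denominators of the recursion coefficients are chosen for this identity: it converts the
factor of a complete pass into the power of q demanded by the cyclic relation. -/
theorem one_sub_fillRatio_mul {q t : K} (H : Generic q t) (lam nu : Fin n → ℕ) {v : ℕ}
    (hd : 0 < defect lam nu v) : 1 - fillRatio q t lam nu v * (1 - t ^ defect lam nu v) =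
      q ^ v * t ^ (below lam v + defect lam nu v) := by
  rw [fillRatio, div_mul_cancel₀ _ (H.one_sub_t _ hd)]
  ring

/-- Counting entries: those larger than p are as many as the columns higher than p + 1, and they fit
only into crossed columns. So the crossed columns with entry at most p are as many as the empty
ones. If s is deficient, the entries p missing from the columns of height p + 1 all lie in crossed
columns, and their number is the defect. -/
theorem leftFactor_full {q t : K} (H : Generic q t) {lam nu : Fin n → ℕ} {p : ℕ} {s : Fin n}
    (hs : lam s = p + 1) (hnu : nu ∈ orbit fun k => lam k - 1) (hf : Fits lam nu) :
    leftFactor q t lam p s (Finset.univ.filter fun j => lam j = 0 ∨ p + 1 < lam j) nu =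
      t ^ Finset.card {k : Fin n | lam k = 0} *
        if nu s = p then 1 else q ^ p * t ^ below lam p := by
  have hle : (Finset.filter (fun j => nu j ≤ p)
      (Finset.univ.filter fun j => lam j = 0 ∨ p + 1 < lam j)).card =
      Finset.card {k : Fin n | lam k = 0} := by
    have h1 := card_filter_orbit hnu (fun x => p < x)
    have h2 : (Finset.univ.filter fun k => p < nu k) = Finset.filter (fun j => ¬ nu j ≤ p)
        (Finset.univ.filter fun j => lam j = 0 ∨ p + 1 < lam j) := by
      rw [Finset.filter_filter]
      refine Finset.filter_congr fun k _ => ?_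
      have := hf k
      omega
    have h3 : (Finset.univ.filter fun j => lam j = 0 ∨ p + 1 < lam j).card =
        Finset.card {k : Fin n | lam k = 0} + Finset.card {k : Fin n | p < lam k - 1} := by
      rw [← Finset.card_union_of_disjoint, ← Finset.filter_or]
      · congr 1; ext k; simp; omega
      · rw [Finset.disjoint_filter]; intro k _ h h'; omega
    have h4 := Finset.card_filter_add_card_filter_not (s := Finset.univ.filter fun j => lam j = 0 ∨ p + 1 < lam j)
      (fun j => nu j ≤ p)
    rw [← h2, h1, h3] at h4
    omega
  rw [leftFactor]
  split_ifs with hu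
  · rw [hle, mul_one]
  · have hlt : nu s < p := by have := hf s; omega
    have hd : (Finset.filter (fun j => nu j = p)
      (Finset.univ.filter fun j => lam j = 0 ∨ p + 1 < lam j)).card = defect lam nu p := by
      have h1 := card_filter_orbit hnu (fun x => x = p)
      have h2 : Finset.card {k : Fin n | nu k = p} = (Finset.filter (fun j => nu j = p)
          (Finset.univ.filter fun j => lam j = 0 ∨ p + 1 < lam j)).card +
          Finset.card {k : Fin n | lam k = p + 1 ∧ nu k = p} := by
        rw [← Finset.card_union_of_disjoint, Finset.filter_filter, ← Finset.filter_or]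
        · congr 1; ext k; have := hf k; simp; omega
        · rw [Finset.filter_filter, Finset.disjoint_filter]; intro k _ h h'; omega
      have h3 : Finset.card {k : Fin n | lam k - 1 = p} = defect lam nu p +
          Finset.card {k : Fin n | lam k = p + 1 ∧ nu k = p} := by
        rw [defect, ← Finset.card_union_of_disjoint, ← Finset.filter_or]
        · congr 1; ext k; have := hf k; simp; omega
        · rw [Finset.disjoint_filter]; intro k _ h h'; omega
      omega
    have hpos : 0 < defect lam nu p := Finset.card_pos.2 ⟨s, by simp [hs, hlt]⟩
    have hsum : (Finset.filter (fun j => nu j < p)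
        (Finset.univ.filter fun j => lam j = 0 ∨ p + 1 < lam j)).card + defect lam nu p =
        Finset.card {k : Fin n | lam k = 0} := by
      rw [← hle, ← hd, ← Finset.card_union_of_disjoint, ← Finset.filter_or]
      · congr 1; ext k; simp [le_iff_lt_or_eq]
      · rw [Finset.disjoint_filter]; intro k _ h h'; omega
    rw [hd, one_sub_fillRatio_mul H lam nu hpos, ← hsum]
    ring

/-- If the entry u of s is not the one just below its height, the crossed columns split into those
higher than u + 1, those of height u + 1 with or without a defect, and the lower ones; the exponents
of t add up to their total number. -/
theorem rightFactor_full {q t : K} (H : Generic q t) {lam nu : Fin n → ℕ} {s : Fin n}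
    (hnu : nu ∈ orbit fun k => lam k - 1) (hf : Fits lam nu) :
    rightFactor q t lam s (Finset.univ.filter fun j => 0 < lam j ∧ (lam s = 0 ∨ lam j < lam s)) nu =
      if lam s = nu s + 1 then 1 else q ^ nu s *
        t ^ Finset.card {j : Fin n | 0 < lam j ∧ (lam s = 0 ∨ lam j < lam s)} := by
  set S := Finset.univ.filter fun j => 0 < lam j ∧ (lam s = 0 ∨ lam j < lam s) with hS
  have hmem : ∀ k, k ∈ S ↔ 0 < lam k ∧ (lam s = 0 ∨ lam k < lam s) := by simp [hS]
  rw [rightFactor]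
  split_ifs with hu
  · have a1 : (S.filter fun j => nu s + 1 < lam j) = ∅ :=
      Finset.filter_false_of_mem fun k hk => by have := (hmem k).1 hk; omega
    have a2 : (S.filter fun j => lam j = nu s + 1 ∧ nu s ≤ nu j) = ∅ :=
      Finset.filter_false_of_mem fun k hk => by have := (hmem k).1 hk; omega
    have a3 : (S.filter fun j => lam j = nu s + 1 ∧ nu j < nu s) = ∅ :=
      Finset.filter_false_of_mem fun k hk => by have := (hmem k).1 hk; omega
    simp [a1, a2, a3]
  · have hs := hf s
    have hd : (S.filter fun j => lam j = nu s + 1 ∧ nu j < nu s).card = defect lam nu (nu s) := by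
      rw [defect, hS, Finset.filter_filter]
      congr 1
      refine Finset.filter_congr fun k _ => ?_
      omega
    have hb : (S.filter fun j => lam j ≤ nu s).card = below lam (nu s) := by
      rw [below, hS, Finset.filter_filter]
      congr 1
      refine Finset.filter_congr fun k _ => ?_
      omega
    have hc : S.card = (S.filter fun j => nu s + 1 < lam j).card +
        (S.filter fun j => lam j = nu s + 1 ∧ nu s ≤ nu j).card +
        (S.filter fun j => lam j = nu s + 1 ∧ nu j < nu s).card +
        (S.filter fun j => lam j ≤ nu s).card := by
      rw [← Finset.card_union_of_disjoint, ← Finset.filter_or, ← Finset.card_union_of_disjoint,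
        ← Finset.filter_or, ← Finset.card_union_of_disjoint, ← Finset.filter_or,
        Finset.filter_true_of_mem]
      · intro k hk; omega
      · rw [Finset.disjoint_filter]; intro k _ h h'; omega
      · rw [Finset.disjoint_filter]; intro k _ h h'; omega
      · rw [Finset.disjoint_filter]; intro k _ h h'; omega
    have hkey : 1 - fillRatio q t lam nu (nu s) * (1 - t ^ defect lam nu (nu s)) =
        q ^ nu s * t ^ (below lam (nu s) + defect lam nu (nu s)) := by
      rcases Nat.eq_zero_or_pos (nu s) with h0 | h0
      · have e1 : defect lam nu (nu s) = 0 := by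
          rw [defect, Finset.card_eq_zero, Finset.filter_eq_empty_iff]
          intro k _; omega
        have e2 : below lam (nu s) = 0 := by
          rw [below, Finset.card_eq_zero, Finset.filter_eq_empty_iff]
          intro k _; omega
        rw [e1, e2, h0]; simp
      -- Pigeonhole: without a deficient column of height u + 1, where u is the entry of s, all of
      -- these would carry u; together with s that is one occurrence of u too many.
      · apply one_sub_fillRatio_mul H
        by_contra hc0
        have hz : defect lam nu (nu s) = 0 := by omega
        rw [defect, Finset.card_eq_zero, Finset.filter_eq_empty_iff] at hz
        have h1 := card_filter_orbit hnu (fun x => x = nu s)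
        have hlt : Finset.card {k : Fin n | lam k - 1 = nu s} < Finset.card {k : Fin n | nu k = nu s} := by
          apply Finset.card_lt_card
          rw [Finset.ssubset_iff_of_subset]
          · exact ⟨s, by simp, by simp; omega⟩
          · intro k hk
            simp only [Finset.mem_filter, Finset.mem_univ, true_and] at hk ⊢
            have := hz (Finset.mem_univ k)
            have := hf k
            omega
        omega
    rw [hd, hkey, hc, hb, hd]
    ring

end Passes

section Steps

variable {K : Type*} [Field K] {n : ℕ}

/-- Exchanging entries with an empty column changes the excess; the power of q in G compensates
this, so that the hypotheses of `left_step` hold for empty and for higher columns alike. -/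
theorem left_step_recCoeff {q t : K} (H : Generic q t) {lam : Fin n → ℕ} {p : ℕ} {s j : Fin n}
    (hs : lam s = p + 1) (hj : lam j = 0 ∨ p + 1 < lam j) {S : Finset (Fin n)} (hjS : j ∉ S)
    (hsS : s ∉ S) {G : (Fin n → ℕ) → K}
    (hG : ∀ nu, G nu = recCoeff q t lam nu * q ^ (if lam j = 0 then nu s else 0))
    (nu : Fin n → ℕ) :
    (if nu j ≤ nu s then t * (G nu * leftFactor q t lam p s S nu)
      else G nu * leftFactor q t lam p s S nu + (t - 1) * (G (nu ∘ Equiv.swap j s) *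
        leftFactor q t lam p s S (nu ∘ Equiv.swap j s))) =
    G nu * leftFactor q t lam p s (insert j S) nu := by
  have hjs : s ≠ j := by rintro rfl; omega
  have hjs0 : ¬ lam s = 0 := by omega
  apply left_step q t lam hjS hsS
  · intro h
    rw [hG, recCoeff_of_not_fits, zero_mul]
    intro hf; have := hf s; omega
  · intro h1 h2
    rw [hG, recCoeff_of_not_fits, zero_mul]
    intro hf; have := hf s
    rw [Function.comp_apply, Equiv.swap_apply_right] at this
    omega
  · intro h1 h2
    rw [Equiv.swap_comm]
    obtain ⟨e, e'⟩ := recCoeff_swap_same q t (lam := lam) (nu := nu) hjs (by omega) (by omega)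
      (by omega) (by omega) (by omega) (by omega)
    refine ⟨?_, e' p⟩
    rw [hG, hG]
    simpa [hjs0] using e
  · intro h1 h2
    rw [Equiv.swap_comm]
    have e := recCoeff_swap_fill H (lam := lam) (nu := nu) hjs hs h2 (by omega) (by omega) (by omega)
    rw [hG, hG]
    simpa using e

/-- Here the moving column itself may be empty. Its entry then contributes to the excess, and the
inverse power of q removes that contribution. -/
theorem right_step_recCoeff {q t : K} (H : Generic q t) {lam : Fin n → ℕ} {s j : Fin n}
    (hj : 0 < lam j) (hs : lam s = 0 ∨ lam j < lam s) {S : Finset (Fin n)} (hjS : j ∉ S)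
    (hS : ∀ k ∈ S, lam j ≤ lam k) {G : (Fin n → ℕ) → K}
    (hG : ∀ nu, G nu = recCoeff q t lam nu * (q ^ (if lam s = 0 then nu s else 0))⁻¹)
    (nu : Fin n → ℕ) :
    (if nu s ≤ nu j then t * (G nu * rightFactor q t lam s S nu)
      else G nu * rightFactor q t lam s S nu + (t - 1) * (G (nu ∘ Equiv.swap s j) *
        rightFactor q t lam s S (nu ∘ Equiv.swap s j))) =
    G nu * rightFactor q t lam s (insert j S) nu := by
  have hjs : s ≠ j := by rintro rfl; omega
  have hq := H.q_ne
  apply right_step q t lam hjS nu hS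
  · intro h
    rw [hG, recCoeff_of_not_fits, zero_mul]
    intro hf; have := hf j; omega
  · intro h1 h2
    rw [hG, recCoeff_of_not_fits, zero_mul]
    intro hf; have := hf j
    rw [Function.comp_apply, Equiv.swap_apply_right] at this
    omega
  · intro h1 h2
    obtain ⟨e, -⟩ := recCoeff_swap_same q t (lam := lam) (nu := nu) hjs (by omega) (by omega)
      (by omega) (by omega) (by omega) (by omega)
    rw [hG, hG]
    rw [if_neg (c := lam j = 0) (by omega), if_neg (c := lam j = 0) (by omega), add_zero, add_zero] at e
    rw [Function.comp_apply, Equiv.swap_apply_left]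
    have a := pow_ne_zero (if lam s = 0 then nu s else 0) hq
    have b := pow_ne_zero (if lam s = 0 then nu j else 0) hq
    field_simp
    linear_combination e
  · intro h1 h2
    have e := recCoeff_swap_fill H (lam := lam) (nu := nu) hjs.symm h2 rfl (by omega) (by omega)
      (by omega)
    rw [hG, hG]
    rw [Equiv.swap_comm, Function.comp_apply, Equiv.swap_apply_right]
    have a := pow_ne_zero (if lam s = 0 then nu s else 0) hq
    have b := pow_ne_zero (if lam s = 0 then nu j else 0) hq
    field_simp
    linear_combination e

end Steps

/-! ### The recursion for the family, and passes across nonempty columns. -/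

section Recursion

variable {K : Type*} [Field K]

/-- The product of the variables in a set of places. -/
noncomputable def varProd (K : Type*) [Field K] {n : ℕ} (A : Finset (Fin n)) :
    MvPolynomial (Fin n) K := ∏ k ∈ A, X k

theorem rename_varProd {n : ℕ} {A : Finset (Fin n)} {i : Fin (n - 1)}
    (h : lft i ∈ A ↔ rgt i ∈ A) : rename (simpleSwap i) (varProd K A) = varProd K A := by
  have hA : ∀ k, k ∈ A ↔ simpleSwap i k ∈ A := by
    intro k
    by_cases h1 : k = lft i
    · subst h1; simpa using h
    by_cases h2 : k = rgt i
    · subst h2; simpa using h.symm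
    rw [simpleSwap_of_ne h1 h2]
  rw [varProd, map_prod]
  refine Finset.prod_equiv (simpleSwap i) hA fun k _ => by rw [rename_X]

/-- The base polynomial of the family of `lam` made from the family `f` of `lam - 1`. -/
noncomputable def recBase (q t : K) {n : ℕ} (lam : Fin n → ℕ)
    (f : (Fin n → ℕ) → MvPolynomial (Fin n) K) : MvPolynomial (Fin n) K :=
  varProd K {k | 0 < lam k} * orbitSum (fun k => lam k - 1) f 1 (recCoeff q t lam)

theorem orbitSum_recCoeff {n : ℕ} (q t : K) {lam : Fin n → ℕ} (kap : Fin n → ℕ)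
    (f : (Fin n → ℕ) → MvPolynomial (Fin n) K)
    {r : Equiv.Perm (Fin n)} (hr : lam ∘ r = lam) :
    orbitSum kap f r (recCoeff q t lam) = orbitSum kap f 1 (recCoeff q t lam) := by
  have h := orbitSum_mul kap f r 1 (recCoeff q t lam)
  rw [mul_one] at h
  rw [h]
  refine orbitSum_congr fun nu _ => recCoeff_comp_perm q t ?_ nu
  conv_lhs => rw [← hr]
  ext k; simp

/-- s_i stabilizes `lam`, hence the coefficients; both branches of the coefficient rule then give t
h, since h + (t - 1) h = t h. This is what starting a Hecke family at `lam` requires. -/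
theorem heckeGen_recBase {n : ℕ} (q : K) {t : K} {lam : Fin n → ℕ}
    {f : (Fin n → ℕ) → MvPolynomial (Fin n) K} (hf : IsHeckeFamily t (fun k => lam k - 1) f)
    (i : Fin (n - 1)) (hi : lam (lft i) = lam (rgt i)) :
    heckeGen t i (recBase q t lam f) = t • recBase q t lam f := by
  have hs : lam ∘ simpleSwap i = lam := comp_simpleSwap_of_eq hi
  rw [recBase, heckeGen_mul_of_rename_eq t (rename_varProd (by simp [hi])),
    hf.heckeGen_orbitSum, one_mul, ← mul_smul_comm, ← orbitSum_smul]
  congr 1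
  rw [orbitSum_smul, ← orbitSum_recCoeff q t _ f hs, ← orbitSum_smul]
  refine orbitSum_congr fun nu _ => ?_
  have h : recCoeff q t lam (nu ∘ Equiv.swap ((1 : Equiv.Perm (Fin n)) (lft i))
    ((1 : Equiv.Perm (Fin n)) (rgt i))) = recCoeff q t lam nu := recCoeff_comp_perm q t hs nu
  rw [h]
  split_ifs
  · rfl
  · ring

/-- The exchange relations (the `q`-deformed Knizhnik–Zamolodchikov equations). -/
structure IsQKZ {N : ℕ} (q t : K) (lam : Fin (N + 1) → ℕ)
    (f : (Fin (N + 1) → ℕ) → MvPolynomial (Fin (N + 1)) K) : Prop extends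
    IsHeckeFamily t lam f where
  cyc : ∀ s : Equiv.Perm (Fin (N + 1)),
    cycOp q (f (lam ∘ s)) = q ^ lam (s 0) • f ((lam ∘ s) ∘ finRotate (N + 1))

variable {N : ℕ} {q t : K} {lam : Fin (N + 1) → ℕ}
  {f g : (Fin (N + 1) → ℕ) → MvPolynomial (Fin (N + 1)) K}

theorem IsHeckeFamily.orbitSum_left (hf : IsHeckeFamily t lam f) (s : Fin (N + 1)) (i : Fin N)
    (h : (Fin (N + 1) → ℕ) → K) :
    heckeGen (n := N + 1) t i (orbitSum lam f (arr s i.succ) h) =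
      orbitSum lam f (arr s i.castSucc) fun nu =>
        if nu (s.succAbove i) ≤ nu s then t * h nu
        else h nu + (t - 1) * h (nu ∘ Equiv.swap (s.succAbove i) s) := by
  have := hf.heckeGen_orbitSum (arr s i.succ) i h
  rw [arr_succ_mul, lft_eq_castSucc, rgt_eq_succ, arr_succ_castSucc, arr_self] at this
  exact this

theorem IsHeckeFamily.orbitSum_right (hf : IsHeckeFamily t lam f) (s : Fin (N + 1)) (i : Fin N)
    (h : (Fin (N + 1) → ℕ) → K) :
    heckeGen (n := N + 1) t i (orbitSum lam f (arr s i.castSucc) h) =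
      orbitSum lam f (arr s i.succ) fun nu =>
        if nu s ≤ nu (s.succAbove i) then t * h nu
        else h nu + (t - 1) * h (nu ∘ Equiv.swap s (s.succAbove i)) := by
  have := hf.heckeGen_orbitSum (arr s i.castSucc) i h
  rw [arr_castSucc_mul, lft_eq_castSucc, rgt_eq_succ, arr_castSucc_succ, arr_self] at this
  exact this

theorem IsHeckeFamily.arr_left (hf : IsHeckeFamily t lam f) {s : Fin (N + 1)} {i : Fin N}
    (h : lam s < lam (s.succAbove i)) :
    f (lam ∘ arr s i.castSucc) = heckeGen (n := N + 1) t i (f (lam ∘ arr s i.succ)) := by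
  have := hf.desc (arr s i.succ) i (by
    rw [lft_eq_castSucc, rgt_eq_succ, arr_succ_castSucc, arr_self]; exact h)
  rw [this, ← arr_succ_mul]
  rfl

theorem IsHeckeFamily.arr_right (hf : IsHeckeFamily t lam f) {s : Fin (N + 1)} {i : Fin N}
    (h : lam (s.succAbove i) < lam s) :
    f (lam ∘ arr s i.succ) = heckeGen (n := N + 1) t i (f (lam ∘ arr s i.castSucc)) := by
  have := hf.desc (arr s i.castSucc) i (by
    rw [lft_eq_castSucc, rgt_eq_succ, arr_castSucc_succ, arr_self]; exact h)
  rw [this, ← arr_castSucc_mul]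
  rfl

theorem base_arr (hl : Antitone lam) (hg : g lam = recBase q t lam f) {s m : Fin (N + 1)}
    (h : lam s = lam m) :
    g (lam ∘ arr s m) = varProd K {k | 0 < lam k} *
      orbitSum (fun k => lam k - 1) f (arr s m) (recCoeff q t lam) := by
  have := comp_arr_of_le hl h
  rw [this, hg, recBase, orbitSum_recCoeff q t _ f this]

/-- Inside its block of equal heights column s moves freely. Every further step to the left crosses
a higher column and is one T_i on both sides; it commutes with the variable product because both
places are nonempty. -/
theorem left_pass (H : Generic q t) (hl : Antitone lam)
    (hf : IsHeckeFamily t (fun k => lam k - 1) f) (hg : IsHeckeFamily t lam g)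
    (hgl : g lam = recBase q t lam f) {s : Fin (N + 1)} {p : ℕ} (hs : lam s = p + 1)
    (m : Fin (N + 1)) (hm : m ≤ s) :
    g (lam ∘ arr s m) = varProd K {k | 0 < lam k} *
      orbitSum (fun k => lam k - 1) f (arr s m) fun nu => recCoeff q t lam nu *
        leftFactor q t lam p s (Finset.univ.filter fun j => m ≤ j ∧ p + 1 < lam j) nu := by
  have base : ∀ m : Fin (N + 1), lam m = lam s → g (lam ∘ arr s m) = varProd K {k | 0 < lam k} *
      orbitSum (fun k => lam k - 1) f (arr s m) fun nu => recCoeff q t lam nu *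
        leftFactor q t lam p s (Finset.univ.filter fun j => m ≤ j ∧ p + 1 < lam j) nu := by
    intro m hms
    have hE : (Finset.univ.filter fun j => m ≤ j ∧ p + 1 < lam j) = ∅ := by
      refine Finset.filter_false_of_mem ?_
      rintro k - ⟨h1, h2⟩
      have := hl h1
      omega
    rw [base_arr hl hgl hms.symm, hE]
    simp only [leftFactor_empty, mul_one]
  induction m using Fin.reverseInduction with
  | last => exact base _ (by rw [le_antisymm (Fin.le_last s) hm])
  | cast i ih =>
    by_cases hi : lam i.castSucc = lam s
    · exact base _ hi
    have hlt : i.castSucc < s := lt_of_le_of_ne hm (by rintro rfl; exact hi rfl)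
    have hcol : s.succAbove i = i.castSucc := Fin.succAbove_of_castSucc_lt _ _ hlt
    have hgt : lam s < lam i.castSucc := lt_of_le_of_ne (hl hm) (Ne.symm hi)
    have hsucc : 0 < lam i.succ := by
      have := hl (Fin.castSucc_lt_iff_succ_le.1 hlt)
      omega
    rw [hg.arr_left (by rwa [hcol]), ih (Fin.castSucc_lt_iff_succ_le.1 hlt),
      heckeGen_mul_of_rename_eq, hf.orbitSum_left, hcol]
    · congr 1
      refine orbitSum_congr fun nu _ => ?_
      rw [left_step_recCoeff H hs (j := i.castSucc) (by omega) (G := recCoeff q t lam)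
        (S := Finset.univ.filter fun j => i.succ ≤ j ∧ p + 1 < lam j) (by simp) (by simp [hs])]
      · congr 2
        ext k
        simp only [Finset.mem_insert, Finset.mem_filter, Finset.mem_univ, true_and]
        constructor
        · rintro (rfl | h)
          · exact ⟨le_rfl, by omega⟩
          · exact ⟨(Fin.castSucc_lt_succ).le.trans h.1, h.2⟩
        · rintro ⟨h1, h2⟩
          rcases h1.eq_or_lt with h | h
          · exact Or.inl h.symm
          · exact Or.inr ⟨Fin.castSucc_lt_iff_succ_le.1 h, h2⟩
      · intro nu
        rw [if_neg (by omega), pow_zero, mul_one]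
    · apply rename_varProd
      simp only [Finset.mem_filter, Finset.mem_univ, true_and, lft_eq_castSucc, rgt_eq_succ]
      omega

/-- The same argument towards the right, stopping before the empty columns, where the variable
product is no longer invariant. -/
theorem right_pass (H : Generic q t) (hl : Antitone lam)
    (hf : IsHeckeFamily t (fun k => lam k - 1) f) (hg : IsHeckeFamily t lam g)
    (hgl : g lam = recBase q t lam f) {s : Fin (N + 1)} (hs : 0 < lam s)
    (m : Fin (N + 1)) (hm : s ≤ m) (hm0 : 0 < lam m) :
    g (lam ∘ arr s m) = varProd K {k | 0 < lam k} *
      orbitSum (fun k => lam k - 1) f (arr s m) fun nu => recCoeff q t lam nu *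
        rightFactor q t lam s (Finset.univ.filter fun j => j ≤ m ∧ lam j < lam s) nu := by
  have base : ∀ m : Fin (N + 1), lam m = lam s → g (lam ∘ arr s m) = varProd K {k | 0 < lam k} *
      orbitSum (fun k => lam k - 1) f (arr s m) fun nu => recCoeff q t lam nu *
        rightFactor q t lam s (Finset.univ.filter fun j => j ≤ m ∧ lam j < lam s) nu := by
    intro m hms
    have hE : (Finset.univ.filter fun j => j ≤ m ∧ lam j < lam s) = ∅ := by
      refine Finset.filter_false_of_mem ?_
      rintro k - ⟨h1, h2⟩
      have := hl h1
      omega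
    rw [base_arr hl hgl hms.symm, hE]
    simp only [rightFactor_empty, mul_one]
  induction m using Fin.induction with
  | zero => exact base _ (by rw [le_antisymm hm (Fin.zero_le s)])
  | succ i ih =>
    by_cases hi : lam i.succ = lam s
    · exact base _ hi
    have hlt : s < i.succ := lt_of_le_of_ne hm (by rintro rfl; exact hi rfl)
    have hle : s ≤ i.castSucc := Fin.le_castSucc_iff.2 hlt
    have hcol : s.succAbove i = i.succ := Fin.succAbove_of_le_castSucc _ _ hle
    have hgt : lam i.succ < lam s := lt_of_le_of_ne (hl hm) hi
    have hsucc : 0 < lam i.castSucc := hm0.trans_le (hl (Fin.castSucc_lt_succ).le)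
    rw [hg.arr_right (by rwa [hcol]), ih hle hsucc,
      heckeGen_mul_of_rename_eq, hf.orbitSum_right, hcol]
    · congr 1
      refine orbitSum_congr fun nu _ => ?_
      rw [right_step_recCoeff H (j := i.succ) (s := s) hm0 (Or.inr hgt) (G := recCoeff q t lam)
        (S := Finset.univ.filter fun j => j ≤ i.castSucc ∧ lam j < lam s) (by simp)]
      · congr 2
        ext k
        simp only [Finset.mem_insert, Finset.mem_filter, Finset.mem_univ, true_and]
        constructor
        · rintro (rfl | h)
          · exact ⟨le_rfl, hgt⟩
          · exact ⟨h.1.trans (Fin.castSucc_lt_succ).le, h.2⟩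
        · rintro ⟨h1, h2⟩
          rcases h1.eq_or_lt with h | h
          · exact Or.inl h
          · exact Or.inr ⟨Fin.le_castSucc_iff.2 h, h2⟩
      · intro k hk
        simp only [Finset.mem_filter, Finset.mem_univ, true_and] at hk
        exact hl (hk.1.trans (Fin.castSucc_lt_succ).le)
      · intro nu
        rw [if_neg (by omega), pow_zero, inv_one, mul_one]
    · apply rename_varProd
      simp only [Finset.mem_filter, Finset.mem_univ, true_and, lft_eq_castSucc, rgt_eq_succ]
      omega

end Recursion

/-! ### The cyclic relation is inherited by the recursion. -/

section CyclicRelation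

variable {K : Type*} [Field K] {N : ℕ} {q t : K} {lam : Fin (N + 1) → ℕ}
  {f g : (Fin (N + 1) → ℕ) → MvPolynomial (Fin (N + 1)) K}

theorem IsQKZ.cycOp_orbitSum (hf : IsQKZ q t lam f) (s : Fin (N + 1))
    (h : (Fin (N + 1) → ℕ) → K) :
    cycOp q (orbitSum lam f (arr s 0) h) =
      orbitSum lam f (arr s (Fin.last N)) fun nu => h nu * q ^ nu s := by
  rw [orbitSum, orbitSum, map_sum]
  refine Finset.sum_congr rfl fun nu hnu => ?_
  obtain ⟨w, rfl⟩ := mem_orbit.1 hnu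
  have e := hf.cyc (w * arr s 0)
  have e1 : (lam ∘ w) ∘ arr s 0 = lam ∘ ⇑(w * arr s 0) := rfl
  have e2 : (lam ∘ w) ∘ arr s (Fin.last N) = (lam ∘ ⇑(w * arr s 0)) ∘ finRotate (N + 1) := by
    rw [← arr_zero_mul_finRotate]; rfl
  rw [map_smul, e1, e, e2, smul_smul, Equiv.Perm.mul_apply, arr_self]
  rfl

theorem varProd_insert {n : ℕ} {A : Finset (Fin n)} {k : Fin n} (h : k ∉ A) :
    varProd K (insert k A) = X k * varProd K A := Finset.prod_insert h

theorem cycOp_varProd_image_succ (B : Finset (Fin N)) :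
    cycOp q (varProd K (B.image Fin.succ)) = varProd K (B.image Fin.castSucc) := by
  rw [varProd, varProd, Finset.prod_image fun a _ b _ h => Fin.succ_injective _ h,
    Finset.prod_image fun a _ b _ h => Fin.castSucc_injective _ h, map_prod]
  exact Finset.prod_congr rfl fun j _ => cycOp_X_succ q j

/-- Continues `right_pass` across the empty columns. At the last nonempty place the right factor is
rewritten as a left factor: the two complete-pass evaluations show q^p t^z R = q^{ν_s} L, z being
the number of empty columns. Each further step removes one empty column from L by reading
`left_step` backwards, until only the higher columns remain, as in `left_pass` at the first place.
-/
theorem zero_pass (H : Generic q t) (hl : Antitone lam)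
    (hf : IsHeckeFamily t (fun k => lam k - 1) f) (hg : IsHeckeFamily t lam g)
    (hgl : g lam = recBase q t lam f) {s : Fin (N + 1)} {p : ℕ} (hs : lam s = p + 1)
    {m0 : Fin (N + 1)} (h0 : 0 < lam m0) (hz : ∀ j, m0 < j → lam j = 0)
    (m : Fin (N + 1)) (hm : m0 ≤ m) :
    (q ^ p * t ^ Finset.card {k : Fin (N + 1) | lam k = 0}) • g (lam ∘ arr s m) =
      t ^ Finset.card {k : Fin (N + 1) | k ≤ m ∧ lam k = 0} •
        (varProd K (Finset.erase {k | 0 < lam k} m0) * (X m *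
        orbitSum (fun k => lam k - 1) f (arr s m) fun nu => recCoeff q t lam nu * q ^ nu s *
          leftFactor q t lam p s
            (Finset.univ.filter fun j => (lam j = 0 ∧ m < j) ∨ p + 1 < lam j) nu)) := by
  have hpos : ∀ j, 0 < lam j ↔ j ≤ m0 := by
    intro j
    refine ⟨fun h => ?_, fun h => h0.trans_le (hl h)⟩
    by_contra hc
    rw [hz j (not_le.1 hc)] at h
    omega
  have hsm : s ≤ m0 := (hpos s).1 (by omega)
  have base : (q ^ p * t ^ Finset.card {k : Fin (N + 1) | lam k = 0}) • g (lam ∘ arr s m0) =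
      t ^ Finset.card {k : Fin (N + 1) | k ≤ m0 ∧ lam k = 0} •
        (varProd K (Finset.erase {k | 0 < lam k} m0) * (X m0 *
        orbitSum (fun k => lam k - 1) f (arr s m0) fun nu => recCoeff q t lam nu * q ^ nu s *
          leftFactor q t lam p s
            (Finset.univ.filter fun j => (lam j = 0 ∧ m0 < j) ∨ p + 1 < lam j) nu)) := by
    have c0 : Finset.card {k : Fin (N + 1) | k ≤ m0 ∧ lam k = 0} = 0 := by
      rw [Finset.card_eq_zero, Finset.filter_eq_empty_iff]
      rintro k - ⟨h1, h2⟩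
      have := (hpos k).2 h1
      omega
    have hY : varProd K (Finset.univ.filter fun k => 0 < lam k) =
        X m0 * varProd K (Finset.erase {k | 0 < lam k} m0) := by
      rw [← varProd_insert (by simp), Finset.insert_erase (by simp [h0])]
    rw [right_pass H hl hf hg hgl (by omega) m0 hsm h0, c0, pow_zero, one_smul, ← mul_smul_comm,
      ← orbitSum_smul, hY, mul_comm (X m0), mul_assoc]
    congr 2
    refine orbitSum_congr fun nu hnu => ?_
    by_cases hfit : Fits lam nu
    swap
    · rw [recCoeff_of_not_fits hfit]; ring
    have e1 : (Finset.univ.filter fun j => j ≤ m0 ∧ lam j < lam s) =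
        Finset.univ.filter fun j => 0 < lam j ∧ (lam s = 0 ∨ lam j < lam s) := by
      refine Finset.filter_congr fun k _ => ?_
      rw [hpos]
      have : lam s ≠ 0 := by omega
      tauto
    have e2 : (Finset.univ.filter fun j => (lam j = 0 ∧ m0 < j) ∨ p + 1 < lam j) =
        Finset.univ.filter fun j => lam j = 0 ∨ p + 1 < lam j := by
      refine Finset.filter_congr fun k _ => ?_
      have := hpos k
      rw [← not_le, ← this]
      omega
    have e3 : below lam p =
        Finset.card {j : Fin (N + 1) | 0 < lam j ∧ (lam s = 0 ∨ lam j < lam s)} := by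
      rw [below]
      congr 1
      refine Finset.filter_congr fun k _ => ?_
      omega
    rw [e1, e2, leftFactor_full H hs hnu hfit, rightFactor_full H hnu hfit, ← e3]
    by_cases hu : nu s = p
    · rw [if_pos (by omega), if_pos hu, hu]; ring
    · rw [if_neg (by omega), if_neg hu]; ring
  induction m using Fin.induction with
  | zero =>
    rw [le_antisymm hm (Fin.zero_le m0)] at base ⊢
    exact base
  | succ i ih =>
    rcases hm.eq_or_lt with he | hlt
    · rw [he] at base ⊢
      exact base
    have hle : m0 ≤ i.castSucc := Fin.le_castSucc_iff.2 hlt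
    have hcol : s.succAbove i = i.succ := Fin.succAbove_of_le_castSucc _ _ (hsm.trans hle)
    have hzero : lam i.succ = 0 := hz _ hlt
    -- The old sum is T_i applied to the new one, so the T_i of this step acts on x_i T_i(…), and
    -- the relation T_i x_i T_i = t x_{i+1} applies.
    have hT : orbitSum (fun k => lam k - 1) f (arr s i.castSucc) (fun nu =>
        recCoeff q t lam nu * q ^ nu s * leftFactor q t lam p s
          (Finset.univ.filter fun j => (lam j = 0 ∧ i.castSucc < j) ∨ p + 1 < lam j) nu) =
        heckeGen (n := N + 1) t i (orbitSum (fun k => lam k - 1) f (arr s i.succ) fun nu =>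
        recCoeff q t lam nu * q ^ nu s * leftFactor q t lam p s
          (Finset.univ.filter fun j => (lam j = 0 ∧ i.succ < j) ∨ p + 1 < lam j) nu) := by
      rw [hf.orbitSum_left, hcol]
      refine orbitSum_congr fun nu _ => ?_
      have hS : (Finset.univ.filter fun j => (lam j = 0 ∧ i.castSucc < j) ∨ p + 1 < lam j) =
          insert i.succ (Finset.univ.filter fun j => (lam j = 0 ∧ i.succ < j) ∨ p + 1 < lam j) := by
        ext k
        simp only [Finset.mem_insert, Finset.mem_filter, Finset.mem_univ, true_and]
        rw [Fin.castSucc_lt_iff_succ_le, le_iff_eq_or_lt]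
        constructor
        · rintro (⟨h1, rfl | h2⟩ | h)
          · exact Or.inl rfl
          · exact Or.inr (Or.inl ⟨h1, h2⟩)
          · exact Or.inr (Or.inr h)
        · rintro (rfl | ⟨h1, h2⟩ | h)
          · exact Or.inl ⟨hzero, Or.inl rfl⟩
          · exact Or.inl ⟨h1, Or.inr h2⟩
          · exact Or.inr h
      rw [hS]
      exact (left_step_recCoeff H hs (j := i.succ) (Or.inl hzero)
        (G := fun nu => recCoeff q t lam nu * q ^ nu s) (by simp [hzero]) (by simp [hs])
        (fun nu => by rw [if_pos hzero]) nu).symm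
    have hcard : Finset.card {k : Fin (N + 1) | k ≤ i.succ ∧ lam k = 0} =
        Finset.card {k : Fin (N + 1) | k ≤ i.castSucc ∧ lam k = 0} + 1 := by
      rw [← Finset.card_insert_of_notMem (a := i.succ) (by simp [Fin.le_def])]
      congr 1
      ext k
      simp only [Finset.mem_insert, Finset.mem_filter, Finset.mem_univ, true_and]
      rw [Fin.le_castSucc_iff, le_iff_eq_or_lt]
      constructor
      · rintro ⟨rfl | h, h'⟩
        · exact Or.inl rfl
        · exact Or.inr ⟨h, h'⟩
      · rintro (rfl | ⟨h, h'⟩)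
        · exact ⟨Or.inl rfl, hzero⟩
        · exact ⟨Or.inr h, h'⟩
    have h1 : i.castSucc ∉ Finset.erase (Finset.univ.filter fun k => 0 < lam k) m0 := by
      simp only [Finset.mem_erase, Finset.mem_filter, Finset.mem_univ, true_and, hpos]
      rintro ⟨h1, h2⟩
      exact h1 (le_antisymm h2 hle)
    have h2 : i.succ ∉ Finset.erase (Finset.univ.filter fun k => 0 < lam k) m0 := by
      simp [hzero]
    rw [hg.arr_right (by rw [hcol]; omega), ← map_smul, ih hle, map_smul, hT, hcard,
      heckeGen_mul_of_rename_eq, ← lft_eq_castSucc, heckeGen_X_mul_heckeGen, ← rgt_eq_succ,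
      mul_smul_comm, smul_smul, pow_succ]
    apply rename_varProd
    rw [lft_eq_castSucc, rgt_eq_succ]
    simp only [h1, h2]

/-- ω turns the variables of the nonempty places into q x_n times the first ones, and multiplies the
coefficient by q^{ν_s}. The image of `left_pass` at the first place thus becomes the expression of
`zero_pass` at the last place. -/
theorem cycOp_arr_of_pos (H : Generic q t) (hl : Antitone lam)
    (hf : IsQKZ q t (fun k => lam k - 1) f) (hg : IsHeckeFamily t lam g)
    (hgl : g lam = recBase q t lam f) {s : Fin (N + 1)} (hs : 0 < lam s) :
    cycOp q (g (lam ∘ arr s 0)) = q ^ lam s • g (lam ∘ arr s (Fin.last N)) := by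
  obtain ⟨p, hp⟩ : ∃ p, lam s = p + 1 := ⟨lam s - 1, by omega⟩
  have hne : (Finset.univ.filter fun k => 0 < lam k).Nonempty := ⟨s, by simp [hs]⟩
  set m0 := (Finset.univ.filter fun k => 0 < lam k).max' hne with hm0
  have h0 : 0 < lam m0 := by
    have := Finset.max'_mem _ hne
    simpa using this
  have hz : ∀ j, m0 < j → lam j = 0 := by
    intro j hj
    by_contra hc
    exact absurd (Finset.le_max' _ j (by simp; omega)) (not_le.2 hj)
  have e := zero_pass H hl hf.toIsHeckeFamily hg hgl hp h0 hz (Fin.last N) (Fin.le_last _)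
  have hZ : (Finset.univ.filter fun k : Fin (N + 1) => k ≤ Fin.last N ∧ lam k = 0) =
      Finset.univ.filter fun k => lam k = 0 :=
    Finset.filter_congr fun k _ => by simp [Fin.le_last]
  have hS : (Finset.univ.filter fun j => (lam j = 0 ∧ Fin.last N < j) ∨ p + 1 < lam j) =
      Finset.univ.filter fun j => 0 ≤ j ∧ p + 1 < lam j :=
    Finset.filter_congr fun k _ => by simp [(Fin.le_last k).not_gt]
  rw [hZ, mul_comm, mul_smul] at e
  have e' := smul_right_injective _ (pow_ne_zero _ H.t_ne) e
  rw [left_pass H hl hf.toIsHeckeFamily hg hgl hp 0 (Fin.zero_le _), map_mul, hf.cycOp_orbitSum, hp,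
    pow_succ, mul_comm (q ^ p), mul_smul, e', hS]
  have hl0 : 0 < lam 0 := hs.trans_le (hl (Fin.zero_le s))
  have hA : (Finset.univ.filter fun k => 0 < lam k) =
      insert 0 ((Finset.univ.filter fun j : Fin N => 0 < lam j.succ).image Fin.succ) := by
    ext k
    induction k using Fin.cases with
    | zero => simp [hl0]
    | succ k => simp
  have hB : Finset.erase (Finset.univ.filter fun k => 0 < lam k) m0 =
      (Finset.univ.filter fun j : Fin N => 0 < lam j.succ).image Fin.castSucc := by
    ext k
    induction k using Fin.lastCases with
    | last =>
      simp only [Finset.mem_erase, Finset.mem_filter, Finset.mem_univ, true_and, Finset.mem_image,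
        Fin.castSucc_ne_last, and_false, exists_false, iff_false, not_and]
      intro h1 h2
      have := hz (Fin.last N) (lt_of_le_of_ne (Fin.le_last _) (Ne.symm h1))
      omega
    | cast k =>
      simp only [Finset.mem_erase, Finset.mem_filter, Finset.mem_univ, true_and, Finset.mem_image,
        Fin.castSucc_inj, exists_eq_right]
      constructor
      · rintro ⟨h1, h2⟩
        have hle : k.castSucc ≤ m0 := by
          by_contra hc
          have := hz _ (not_le.1 hc)
          omega
        exact h0.trans_le (hl (Fin.castSucc_lt_iff_succ_le.1 (lt_of_le_of_ne hle h1)))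
      · intro h
        refine ⟨?_, h.trans_le (hl (Fin.castSucc_lt_succ).le)⟩
        intro hc
        have := hz k.succ (hc ▸ Fin.castSucc_lt_succ)
        omega
  rw [hA, varProd_insert (by simp), ← hA, map_mul, cycOp_X_zero, cycOp_varProd_image_succ, hB,
    smul_eq_C_mul]
  have hsum : orbitSum (fun k => lam k - 1) f (arr s (Fin.last N)) (fun nu =>
      recCoeff q t lam nu * leftFactor q t lam p s
        (Finset.univ.filter fun j => 0 ≤ j ∧ p + 1 < lam j) nu * q ^ nu s) =
      orbitSum (fun k => lam k - 1) f (arr s (Fin.last N)) (fun nu =>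
      recCoeff q t lam nu * q ^ nu s * leftFactor q t lam p s
        (Finset.univ.filter fun j => 0 ≤ j ∧ p + 1 < lam j) nu) :=
    orbitSum_congr fun nu _ => by ring
  rw [hsum]
  ring

/-- At the first empty place the right factor of a complete pass is q^{ν} t^{k0}; inserting it
together with its inverse allows `right_step` to be read backwards. Each step to the left removes
one crossed column from the factor and moves a variable to the right. -/
theorem zero_column_pass (H : Generic q t) (hl : Antitone lam)
    (hf : IsHeckeFamily t (fun k => lam k - 1) f) (hg : IsHeckeFamily t lam g)
    (hgl : g lam = recBase q t lam f) (hs : lam (Fin.last N) = 0)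
    {k0 : Fin (N + 1)} (h0 : lam k0 = 0) (hz : ∀ j, j < k0 → 0 < lam j)
    (m : Fin (N + 1)) (hm : m ≤ k0) :
    t ^ m.1 • g (lam ∘ arr (Fin.last N) m) = varProd K (Finset.erase {k | k ≤ k0} m) *
        orbitSum (fun k => lam k - 1) f (arr (Fin.last N) m) fun nu =>
          recCoeff q t lam nu * (q ^ nu (Fin.last N))⁻¹ *
          rightFactor q t lam (Fin.last N) (Finset.univ.filter fun j => j < m) nu := by
  have hpos : ∀ j, 0 < lam j ↔ j < k0 := by
    intro j
    refine ⟨fun h => ?_, hz j⟩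
    by_contra hc
    have := hl (not_lt.1 hc)
    omega
  have base : t ^ k0.1 • g (lam ∘ arr (Fin.last N) k0) = varProd K (Finset.erase {k | k ≤ k0} k0) *
        orbitSum (fun k => lam k - 1) f (arr (Fin.last N) k0) fun nu =>
          recCoeff q t lam nu * (q ^ nu (Fin.last N))⁻¹ *
          rightFactor q t lam (Fin.last N) (Finset.univ.filter fun j => j < k0) nu := by
    have e1 : (Finset.univ.filter fun k => 0 < lam k) =
        Finset.erase (Finset.univ.filter fun k => k ≤ k0) k0 := by
      ext k
      simp only [Finset.mem_erase, Finset.mem_filter, Finset.mem_univ, true_and, hpos,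
        lt_iff_le_and_ne]
      tauto
    rw [base_arr hl hgl (by rw [hs, h0]), e1, ← mul_smul_comm, ← orbitSum_smul]
    congr 1
    refine orbitSum_congr fun nu hnu => ?_
    by_cases hfit : Fits lam nu
    swap
    · rw [recCoeff_of_not_fits hfit]; ring
    have e2 : (Finset.univ.filter fun j => j < k0) = Finset.univ.filter fun j =>
        0 < lam j ∧ (lam (Fin.last N) = 0 ∨ lam j < lam (Fin.last N)) := by
      refine Finset.filter_congr fun k _ => ?_
      rw [hpos]
      tauto
    have e3 : (Finset.univ.filter fun j => j < k0).card = k0.1 := by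
      rw [← Fin.card_Iio k0]
      congr 1
      ext k
      simp
    have hq := pow_ne_zero (nu (Fin.last N)) H.q_ne
    rw [e2, rightFactor_full H hnu hfit, if_neg (by omega), ← e2, e3]
    field_simp
  induction m using Fin.reverseInduction with
  | last =>
    rw [le_antisymm (Fin.le_last k0) hm] at base ⊢
    exact base
  | cast i ih =>
    rcases hm.eq_or_lt with he | hlt
    · rw [← he] at base ⊢
      exact base
    have hle : i.succ ≤ k0 := Fin.castSucc_lt_iff_succ_le.1 hlt
    have hcol : (Fin.last N).succAbove i = i.castSucc := Fin.succAbove_last_apply i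
    have hT : orbitSum (fun k => lam k - 1) f (arr (Fin.last N) i.succ) (fun nu =>
          recCoeff q t lam nu * (q ^ nu (Fin.last N))⁻¹ *
          rightFactor q t lam (Fin.last N) (Finset.univ.filter fun j => j < i.succ) nu) =
        heckeGen (n := N + 1) t i (orbitSum (fun k => lam k - 1) f (arr (Fin.last N) i.castSucc)
        fun nu => recCoeff q t lam nu * (q ^ nu (Fin.last N))⁻¹ *
          rightFactor q t lam (Fin.last N) (Finset.univ.filter fun j => j < i.castSucc) nu) := by
      rw [hf.orbitSum_right, hcol]
      refine orbitSum_congr fun nu _ => ?_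
      have hS : (Finset.univ.filter fun j => j < i.succ) =
          insert i.castSucc (Finset.univ.filter fun j => j < i.castSucc) := by
        ext k
        simp only [Finset.mem_insert, Finset.mem_filter, Finset.mem_univ, true_and]
        rw [← Fin.le_castSucc_iff, le_iff_eq_or_lt]
      rw [hS]
      refine (right_step_recCoeff H (j := i.castSucc) (hz _ hlt) (Or.inl hs)
        (G := fun nu => recCoeff q t lam nu * (q ^ nu (Fin.last N))⁻¹) (by simp) ?_ ?_ nu).symm
      · intro k hk
        simp only [Finset.mem_filter, Finset.mem_univ, true_and] at hk
        exact hl hk.le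
      · intro nu
        rw [if_pos hs]
    set B := ((Finset.univ.filter fun k => k ≤ k0).erase i.castSucc).erase i.succ with hB
    have hne : i.castSucc ≠ i.succ := (Fin.castSucc_lt_succ).ne
    have h1 : Finset.erase (Finset.univ.filter fun k => k ≤ k0) i.castSucc = insert i.succ B := by
      rw [hB, Finset.insert_erase (by simp [hle, hne.symm])]
    have h2 : Finset.erase (Finset.univ.filter fun k => k ≤ k0) i.succ = insert i.castSucc B := by
      rw [hB, Finset.erase_right_comm, Finset.insert_erase (by simp [hm, hne])]
    have hb1 : i.castSucc ∉ B := by simp [hB]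
    have hb2 : i.succ ∉ B := by simp [hB]
    have e := congrArg (heckeGen (n := N + 1) t i) (ih hle)
    rw [map_smul, ← hg.arr_left (by rw [hcol, hs]; exact hz _ hlt), h2, varProd_insert hb1, hT,
      mul_comm (X _), mul_assoc, heckeGen_mul_of_rename_eq, ← lft_eq_castSucc,
      heckeGen_X_mul_heckeGen, mul_smul_comm, Fin.val_succ, pow_succ', mul_smul] at e
    · have e' := smul_right_injective _ H.t_ne e
      rw [h1, varProd_insert hb2, mul_comm (X _), mul_assoc]
      exact e'
    · apply rename_varProd
      rw [lft_eq_castSucc, rgt_eq_succ]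
      simp only [hb1, hb2]

/-- At the first place no factor is left but q^{-ν}, which cancels against the power of q produced
by ω. -/
theorem cycOp_arr_of_zero (H : Generic q t) (hl : Antitone lam)
    (hf : IsQKZ q t (fun k => lam k - 1) f) (hg : IsHeckeFamily t lam g)
    (hgl : g lam = recBase q t lam f) (hs : lam (Fin.last N) = 0) :
    cycOp q (g (lam ∘ arr (Fin.last N) 0)) = g lam := by
  have hne : (Finset.univ.filter fun k => lam k = 0).Nonempty := ⟨Fin.last N, by simp [hs]⟩
  set k0 := (Finset.univ.filter fun k => lam k = 0).min' hne with hk0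
  have h0 : lam k0 = 0 := by
    have := Finset.min'_mem _ hne
    simpa using this
  have hz : ∀ j, j < k0 → 0 < lam j := by
    intro j hj
    by_contra hc
    exact absurd (Finset.min'_le _ j (by simp; omega)) (not_le.2 hj)
  have hpos : ∀ j, 0 < lam j ↔ j < k0 := by
    intro j
    refine ⟨fun h => ?_, hz j⟩
    by_contra hc
    have := hl (not_lt.1 hc)
    omega
  have e := zero_column_pass H hl hf.toIsHeckeFamily hg hgl hs h0 hz 0 (Fin.zero_le _)
  have hS : (Finset.univ.filter fun j : Fin (N + 1) => j < 0) = ∅ := by simp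
  simp only [hS, rightFactor_empty, mul_one, Fin.val_zero, pow_zero, one_smul] at e
  have hA : Finset.erase (Finset.univ.filter fun k => k ≤ k0) 0 =
      (Finset.univ.filter fun j : Fin N => j.succ ≤ k0).image Fin.succ := by
    ext k
    induction k using Fin.cases with
    | zero => simp
    | succ k => simp
  have hB : (Finset.univ.filter fun j : Fin N => j.succ ≤ k0).image Fin.castSucc =
      Finset.univ.filter fun k => 0 < lam k := by
    ext k
    induction k using Fin.lastCases with
    | last => simp [hs]
    | cast k =>
      simp only [Finset.mem_filter, Finset.mem_univ, true_and, Finset.mem_image,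
        Fin.castSucc_inj, exists_eq_right, hpos]
      exact Fin.castSucc_lt_iff_succ_le.symm
  rw [e, map_mul, hA, cycOp_varProd_image_succ, hB, hf.cycOp_orbitSum, arr_same, hgl, recBase]
  congr 1
  refine orbitSum_congr fun nu _ => ?_
  have hq := pow_ne_zero (nu (Fin.last N)) H.q_ne
  field_simp

theorem eq_comp_arr_of_antitone_tail (hl : Antitone lam) {s : Equiv.Perm (Fin (N + 1))}
    (h : ∀ a b : Fin (N + 1), 0 < a → a ≤ b → lam (s b) ≤ lam (s a)) :
    lam ∘ s = lam ∘ arr (s 0) 0 := by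
  set w := (arr (s 0) 0)⁻¹ * s with hw
  have hw0 : w 0 = 0 := by
    rw [hw, Equiv.Perm.mul_apply, Equiv.Perm.inv_eq_iff_eq, arr_self]
  have hs : ∀ a, s a = arr (s 0) 0 (w a) := by intro a; simp [hw]
  -- Replacing the first entry by the maximum makes the composition antitone, so that the uniqueness
  -- of the sorted rearrangement applies to the remaining entries.
  set F : Fin (N + 1) → ℕ := fun a => if a = 0 then lam 0 else lam (arr (s 0) 0 a) with hF
  have hle : ∀ a, lam a ≤ lam 0 := fun a => hl (Fin.zero_le a)
  have hFa : Antitone F := by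
    intro a b hab
    induction a using Fin.cases with
    | zero => simp only [hF, if_true]; split_ifs <;> simp [hle]
    | succ a =>
      induction b using Fin.cases with
      | zero => simp at hab
      | succ b =>
        simp only [hF, Fin.succ_ne_zero, if_false]
        rw [← Fin.succAbove_zero_apply, arr_succAbove, ← Fin.succAbove_zero_apply, arr_succAbove]
        exact hl ((Fin.strictMono_succAbove _).monotone (by simpa using hab))
  have hFw : ∀ a, a ≠ 0 → F (w a) = lam (s a) := by
    intro a ha
    have : w a ≠ 0 := fun e => ha (w.injective (e.trans hw0.symm))
    simp only [hF, if_neg this]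
    rw [← hs]
  have hFwa : Antitone (F ∘ w) := by
    intro a b hab
    by_cases ha : a = 0
    · subst ha
      have : F (w 0) = lam 0 := by simp [hF, hw0]
      simp only [Function.comp_apply, this]
      simp only [hF]; split_ifs <;> simp [hle]
    · have hb : b ≠ 0 := by
        rintro rfl
        exact ha (le_antisymm hab (Fin.zero_le a))
      simp only [Function.comp_apply, hFw a ha, hFw b hb]
      exact h a b (Fin.pos_of_ne_zero ha) hab
  have e := comp_perm_eq_of_antitone hFa hFwa
  ext a
  by_cases ha : a = 0
  · subst ha; simp
  · have := congrFun e a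
    rw [Function.comp_apply, hFw a ha] at this
    simp only [Function.comp_apply, this, hF, if_neg ha]

theorem comp_arr_zero_eq (hl : Antitone lam) {s : Fin (N + 1)} (h : lam s = lam (Fin.last N)) :
    lam ∘ arr s 0 = lam ∘ arr (Fin.last N) 0 := by
  ext k
  induction k using Fin.cases with
  | zero => simp [h]
  | succ j =>
    simp only [Function.comp_apply]
    rw [← Fin.succAbove_zero_apply, arr_succAbove, arr_succAbove, Fin.succAbove_last_apply]
    rcases lt_or_ge j.castSucc s with h1 | h1
    · rw [Fin.succAbove_of_castSucc_lt _ _ h1]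
    · rw [Fin.succAbove_of_le_castSucc _ _ h1]
      have h2 := hl h1
      have h3 := hl (Fin.le_last j.succ)
      have h4 := hl (Fin.castSucc_lt_succ (i := j)).le
      omega

/-- The exchange relations pass from `lam - 1` to `lam`. -/
theorem isQKZ_heckeFamily_recBase (H : Generic q t) (hl : Antitone lam)
    (hf : IsQKZ q t (fun k => lam k - 1) f) :
    IsQKZ q t lam (heckeFamily t (recBase q t lam f)) := by
  have hg := isHeckeFamily_heckeFamily t hl (heckeGen_recBase q hf.toIsHeckeFamily)
  have hgl := heckeFamily_of_antitone t (recBase q t lam f) hl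
  set g := heckeFamily t (recBase q t lam f)
  refine { hg with cyc := ?_ }
  suffices hd : ∀ (d : ℕ) (s : Equiv.Perm (Fin (N + 1))), invs (lam ∘ s) = d →
      cycOp q (g (lam ∘ s)) = q ^ lam (s 0) • g ((lam ∘ s) ∘ finRotate (N + 1)) from
    fun s => hd _ s rfl
  intro d
  induction d using Nat.strong_induction_on with
  | _ d ih =>
  rintro s rfl
  -- An ascent away from the first place is removed by ω T_{i+1} = T_i ω. Without such ascents the
  -- composition is `lam` with a single column moved to the front.
  by_cases hex : ∃ i : Fin (N + 1 - 1), 0 < i.1 ∧ (lam ∘ s) (lft i) < (lam ∘ s) (rgt i)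
  · obtain ⟨j, hj0, hj⟩ := hex
    obtain ⟨i, hi⟩ : ∃ i : Fin (N + 1 - 1), j.1 = i.1 + 1 := ⟨⟨j.1 - 1, by omega⟩, by simp; omega⟩
    have hstep := ih _ (by
      have e := invs_comp_simpleSwap _ j hj
      change invs ((lam ∘ s) ∘ simpleSwap j) < _
      omega) (s * simpleSwap j) rfl
    have e1 : lam ∘ ⇑(s * simpleSwap j) = (lam ∘ s) ∘ simpleSwap j := rfl
    have hgs : g (lam ∘ s) = heckeGen t j (g (lam ∘ ⇑(s * simpleSwap j))) := by
      rw [hg.desc (s * simpleSwap j) j (by simpa using hj), e1, comp_simpleSwap_comp_simpleSwap]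
    have hrot : ∀ k, simpleSwap j (finRotate (N + 1) k) = finRotate (N + 1) (simpleSwap i k) := by
      have r1 : finRotate (N + 1) (lft i) = lft j := by
        rw [lft_eq_castSucc, finRotate_castSucc]; simp [lft, Fin.ext_iff, hi]
      have r2 : finRotate (N + 1) (rgt i) = rgt j := by
        have : rgt i = Fin.castSucc (n := N) j := by simp [rgt, Fin.ext_iff, hi]
        rw [this, finRotate_castSucc]; rfl
      intro k
      by_cases h1 : k = lft i
      · subst h1; rw [simpleSwap_lft, r1, r2, simpleSwap_lft]
      by_cases h2 : k = rgt i
      · subst h2; rw [simpleSwap_rgt, r1, r2, simpleSwap_rgt]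
      rw [simpleSwap_of_ne h1 h2, simpleSwap_of_ne]
      · rw [← r1]; exact fun e => h1 ((finRotate (N + 1)).injective e)
      · rw [← r2]; exact fun e => h2 ((finRotate (N + 1)).injective e)
    have e2 : (lam ∘ ⇑(s * simpleSwap j)) ∘ finRotate (N + 1) =
        lam ∘ ⇑(s * finRotate (N + 1) * simpleSwap i) := by
      ext k
      change lam (s (simpleSwap j (finRotate _ k))) = lam (s (finRotate _ (simpleSwap i k)))
      rw [hrot]
    have e3 : (s * simpleSwap j) 0 = s 0 := by
      rw [Equiv.Perm.mul_apply, simpleSwap_of_ne]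
      · simp [lft, Fin.ext_iff]; omega
      · simp [rgt, Fin.ext_iff]
    have hl' : finRotate (N + 1) (rgt i) = rgt j := by
      have : rgt i = Fin.castSucc (n := N) j := by simp [rgt, Fin.ext_iff, hi]
      rw [this, finRotate_castSucc]; rfl
    have hl'' : finRotate (N + 1) (lft i) = lft j := by
      rw [lft_eq_castSucc, finRotate_castSucc]; simp [lft, Fin.ext_iff, hi]
    rw [hgs, cycOp_heckeGen q t hi, hstep, e3, map_smul, e2,
      hg.desc (s * finRotate (N + 1) * simpleSwap i) i (by
        simpa [hl', hl''] using hj)]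
    congr 2
    ext k
    simp
  · push Not at hex
    have hs : lam ∘ s = lam ∘ arr (s 0) 0 := by
      apply eq_comp_arr_of_antitone_tail hl
      have hstep : ∀ j : Fin N, 0 < j.1 → lam (s j.succ) ≤ lam (s j.castSucc) :=
        fun j hj => hex j hj
      intro a b ha hab
      induction b using Fin.induction with
      | zero => exact absurd (ha.trans_le hab) (lt_irrefl _)
      | succ b ihb =>
        rcases hab.eq_or_lt with h | h
        · rw [h]
        · have h' : a ≤ b.castSucc := Fin.le_castSucc_iff.2 h
          exact (hstep b (by have : 0 < b.castSucc := ha.trans_le h'; simpa [Fin.lt_def] using this)).trans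
            (ihb h')
    rw [hs]
    rcases Nat.eq_zero_or_pos (lam (s 0)) with h0 | h0
    · have hlast : lam (Fin.last N) = 0 := by
        have := hl (Fin.le_last (s 0)); omega
      rw [h0, pow_zero, one_smul, comp_arr_zero_eq hl (by rw [h0, hlast]),
        cycOp_arr_of_zero H hl hf hg hgl hlast]
      congr 1
      change lam = lam ∘ ⇑(arr (Fin.last N) 0 * finRotate (N + 1))
      rw [arr_zero_mul_finRotate, arr_same]
      rfl
    · rw [cycOp_arr_of_pos H hl hf hg hgl h0]
      congr 2
      rw [← arr_zero_mul_finRotate]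
      rfl

end CyclicRelation

/-! ### The Hecke generators on monomials. -/

section Monomials

variable {K : Type*} [Field K] {n : ℕ}

/-- The monomial with exponents `mu`. -/
noncomputable def xPow (K : Type*) [Field K] {n : ℕ} (mu : Fin n → ℕ) : MvPolynomial (Fin n) K :=
  ∏ k, X k ^ mu k

theorem xPow_eq_monomial (mu : Fin n → ℕ) :
    xPow K mu = monomial (Finsupp.equivFunOnFinite.symm mu) 1 := by
  rw [xPow, monomial_eq, C_1, one_mul, Finsupp.prod_fintype _ _ fun _ => pow_zero _]
  rfl

theorem xPow_add (mu nu : Fin n → ℕ) : xPow K (mu + nu) = xPow K mu * xPow K nu := by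
  simp only [xPow, Pi.add_apply, pow_add, Finset.prod_mul_distrib]

theorem xPow_single (k : Fin n) (d : ℕ) : xPow K (Pi.single k d) = X k ^ d := by
  rw [xPow, Finset.prod_eq_single k]
  · simp
  · intro j _ hj; simp [hj]
  · simp

theorem rename_xPow (mu : Fin n → ℕ) (i : Fin (n - 1)) :
    rename (simpleSwap i) (xPow K mu) = xPow K (mu ∘ simpleSwap i) := by
  rw [xPow, xPow, map_prod]
  simp only [map_pow, rename_X]
  refine Fintype.prod_equiv (simpleSwap i) _ _ fun k => ?_
  simp [simpleSwap_simpleSwap]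

theorem varProd_eq_xPow (A : Finset (Fin n)) :
    varProd K A = xPow K fun k => if k ∈ A then 1 else 0 := by
  simp [varProd, xPow, pow_ite]

theorem coeff_xPow (mu nu : Fin n → ℕ) :
    coeff (Finsupp.equivFunOnFinite.symm nu) (xPow K mu) = if mu = nu then 1 else 0 := by
  classical
  rw [xPow_eq_monomial, coeff_monomial]
  simp

theorem heckeGen_X_lft_pow (t : K) (i : Fin (n - 1)) (d : ℕ) :
    heckeGen t i (X (lft i) ^ (d + 1)) = X (rgt i) ^ (d + 1) + (1 - t) •
      ∑ k ∈ Finset.range d, (X (lft i) ^ (k + 1) * X (rgt i) ^ (d - k) :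
        MvPolynomial (Fin n) K) := by
  apply eq_of_sub_mul_eq (i := i)
  have h : ∑ k ∈ Finset.range d, (X (lft i) ^ (k + 1) * X (rgt i) ^ (d - k) :
        MvPolynomial (Fin n) K) = X (lft i) * X (rgt i) *
      ∑ k ∈ Finset.range d, X (lft i) ^ k * X (rgt i) ^ (d - 1 - k) := by
    rw [Finset.mul_sum]
    refine Finset.sum_congr rfl fun k hk => ?_
    have : d - k = (d - 1 - k) + 1 := by have := Finset.mem_range.1 hk; omega
    rw [this, pow_succ, pow_succ]
    ring
  have g := geom_sum₂_mul (X (lft i) : MvPolynomial (Fin n) K) (X (rgt i)) d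
  rw [sub_mul_heckeGen, map_pow, rename_X, simpleSwap_lft, h, smul_eq_C_mul, map_sub, C_1]
  linear_combination (-(1 - C t) * X (lft i) * X (rgt i) : MvPolynomial (Fin n) K) * g

theorem heckeGen_X_rgt_pow (t : K) (i : Fin (n - 1)) (d : ℕ) :
    heckeGen t i (X (rgt i) ^ d) = t • X (lft i) ^ d + (t - 1) •
      ∑ k ∈ Finset.range d, (X (lft i) ^ k * X (rgt i) ^ (d - k) :
        MvPolynomial (Fin n) K) := by
  apply eq_of_sub_mul_eq (i := i)
  have h : ∑ k ∈ Finset.range d, (X (lft i) ^ k * X (rgt i) ^ (d - k) :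
        MvPolynomial (Fin n) K) = X (rgt i) *
      ∑ k ∈ Finset.range d, X (lft i) ^ k * X (rgt i) ^ (d - 1 - k) := by
    rw [Finset.mul_sum]
    refine Finset.sum_congr rfl fun k hk => ?_
    have : d - k = (d - 1 - k) + 1 := by have := Finset.mem_range.1 hk; omega
    rw [this, pow_succ]
    ring
  have g := geom_sum₂_mul (X (lft i) : MvPolynomial (Fin n) K) (X (rgt i)) d
  rw [sub_mul_heckeGen, map_pow, rename_X, simpleSwap_rgt, h, smul_eq_C_mul, smul_eq_C_mul,
    map_sub, C_1]
  linear_combination (-(C t - 1) * X (rgt i) : MvPolynomial (Fin n) K) * g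

/-- The span of the monomials whose exponents satisfy `P`. -/
noncomputable def expSpan (K : Type*) [Field K] {n : ℕ} (P : (Fin n → ℕ) → Prop) :
    Submodule K (MvPolynomial (Fin n) K) :=
  Submodule.span K {p | ∃ mu, P mu ∧ p = xPow K mu}

theorem xPow_mem_expSpan {P : (Fin n → ℕ) → Prop} {mu : Fin n → ℕ} (h : P mu) :
    xPow K mu ∈ expSpan K P := Submodule.subset_span ⟨mu, h, rfl⟩

theorem expSpan_mono {P Q : (Fin n → ℕ) → Prop} (h : ∀ mu, P mu → Q mu) :
    expSpan K P ≤ expSpan K Q :=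
  Submodule.span_mono fun _ ⟨mu, hm, e⟩ => ⟨mu, h mu hm, e⟩

theorem map_mem_expSpan {P Q : (Fin n → ℕ) → Prop} {T : Module.End K (MvPolynomial (Fin n) K)}
    (h : ∀ mu, P mu → T (xPow K mu) ∈ expSpan K Q) {f : MvPolynomial (Fin n) K}
    (hf : f ∈ expSpan K P) : T f ∈ expSpan K Q := by
  have : expSpan K P ≤ (expSpan K Q).comap T :=
    Submodule.span_le.2 fun _ ⟨mu, hm, e⟩ => e ▸ h mu hm
  exact this hf

theorem coeff_eq_zero_of_mem_expSpan {P : (Fin n → ℕ) → Prop} {f : MvPolynomial (Fin n) K}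
    (hf : f ∈ expSpan K P) {nu : Fin n → ℕ} (hn : ¬P nu) :
    coeff (Finsupp.equivFunOnFinite.symm nu) f = 0 := by
  have : expSpan K P ≤ LinearMap.ker (lcoeff K (Finsupp.equivFunOnFinite.symm nu)) := by
    refine Submodule.span_le.2 fun _ ⟨mu, hm, e⟩ => ?_
    rw [SetLike.mem_coe, LinearMap.mem_ker, e, lcoeff_apply, coeff_xPow, if_neg]
    rintro rfl
    exact hn hm
  exact this hf

/-- `be` arises from `al` by moving the entries at `i`, `i + 1` towards each other. -/
structure Between (i : Fin (n - 1)) (al be : Fin n → ℕ) : Prop where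
  off : ∀ k, k ≠ lft i → k ≠ rgt i → be k = al k
  add : be (lft i) + be (rgt i) = al (lft i) + al (rgt i)
  min_le : min (al (lft i)) (al (rgt i)) ≤ be (lft i)
  le_max : be (lft i) ≤ max (al (lft i)) (al (rgt i))

theorem exists_split (al : Fin n → ℕ) (i : Fin (n - 1)) :
    ∃ ga : Fin n → ℕ, (∀ k, k ≠ lft i → k ≠ rgt i → ga k = al k) ∧
      ga (lft i) = min (al (lft i)) (al (rgt i)) ∧ ga (rgt i) = min (al (lft i)) (al (rgt i)) :=
  ⟨fun k => if k = lft i ∨ k = rgt i then min (al (lft i)) (al (rgt i)) else al k, by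
    refine ⟨fun k h1 h2 => ?_, ?_, ?_⟩ <;> simp_all⟩

/-- Splitting off the s_i-invariant monomial with both exponents lowered to their minimum reduces to
a pure power of x_i, where a geometric sum gives the terms strictly in between. -/
theorem heckeGen_xPow_of_gt (t : K) (i : Fin (n - 1)) {al : Fin n → ℕ}
    (h : al (rgt i) < al (lft i)) :
    heckeGen t i (xPow K al) - xPow K (al ∘ simpleSwap i) ∈ expSpan K fun be =>
      Between i al be ∧ al (rgt i) < be (lft i) ∧ be (lft i) < al (lft i) := by
  obtain ⟨ga, g0, g1, g2⟩ := exists_split al i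
  obtain ⟨d, hd⟩ : ∃ d, al (lft i) = al (rgt i) + (d + 1) := ⟨al (lft i) - al (rgt i) - 1, by omega⟩
  rw [min_eq_right h.le] at g1 g2
  have hn := lft_ne_rgt i
  have e1 : al = ga + Pi.single (lft i) (d + 1) := by
    ext k
    by_cases h1 : k = lft i
    · subst h1; simp [g1, hd]
    by_cases h2 : k = rgt i
    · subst h2; simp [g2, hn.symm]
    simp [g0 k h1 h2, h1]
  have hg : rename (simpleSwap i) (xPow K ga) = xPow K ga := by
    rw [rename_xPow, comp_simpleSwap_of_eq (by rw [g1, g2])]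
  have e2 : xPow K (al ∘ simpleSwap i) = xPow K ga * X (rgt i) ^ (d + 1) := by
    rw [← rename_xPow, e1, xPow_add, map_mul, hg, xPow_single, map_pow, rename_X, simpleSwap_lft]
  have e3 : heckeGen t i (xPow K al) - xPow K (al ∘ simpleSwap i) = (1 - t) •
      ∑ k ∈ Finset.range d,
        xPow K (ga + Pi.single (lft i) (k + 1) + Pi.single (rgt i) (d - k)) := by
    have e4 : xPow K al = xPow K ga * X (lft i) ^ (d + 1) := by
      conv_lhs => rw [e1]
      rw [xPow_add, xPow_single]
    rw [e2, e4, heckeGen_mul_of_rename_eq t hg, heckeGen_X_lft_pow, mul_add,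
      add_sub_cancel_left, mul_smul_comm, Finset.mul_sum]
    simp only [xPow_add, xPow_single, mul_assoc]
  rw [e3]
  refine Submodule.smul_mem _ _ (Submodule.sum_mem _ fun k hk => xPow_mem_expSpan ?_)
  have hk := Finset.mem_range.1 hk
  refine ⟨⟨fun j h1 h2 => ?_, ?_, ?_, ?_⟩, ?_, ?_⟩
  · simp [g0 j h1 h2, h1, h2]
  all_goals simp [hn, hn.symm, g1, g2] <;> omega

theorem heckeGen_xPow (t : K) (i : Fin (n - 1)) (al : Fin n → ℕ) :
    heckeGen t i (xPow K al) ∈ expSpan K (Between i al) := by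
  have hs : Between i al (al ∘ simpleSwap i) := by
    refine ⟨fun k h1 h2 => ?_, ?_, ?_, ?_⟩
    · simp [simpleSwap_of_ne h1 h2]
    all_goals simp [simpleSwap_lft, simpleSwap_rgt, add_comm]
  rcases lt_or_ge (al (rgt i)) (al (lft i)) with h | h
  · have := heckeGen_xPow_of_gt t i h
    rw [← sub_add_cancel (heckeGen t i (xPow K al)) (xPow K (al ∘ simpleSwap i))]
    exact Submodule.add_mem _ (expSpan_mono (fun _ h => h.1) this) (xPow_mem_expSpan hs)
  obtain ⟨ga, g0, g1, g2⟩ := exists_split al i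
  obtain ⟨d, hd⟩ : ∃ d, al (rgt i) = al (lft i) + d := ⟨al (rgt i) - al (lft i), by omega⟩
  rw [min_eq_left h] at g1 g2
  have hn := lft_ne_rgt i
  have e1 : al = ga + Pi.single (rgt i) d := by
    ext k
    by_cases h1 : k = lft i
    · subst h1; simp [g1, hn]
    by_cases h2 : k = rgt i
    · subst h2; simp [g2, hd]
    simp [g0 k h1 h2, h2]
  have hg : rename (simpleSwap i) (xPow K ga) = xPow K ga := by
    rw [rename_xPow, comp_simpleSwap_of_eq (by rw [g1, g2])]
  have e2 : xPow K (al ∘ simpleSwap i) = xPow K ga * X (lft i) ^ d := by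
    rw [← rename_xPow, e1, xPow_add, map_mul, hg, xPow_single, map_pow, rename_X, simpleSwap_rgt]
  have e3 : heckeGen t i (xPow K al) = t • xPow K (al ∘ simpleSwap i) + (t - 1) •
      ∑ k ∈ Finset.range d,
        xPow K (ga + Pi.single (lft i) k + Pi.single (rgt i) (d - k)) := by
    have e4 : xPow K al = xPow K ga * X (rgt i) ^ d := by
      conv_lhs => rw [e1]
      rw [xPow_add, xPow_single]
    rw [e2, e4, heckeGen_mul_of_rename_eq t hg, heckeGen_X_rgt_pow, mul_add, mul_smul_comm,
      mul_smul_comm, Finset.mul_sum]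
    simp only [xPow_add, xPow_single, mul_assoc]
  rw [e3]
  refine Submodule.add_mem _ (Submodule.smul_mem _ _ (xPow_mem_expSpan hs)) <|
    Submodule.smul_mem _ _ (Submodule.sum_mem _ fun k hk => xPow_mem_expSpan ?_)
  have hk := Finset.mem_range.1 hk
  refine ⟨fun j h1 h2 => ?_, ?_, ?_, ?_⟩
  · simp [g0 j h1 h2, h1, h2]
  all_goals simp [hn, hn.symm, g1, g2] <;> omega

end Monomials

/-! ### Dominance of exponent vectors. -/

section Dominance

variable {n : ℕ}

/-- The sum of the first `c` entries. -/
def headSum (lam : Fin n → ℕ) (c : ℕ) : ℕ := ∑ k : Fin n with k.1 < c, lam k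

/-- `al` is dominated by `lam`, and is not a rearrangement of it. -/
structure Dominated (lam al : Fin n → ℕ) : Prop where
  sum_eq : ∑ k, al k = ∑ k, lam k
  sum_le : ∀ S : Finset (Fin n), ∑ k ∈ S, al k ≤ headSum lam S.card
  sq_lt : ∑ k, al k ^ 2 < ∑ k, lam k ^ 2

/-- Counting from zero, the i-th smallest element of S is at least i. -/
theorem sum_le_headSum {lam : Fin n → ℕ} (hl : Antitone lam) (S : Finset (Fin n)) :
    ∑ k ∈ S, lam k ≤ headSum lam S.card := by
  have hc : S.card ≤ n := by simpa using S.card_le_univ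
  have e1 : ∑ k ∈ S, lam k = ∑ i : Fin S.card, lam (S.orderEmbOfFin rfl i) := by
    conv_lhs => rw [← Finset.image_orderEmbOfFin_univ S rfl]
    rw [Finset.sum_image fun a _ b _ h => (S.orderEmbOfFin rfl).injective h]
  have e2 : headSum lam S.card = ∑ i : Fin S.card, lam (Fin.castLE hc i) := by
    have : (Finset.univ.filter fun k : Fin n => k.1 < S.card) =
        Finset.univ.image (Fin.castLE hc) := by
      ext k
      simp only [Finset.mem_filter, Finset.mem_univ, true_and, Finset.mem_image]
      exact ⟨fun h => ⟨⟨k.1, h⟩, rfl⟩, fun ⟨a, h⟩ => h ▸ a.2⟩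
    rw [headSum, this, Finset.sum_image fun a _ b _ h => Fin.castLE_injective hc h]
  rw [e1, e2]
  refine Finset.sum_le_sum fun i _ => hl ?_
  have : ∀ (d : ℕ) (e : Fin d ↪o Fin n) (i : Fin d), i.1 ≤ (e i).1 := by
    intro d e i
    have hd : ∀ (m : ℕ) (hm : m < d), m ≤ (e ⟨m, hm⟩).1 := by
      intro m
      induction m with
      | zero => intro _; exact Nat.zero_le _
      | succ m ih =>
        intro hm
        have h1 := ih (by omega)
        have h2 : e ⟨m, by omega⟩ < e ⟨m + 1, hm⟩ := e.strictMono (by simp)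
        have h3 : (e ⟨m, by omega⟩).1 < (e ⟨m + 1, hm⟩).1 := h2
        omega
    exact hd i.1 i.2
  exact this _ _ i

theorem sum_comp_perm_subset (lam : Fin n → ℕ) (s : Equiv.Perm (Fin n)) (S : Finset (Fin n)) :
    ∑ k ∈ S, (lam ∘ s) k = ∑ k ∈ S.map s.toEmbedding, lam k := by
  rw [Finset.sum_map]; rfl

theorem sum_le_headSum_of_mem_orbit {lam al : Fin n → ℕ} (hl : Antitone lam) (h : al ∈ orbit lam)
    (S : Finset (Fin n)) : ∑ k ∈ S, al k ≤ headSum lam S.card := by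
  obtain ⟨s, rfl⟩ := mem_orbit.1 h
  rw [sum_comp_perm_subset]
  exact (sum_le_headSum hl _).trans (by rw [Finset.card_map])

theorem sum_eq_of_mem_orbit {lam al : Fin n → ℕ} (h : al ∈ orbit lam) (F : ℕ → ℕ) :
    ∑ k, F (al k) = ∑ k, F (lam k) := by
  obtain ⟨s, rfl⟩ := mem_orbit.1 h
  exact Equiv.sum_comp s fun k => F (lam k)

theorem sum_split_pair (S : Finset (Fin n)) (i : Fin (n - 1)) (F : Fin n → ℕ) :
    ∑ k ∈ S, F k = ∑ k ∈ (S.erase (lft i)).erase (rgt i), F k +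
      ((if lft i ∈ S then F (lft i) else 0) + if rgt i ∈ S then F (rgt i) else 0) := by
  have hn := lft_ne_rgt i
  by_cases h1 : lft i ∈ S <;> by_cases h2 : rgt i ∈ S <;> simp only [h1, h2, if_true, if_false]
  · rw [← Finset.sum_erase_add _ _ h1,
      ← Finset.sum_erase_add _ _ (Finset.mem_erase.2 ⟨hn.symm, h2⟩)]
    ring
  · rw [Finset.erase_eq_of_notMem (a := rgt i) (by simp [h2]), ← Finset.sum_erase_add _ _ h1]
    ring
  · rw [Finset.erase_eq_of_notMem h1, ← Finset.sum_erase_add _ _ h2]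
    ring
  · rw [Finset.erase_eq_of_notMem h1, Finset.erase_eq_of_notMem h2]
    ring

theorem Between.sum_off {i : Fin (n - 1)} {al be : Fin n → ℕ} (h : Between i al be)
    (S : Finset (Fin n)) (F : ℕ → ℕ) :
    ∑ k ∈ (S.erase (lft i)).erase (rgt i), F (be k) =
      ∑ k ∈ (S.erase (lft i)).erase (rgt i), F (al k) :=
  Finset.sum_congr rfl fun k hk => by
    simp only [Finset.mem_erase] at hk
    rw [h.off k hk.2.1 hk.1]

theorem sq_add_sq_le {a b c d : ℕ} (h1 : min a b ≤ c) (h2 : c ≤ max a b) (h : c + d = a + b) :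
    c ^ 2 + d ^ 2 ≤ a ^ 2 + b ^ 2 := by
  rcases le_total a b with hab | hab
  · rw [min_eq_left hab] at h1
    rw [max_eq_right hab] at h2
    obtain ⟨x, rfl⟩ := Nat.exists_eq_add_of_le h1
    obtain ⟨y, rfl⟩ := Nat.exists_eq_add_of_le h2
    obtain rfl : d = a + y := by omega
    nlinarith [Nat.zero_le (x * y)]
  · rw [min_eq_right hab] at h1
    rw [max_eq_left hab] at h2
    obtain ⟨x, rfl⟩ := Nat.exists_eq_add_of_le h1
    obtain ⟨y, rfl⟩ := Nat.exists_eq_add_of_le h2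
    obtain rfl : d = b + y := by omega
    nlinarith [Nat.zero_le (x * y)]

theorem sq_add_sq_lt {a b c d : ℕ} (h1 : b < c) (h2 : c < a) (h : c + d = a + b) :
    c ^ 2 + d ^ 2 < a ^ 2 + b ^ 2 := by
  obtain ⟨x, rfl⟩ := Nat.exists_eq_add_of_lt h1
  obtain ⟨y, rfl⟩ := Nat.exists_eq_add_of_lt h2
  obtain rfl : d = b + y + 1 := by omega
  nlinarith [Nat.zero_le (x * y)]

theorem Between.sum_eq {i : Fin (n - 1)} {al be : Fin n → ℕ} (h : Between i al be) :
    ∑ k, be k = ∑ k, al k := by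
  have e := h.sum_off Finset.univ id
  have := h.add
  rw [sum_split_pair _ i, sum_split_pair _ i (fun k => al k)]
  simp only [id] at e
  simp only [Finset.mem_univ, if_true]
  omega

theorem Between.sum_le {i : Fin (n - 1)} {al be : Fin n → ℕ} (h : Between i al be) {b : ℕ → ℕ}
    (hb : ∀ S : Finset (Fin n), ∑ k ∈ S, al k ≤ b S.card) (S : Finset (Fin n)) :
    ∑ k ∈ S, be k ≤ b S.card := by
  have e := h.sum_off S id
  have h1 := hb S
  -- The bound depends only on the size of S, so it also holds for the image of S under s_i. If S
  -- contains just one of the two places, the entry of `be` there is at most the larger of the two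
  -- entries of `al`, which one of the two bounds covers.
  have h2 : ∑ k ∈ S, (al ∘ simpleSwap i) k ≤ b S.card := by
    rw [sum_comp_perm_subset]
    exact (hb _).trans (by rw [Finset.card_map])
  have h3 : ∑ k ∈ (S.erase (lft i)).erase (rgt i), (al ∘ simpleSwap i) k =
      ∑ k ∈ (S.erase (lft i)).erase (rgt i), al k :=
    Finset.sum_congr rfl fun k hk => by
      simp only [Finset.mem_erase] at hk
      simp [simpleSwap_of_ne hk.2.1 hk.1]
  rw [sum_split_pair _ i] at h1 h2 ⊢
  rw [h3] at h2
  simp only [id] at e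
  simp only [Function.comp_apply, simpleSwap_lft, simpleSwap_rgt] at h2
  have h4 := h.add
  have h5 := h.min_le
  have h6 := h.le_max
  split_ifs at * <;> omega

theorem Between.dominated {lam al be : Fin n → ℕ} {i : Fin (n - 1)} (h : Between i al be)
    (hd : Dominated lam al) : Dominated lam be where
  sum_eq := h.sum_eq.trans hd.sum_eq
  sum_le := h.sum_le hd.sum_le
  sq_lt := by
    refine lt_of_le_of_lt ?_ hd.sq_lt
    have e := h.sum_off Finset.univ (· ^ 2)
    have := sq_add_sq_le h.min_le h.le_max h.add
    rw [sum_split_pair _ i, sum_split_pair _ i (fun k => al k ^ 2)]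
    simp only [Finset.mem_univ, if_true]
    omega

theorem Between.dominated_of_mem_orbit {lam al be : Fin n → ℕ} {i : Fin (n - 1)}
    (h : Between i al be) (hl : Antitone lam) (ho : al ∈ orbit lam)
    (h1 : al (rgt i) < be (lft i)) (h2 : be (lft i) < al (lft i)) : Dominated lam be where
  sum_eq := h.sum_eq.trans (sum_eq_of_mem_orbit ho id)
  sum_le := h.sum_le (sum_le_headSum_of_mem_orbit hl ho)
  sq_lt := by
    refine lt_of_lt_of_eq ?_ (sum_eq_of_mem_orbit ho (· ^ 2))
    have e := h.sum_off Finset.univ (· ^ 2)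
    have := sq_add_sq_lt h1 h2 h.add
    rw [sum_split_pair _ i, sum_split_pair _ i (fun k => al k ^ 2)]
    simp only [Finset.mem_univ, if_true]
    omega

end Dominance

/-! ### Leading terms of the family. -/

section Leading

variable {K : Type*} [Field K] {n : ℕ}

/-- Each `f mu` has the leading term `x ^ mu`. -/
def HasLeadingTerms (lam : Fin n → ℕ) (f : (Fin n → ℕ) → MvPolynomial (Fin n) K) : Prop :=
  ∀ mu ∈ orbit lam, f mu - xPow K mu ∈ expSpan K (Dominated lam)

/-- Along bubble sort T_i takes x^μ to x^{s_i μ} up to strictly intermediate exponents, whose sum of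
squares is smaller; exponents that are already dominated stay dominated. -/
theorem IsHeckeFamily.hasLeadingTerms {t : K} {lam : Fin n → ℕ}
    {f : (Fin n → ℕ) → MvPolynomial (Fin n) K} (hf : IsHeckeFamily t lam f) (hl : Antitone lam)
    (h : f lam - xPow K lam ∈ expSpan K (Dominated lam)) : HasLeadingTerms lam f := by
  suffices hd : ∀ (d : ℕ) (s : Equiv.Perm (Fin n)), invs (lam ∘ s) = d →
      f (lam ∘ s) - xPow K (lam ∘ s) ∈ expSpan K (Dominated lam) by
    intro mu hmu
    obtain ⟨s, rfl⟩ := mem_orbit.1 hmu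
    exact hd _ s rfl
  intro d
  induction d using Nat.strong_induction_on with
  | _ d ih =>
  rintro s rfl
  by_cases hex : ∃ i : Fin (n - 1), (lam ∘ s) (lft i) < (lam ∘ s) (rgt i)
  · obtain ⟨i, hi⟩ := hex
    have e := invs_comp_simpleSwap _ i hi
    have hs := ih (invs ((lam ∘ s) ∘ simpleSwap i)) (by omega) (s * simpleSwap i) rfl
    have e1 : lam ∘ ⇑(s * simpleSwap i) = (lam ∘ s) ∘ simpleSwap i := rfl
    have hlt : (lam ∘ ⇑(s * simpleSwap i)) (rgt i) < (lam ∘ ⇑(s * simpleSwap i)) (lft i) := by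
      rw [e1]
      simpa [simpleSwap_lft, simpleSwap_rgt] using hi
    have e2 := hf.desc (s * simpleSwap i) i hlt
    have h1 := heckeGen_xPow_of_gt t i hlt
    rw [e1, comp_simpleSwap_comp_simpleSwap] at e2 h1
    rw [e1] at hs
    have h2 : heckeGen t i (f ((lam ∘ s) ∘ simpleSwap i) - xPow K ((lam ∘ s) ∘ simpleSwap i)) ∈
        expSpan K (Dominated lam) :=
      map_mem_expSpan (fun mu hmu => expSpan_mono (fun _ hb => hb.dominated hmu)
        (heckeGen_xPow t i mu)) hs
    have h3 : heckeGen t i (xPow K ((lam ∘ s) ∘ simpleSwap i)) - xPow K (lam ∘ s) ∈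
        expSpan K (Dominated lam) :=
      expSpan_mono (fun be hb => hb.1.dominated_of_mem_orbit hl
        (comp_mem_orbit (mem_orbit.2 ⟨s, rfl⟩) _) hb.2.1 hb.2.2) h1
    have h4 := Submodule.add_mem _ h2 h3
    rwa [map_sub, e2, sub_add_sub_cancel] at h4
  · push Not at hex
    rwa [comp_perm_eq_of_antitone hl (antitone_of_forall_le hex)]

theorem recCoeff_sub_one (q t : K) (lam : Fin n → ℕ) :
    recCoeff q t lam (fun k => lam k - 1) = 1 := by
  have h1 : Fits lam fun k => lam k - 1 := fun k => by simp only; omega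
  have h2 : excess lam (fun k => lam k - 1) = 0 :=
    Finset.sum_eq_zero fun k _ => by split_ifs with h <;> simp [h]
  have h3 : ∀ v, defect lam (fun k => lam k - 1) v = 0 := by
    intro v
    rw [defect, Finset.card_eq_zero, Finset.filter_eq_empty_iff]
    rintro k - ⟨_, h⟩
    omega
  rw [recCoeff, if_pos h1, h2, pow_zero, one_mul]
  exact Finset.prod_eq_one fun v _ => by simp [h3, defectFactor]

theorem headSum_sub_one_add {lam : Fin n → ℕ} (hl : Antitone lam) (S : Finset (Fin n)) :
    headSum (fun k => lam k - 1) S.card + (S.filter fun k => 0 < lam k).card ≤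
      headSum lam S.card := by
  have h1 : headSum lam S.card = headSum (fun k => lam k - 1) S.card +
      headSum (fun k => if 0 < lam k then 1 else 0) S.card := by
    rw [headSum, headSum, headSum, ← Finset.sum_add_distrib]
    exact Finset.sum_congr rfl fun k _ => by split_ifs <;> omega
  have h2 : Antitone fun k => if 0 < lam k then 1 else 0 := by
    intro a b hab
    have := hl hab
    simp only
    split_ifs <;> omega
  have h3 := sum_le_headSum h2 S
  rw [Finset.card_filter]
  omega

/-- Hypothesis `h3` compares the squares after 1 is added on the support A of `lam`: the sum of
squares grows by twice the sum over A plus the size of A. -/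
theorem Dominated.add_one {lam al : Fin n → ℕ} (hl : Antitone lam)
    (h1 : ∑ k, al k = ∑ k, (lam k - 1))
    (h2 : ∀ S : Finset (Fin n), ∑ k ∈ S, al k ≤ headSum (fun k => lam k - 1) S.card)
    (h3 : ∑ k, al k ^ 2 + 2 * ∑ k with 0 < lam k, al k <
      ∑ k, (lam k - 1) ^ 2 + 2 * ∑ k with 0 < lam k, (lam k - 1)) :
    Dominated lam ((fun k => if k ∈ Finset.univ.filter fun k => 0 < lam k then 1 else 0) + al) where
  sum_eq := by
    have : ∑ k, lam k = ∑ k, ((if k ∈ Finset.univ.filter fun k => 0 < lam k then 1 else 0) +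
        (lam k - 1)) :=
      Finset.sum_congr rfl fun k _ => by simp only [Finset.mem_filter, Finset.mem_univ, true_and]; split_ifs <;> omega
    rw [this]
    simp only [Pi.add_apply]
    rw [Finset.sum_add_distrib, Finset.sum_add_distrib, h1]
  sum_le S := by
    have e := headSum_sub_one_add hl S
    have := h2 S
    simp only [Pi.add_apply, Finset.mem_filter, Finset.mem_univ, true_and]
    rw [Finset.sum_add_distrib, ← Finset.card_filter]
    omega
  sq_lt := by
    have key : ∀ al : Fin n → ℕ,
        ∑ k, (((fun k => if k ∈ Finset.univ.filter fun k => 0 < lam k then 1 else 0 : Fin n → ℕ) + al) k) ^ 2 =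
        (∑ k, al k ^ 2 + 2 * ∑ k with 0 < lam k, al k) + ∑ k, if 0 < lam k then 1 else 0 := by
      intro al
      rw [Finset.sum_filter, Finset.mul_sum, ← Finset.sum_add_distrib, ← Finset.sum_add_distrib]
      refine Finset.sum_congr rfl fun k _ => ?_
      simp only [Pi.add_apply, Finset.mem_filter, Finset.mem_univ, true_and]
      split_ifs <;> ring
    have e : ∑ k, lam k ^ 2 =
        (∑ k, (lam k - 1) ^ 2 + 2 * ∑ k with 0 < lam k, (lam k - 1)) +
          ∑ k, if 0 < lam k then 1 else 0 := by
      rw [← key]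
      refine Finset.sum_congr rfl fun k _ => ?_
      congr 1
      simp only [Pi.add_apply, Finset.mem_filter, Finset.mem_univ, true_and]
      split_ifs <;> omega
    rw [key, e]
    omega

/-- Only ν = λ - 1 can produce x^λ, with coefficient 1. Any other fitting ν is pointwise at most λ -
1 on the support of λ and smaller somewhere, since otherwise the total sum would force it to vanish
elsewhere; this makes the sum of squares drop. -/
theorem recBase_sub_xPow (q t : K) {lam : Fin n → ℕ} (hl : Antitone lam)
    {f : (Fin n → ℕ) → MvPolynomial (Fin n) K} (hf : HasLeadingTerms (fun k => lam k - 1) f) :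
    recBase q t lam f - xPow K lam ∈ expSpan K (Dominated lam) := by
  have hk : Antitone fun k => lam k - 1 := fun a b h => Nat.sub_le_sub_right (hl h) 1
  have hmul : ∀ al, Dominated (fun k => lam k - 1) al →
      varProd K (Finset.univ.filter fun k => 0 < lam k) * xPow K al ∈
        expSpan K (Dominated lam) := by
    intro al h
    rw [varProd_eq_xPow, ← xPow_add]
    refine xPow_mem_expSpan (Dominated.add_one hl h.sum_eq h.sum_le ?_)
    -- The support is an initial segment, so the dominance bound for it is exactly the sum of λ - 1
    -- over the support.
    have hA : (Finset.univ.filter fun k => 0 < lam k) =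
        Finset.univ.filter fun k : Fin n =>
          k.1 < (Finset.univ.filter fun k => 0 < lam k).card := by
      symm
      apply Finset.eq_of_subset_of_card_le
      · intro k hk
        simp only [Finset.mem_filter, Finset.mem_univ, true_and] at hk ⊢
        by_contra hc
        have : (Finset.univ.filter fun k => 0 < lam k) ⊆ Finset.Iio k := by
          intro j hj
          simp only [Finset.mem_filter, Finset.mem_univ, true_and] at hj
          rw [Finset.mem_Iio]
          by_contra hjk
          have := hl (not_lt.1 hjk)
          omega
        have := Finset.card_le_card this
        rw [Fin.card_Iio] at this
        omega
      · have h1 : (Finset.univ.filter fun k => 0 < lam k).card ≤ n := by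
          simpa using (Finset.univ.filter fun k => 0 < lam k).card_le_univ
        generalize (Finset.univ.filter fun k => 0 < lam k).card = c at h1
        rw [Fin.card_filter_val_lt]
        simp [h1]
    have h1 := h.sum_le (Finset.univ.filter fun k => 0 < lam k)
    rw [headSum, ← hA] at h1
    have h2 := h.sq_lt
    omega
  have hterm : ∀ nu ∈ orbit (fun k => lam k - 1), nu ≠ (fun k => lam k - 1) → Fits lam nu →
      varProd K (Finset.univ.filter fun k => 0 < lam k) * xPow K nu ∈
        expSpan K (Dominated lam) := by
    intro nu hnu hne hfit
    rw [varProd_eq_xPow, ← xPow_add]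
    refine xPow_mem_expSpan (Dominated.add_one hl (sum_eq_of_mem_orbit hnu id)
      (sum_le_headSum_of_mem_orbit hk hnu) ?_)
    rw [sum_eq_of_mem_orbit hnu (· ^ 2)]
    have hle : ∀ k ∈ Finset.univ.filter (fun k => 0 < lam k), nu k ≤ lam k - 1 := by
      intro k hk
      have := hfit k
      simp only [Finset.mem_filter, Finset.mem_univ, true_and] at hk
      omega
    refine Nat.add_lt_add_left (Nat.mul_lt_mul_of_pos_left ?_ two_pos) _
    refine lt_of_le_of_ne (Finset.sum_le_sum hle) fun heq => hne ?_
    have h1 := (Finset.sum_eq_sum_iff_of_le hle).1 heq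
    have h2 := sum_eq_of_mem_orbit hnu id
    simp only [id] at h2
    rw [← Finset.sum_filter_add_sum_filter_not Finset.univ (fun k => 0 < lam k),
      ← Finset.sum_filter_add_sum_filter_not Finset.univ (fun k => 0 < lam k)
        (fun k => lam k - 1), heq] at h2
    have h3 : ∑ k with ¬0 < lam k, (lam k - 1) = 0 := by
      refine Finset.sum_eq_zero fun k hk => ?_
      simp only [Finset.mem_filter, Finset.mem_univ, true_and] at hk
      omega
    rw [h3, add_zero, Nat.add_eq_left, Finset.sum_eq_zero_iff] at h2
    ext k
    by_cases hk : 0 < lam k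
    · exact h1 k (by simp [hk])
    · rw [h2 k (by simpa using hk)]
      omega
  have hexp : recBase q t lam f - xPow K lam = ∑ nu ∈ orbit (fun k => lam k - 1),
      (recCoeff q t lam nu • LinearMap.mulLeft K (varProd K {k | 0 < lam k}) (f nu - xPow K nu) +
        if nu = (fun k => lam k - 1) then 0 else
          recCoeff q t lam nu • (varProd K {k | 0 < lam k} * xPow K nu)) := by
    rw [recBase, orbitSum, Finset.mul_sum, Finset.sum_add_distrib,
      ← Finset.sum_erase_add _ _ (self_mem_orbit fun k => lam k - 1)]
    rw [← Finset.sum_erase_add _ _ (self_mem_orbit fun k => lam k - 1),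
      ← Finset.sum_erase_add (orbit fun k => lam k - 1) (fun nu =>
        if nu = (fun k => lam k - 1) then 0 else
          recCoeff q t lam nu • (varProd K {k | 0 < lam k} * xPow K nu))
        (self_mem_orbit fun k => lam k - 1)]
    have e : xPow K lam = varProd K {k | 0 < lam k} * xPow K (fun k => lam k - 1) := by
      rw [varProd_eq_xPow, ← xPow_add]
      congr 1
      ext k
      simp only [Pi.add_apply, Finset.mem_filter, Finset.mem_univ, true_and]
      split_ifs <;> omega
    rw [if_pos rfl, recCoeff_sub_one, e, add_zero, add_right_comm, ← Finset.sum_add_distrib]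
    simp only [LinearMap.mulLeft_apply, one_smul, Equiv.Perm.coe_one, Function.comp_id]
    rw [mul_sub, ← add_sub_assoc]
    congr 2
    refine Finset.sum_congr rfl fun nu hnu => ?_
    rw [if_neg (Finset.ne_of_mem_erase hnu), mul_sub, smul_sub, mul_smul_comm, sub_add_cancel]
  rw [hexp]
  refine Submodule.sum_mem _ fun nu hnu => Submodule.add_mem _ ?_ ?_
  · exact Submodule.smul_mem _ _ (map_mem_expSpan (fun al hal => hmul al hal) (hf nu hnu))
  · split_ifs with hc
    · exact Submodule.zero_mem _
    · by_cases hfit : Fits lam nu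
      · exact Submodule.smul_mem _ _ (hterm nu hnu hc hfit)
      · rw [recCoeff_of_not_fits hfit, zero_smul]
        exact Submodule.zero_mem _

theorem hasLeadingTerms_heckeFamily_recBase (q : K) {t : K} {lam : Fin n → ℕ} (hl : Antitone lam)
    {f : (Fin n → ℕ) → MvPolynomial (Fin n) K} (hf : IsHeckeFamily t (fun k => lam k - 1) f)
    (hf' : HasLeadingTerms (fun k => lam k - 1) f) :
    HasLeadingTerms lam (heckeFamily t (recBase q t lam f)) := by
  refine (isHeckeFamily_heckeFamily t hl (heckeGen_recBase q hf)).hasLeadingTerms hl ?_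
  rw [heckeFamily_of_antitone t _ hl]
  exact recBase_sub_xPow q t hl hf'

end Leading

/-! ### The operator formula as the unwound recursion. -/

section Formula

variable {K : Type*} [Field K] {n : ℕ}

theorem le_largest (lam : Fin n → ℕ) (k : Fin n) : lam k ≤ largest lam :=
  Finset.le_sup (f := lam) (Finset.mem_univ k)

/-- Truncated parts keep their size while the recursion lowers them; a part j of the formula is the
entry v = j - (i + 1). Under this shift a-numbers give the excess, b-numbers the defects, and the
difference of conjugate parts is `below`. -/
theorem coeffC_trunc (q t : K) (lam : Fin n → ℕ) (i : ℕ) (hi : i + 1 < largest lam)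
    (s : Equiv.Perm (Fin n)) :
    coeffC q t (i + 1) (trunc lam i) (act s (trunc lam (i + 1))) =
      recCoeff q t (fun k => lam k - i) (act s fun k => lam k - (i + 1)) := by
  have hfit : (∃ k : Fin n, 0 < trunc lam i k ∧ trunc lam i k < act s (trunc lam (i + 1)) k) ↔
      ¬Fits (fun k => lam k - i) (act s fun k => lam k - (i + 1)) := by
    rw [Fits, not_forall]
    refine exists_congr fun k => ?_
    simp only [trunc, act]
    split_ifs <;> omega
  rw [coeffC, recCoeff]
  by_cases hf : Fits (fun k => lam k - i) (act s fun k => lam k - (i + 1))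
  swap
  · rw [if_pos (hfit.2 hf), if_neg hf]
  rw [if_neg (fun h => hfit.1 h hf), if_pos hf]
  obtain ⟨k0, hk0⟩ : ∃ k0, lam k0 = largest lam := by
    have hne : (Finset.univ : Finset (Fin n)).Nonempty := by
      by_contra hc
      rw [Finset.not_nonempty_iff_eq_empty] at hc
      rw [largest, hc] at hi
      simp at hi
    obtain ⟨k0, -, h⟩ := Finset.exists_mem_eq_sup _ hne lam
    exact ⟨k0, h.symm⟩
  have hr1 : largest (trunc lam i) = largest lam := by
    apply le_antisymm
    · refine Finset.sup_le fun k _ => ?_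
      have := le_largest lam k
      simp only [trunc]
      split_ifs <;> omega
    · rw [← hk0]
      refine le_trans ?_ (le_largest (trunc lam i) k0)
      simp only [trunc]
      split_ifs <;> omega
  obtain ⟨r, hr⟩ : ∃ r, largest lam = i + 1 + r := ⟨largest lam - (i + 1), by omega⟩
  have hr2 : largest (fun k => lam k - i) = r + 1 := by
    apply le_antisymm
    · refine Finset.sup_le fun k _ => ?_
      have := le_largest lam k
      omega
    · refine le_trans ?_ (le_largest (fun k => lam k - i) k0)
      omega
  have hexc : excess (fun k => lam k - i) (act s fun k => lam k - (i + 1)) =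
      ∑ v ∈ Finset.Icc 1 r,
        v * aNum (i + 1 + v) (trunc lam i) (act s (trunc lam (i + 1))) := by
    simp only [aNum, Finset.card_filter, Finset.mul_sum]
    rw [Finset.sum_comm, excess]
    refine Finset.sum_congr rfl fun k _ => ?_
    have hx := le_largest lam (s⁻¹ k)
    have e1 : trunc lam i k = if lam k ≤ i then 0 else lam k := rfl
    have e2 : act s (trunc lam (i + 1)) k =
      if lam (s⁻¹ k) ≤ i + 1 then 0 else lam (s⁻¹ k) := rfl
    have e3 : (act s fun k => lam k - (i + 1)) k = lam (s⁻¹ k) - (i + 1) := rfl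
    by_cases h1 : lam k ≤ i
    · rw [if_pos h1] at e1
      rw [if_pos (by omega)]
      by_cases h2 : lam (s⁻¹ k) ≤ i + 1
      · rw [if_pos h2] at e2
        rw [Finset.sum_eq_zero]
        · omega
        · intro v hv
          have := (Finset.mem_Icc.1 hv).1
          rw [if_neg (by omega), mul_zero]
      · rw [if_neg h2] at e2
        rw [Finset.sum_eq_single (lam (s⁻¹ k) - (i + 1))]
        · rw [if_pos (by omega), mul_one, e3]
        · intro v _ hv
          rw [if_neg (by omega), mul_zero]
        · intro h
          rw [Finset.mem_Icc] at h
          omega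
    · rw [if_neg h1] at e1
      rw [if_neg (by omega), Finset.sum_eq_zero]
      intro v _
      rw [if_neg (by omega), mul_zero]
  have hdef : ∀ v, 1 ≤ v → defect (fun k => lam k - i) (act s fun k => lam k - (i + 1)) v =
      bNum (i + 1 + v) (trunc lam i) (act s (trunc lam (i + 1))) := by
    intro v hv
    rw [defect, bNum]
    congr 1
    refine Finset.filter_congr fun k _ => ?_
    simp only [trunc, act]
    split_ifs <;> omega
  have hbel : ∀ v, below (fun k => lam k - i) v =
      conj (trunc lam i) (i + 1) - conj (trunc lam i) (i + 1 + v) := by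
    intro v
    have h : conj (trunc lam i) (i + 1) =
        below (fun k => lam k - i) v + conj (trunc lam i) (i + 1 + v) := by
      rw [conj, conj, below, ← Finset.card_union_of_disjoint]
      · congr 1
        ext k
        have e1 : trunc lam i k = if lam k ≤ i then 0 else lam k := rfl
        simp only [Finset.mem_union, Finset.mem_filter, Finset.mem_univ, true_and]
        split_ifs at e1 <;> omega
      · rw [Finset.disjoint_filter]
        intro k _
        simp only [trunc]
        split_ifs <;> omega
    omega
  -- The recursion's product runs one index further than the formula's; no column has height r + 2,
  -- so the additional factor is 1.
  have hlast : defectFactor q t (fun k => lam k - i) (r + 1)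
      (defect (fun k => lam k - i) (act s fun k => lam k - (i + 1)) (r + 1)) = 1 := by
    have : defect (fun k => lam k - i) (act s fun k => lam k - (i + 1)) (r + 1) = 0 := by
      rw [defect, Finset.card_eq_zero, Finset.filter_eq_empty_iff]
      rintro k - ⟨h, -⟩
      have := le_largest lam k
      omega
    rw [this]
    simp [defectFactor]
  rw [hr2, ← Finset.insert_Icc_right_eq_Icc_add_one (by omega), Finset.prod_insert (by simp), hlast,
    one_mul, hexc, ← Finset.prod_pow_eq_pow_sum, ← Finset.prod_mul_distrib, hr1, hr]
  refine (Finset.prod_bij (fun v _ => i + 1 + v) ?_ ?_ ?_ ?_).symm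
  · intro v hv
    rw [Finset.mem_Icc] at hv ⊢
    omega
  · intro a _ b _ h
    omega
  · intro j hj
    rw [Finset.mem_Icc] at hj
    exact ⟨j - (i + 1), by rw [Finset.mem_Icc]; omega, by omega⟩
  · intro v hv
    rw [hdef v (Finset.mem_Icc.1 hv).1, defectFactor, Nat.add_sub_cancel_left, hbel]

theorem trunc_zero (lam : Fin n → ℕ) : trunc lam 0 = lam := by
  ext k
  simp only [trunc]
  split_ifs <;> omega

theorem antitone_trunc {lam : Fin n → ℕ} (hl : Antitone lam) (i : ℕ) : Antitone (trunc lam i) := by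
  intro a b hab
  have := hl hab
  simp only [trunc]
  split_ifs <;> omega

theorem antitone_sub {lam : Fin n → ℕ} (hl : Antitone lam) (i : ℕ) :
    Antitone fun k => lam k - i := fun _ _ h => Nat.sub_le_sub_right (hl h) i

/-- Truncating and lowering have the same level sets, and coset representatives depend on nothing
else. -/
theorem distinctPerms_trunc (lam : Fin n → ℕ) (i : ℕ) :
    distinctPerms (trunc lam i) = distinctPerms fun k => lam k - i := by
  ext s
  rw [mem_distinctPerms, mem_distinctPerms]
  refine forall_congr' fun u => ?_
  have : act u (trunc lam i) = act s (trunc lam i) ↔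
      (act u fun k => lam k - i) = act s fun k => lam k - i := by
    rw [funext_iff, funext_iff]
    refine forall_congr' fun k => ?_
    simp only [act, trunc]
    split_ifs <;> omega
  rw [this]

theorem filter_pos_eq {lam : Fin n → ℕ} (hl : Antitone lam) :
    (Finset.univ.filter fun k => 0 < lam k) = Finset.univ.filter fun k : Fin n =>
      k.1 < (Finset.univ.filter fun k => 0 < lam k).card := by
  symm
  apply Finset.eq_of_subset_of_card_le
  · intro k hk
    simp only [Finset.mem_filter, Finset.mem_univ, true_and] at hk ⊢
    by_contra hc
    have : (Finset.univ.filter fun k => 0 < lam k) ⊆ Finset.Iio k := by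
      intro j hj
      simp only [Finset.mem_filter, Finset.mem_univ, true_and] at hj
      rw [Finset.mem_Iio]
      by_contra hjk
      have := hl (not_lt.1 hjk)
      omega
    have := Finset.card_le_card this
    rw [Fin.card_Iio] at this
    omega
  · have h1 : (Finset.univ.filter fun k => 0 < lam k).card ≤ n := by
      simpa using (Finset.univ.filter fun k => 0 < lam k).card_le_univ
    generalize (Finset.univ.filter fun k => 0 < lam k).card = c at h1
    rw [Fin.card_filter_val_lt]
    simp [h1]

theorem xMon_eq {lam : Fin n → ℕ} (hl : Antitone lam) :
    xMon K lam = varProd K {k | 0 < lam k} := by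
  rw [varProd, filter_pos_eq hl]
  rfl

/-- The family obtained from the constant family by `r` steps of the recursion. -/
noncomputable def qkzFamily (q t : K) : ℕ → (Fin n → ℕ) → (Fin n → ℕ) → MvPolynomial (Fin n) K
  | 0, _ => fun _ => 1
  | r + 1, lam => heckeFamily t (recBase q t lam (qkzFamily q t r fun k => lam k - 1))

theorem isHeckeFamily_one (t : K) (lam : Fin n → ℕ) (h : ∀ k, lam k = 0) :
    IsHeckeFamily t lam fun _ => 1 where
  desc s i hi := by simp [h] at hi
  eq s i _ := heckeGen_one t i

theorem isHeckeFamily_qkzFamily (q t : K) (r : ℕ) {lam : Fin n → ℕ} (hl : Antitone lam)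
    (hr : ∀ k, lam k ≤ r) : IsHeckeFamily t lam (qkzFamily q t r lam) := by
  induction r generalizing lam with
  | zero => exact isHeckeFamily_one t lam fun k => Nat.le_zero.1 (hr k)
  | succ r ih =>
    exact isHeckeFamily_heckeFamily t hl (heckeGen_recBase q
      (ih (antitone_sub hl 1) fun k => by have := hr k; omega))

theorem hasLeadingTerms_qkzFamily (q t : K) (r : ℕ) {lam : Fin n → ℕ} (hl : Antitone lam)
    (hr : ∀ k, lam k ≤ r) : HasLeadingTerms lam (qkzFamily q t r lam) := by
  induction r generalizing lam with
  | zero =>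
    intro mu hmu
    obtain ⟨s, rfl⟩ := mem_orbit.1 hmu
    have : xPow K (lam ∘ s) = 1 := Finset.prod_eq_one fun k _ => by
      simp [Nat.le_zero.1 (hr (s k))]
    rw [this, qkzFamily, sub_self]
    exact Submodule.zero_mem _
  | succ r ih =>
    have hr' : ∀ k, lam k - 1 ≤ r := fun k => by have := hr k; omega
    exact hasLeadingTerms_heckeFamily_recBase q hl
      (isHeckeFamily_qkzFamily q t r (antitone_sub hl 1) hr') (ih (antitone_sub hl 1) hr')

theorem isQKZ_qkzFamily {N : ℕ} {q t : K} (H : Generic q t) (r : ℕ) {lam : Fin (N + 1) → ℕ}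
    (hl : Antitone lam) (hr : ∀ k, lam k ≤ r) : IsQKZ q t lam (qkzFamily q t r lam) := by
  induction r generalizing lam with
  | zero =>
    refine { isHeckeFamily_one t lam fun k => Nat.le_zero.1 (hr k) with cyc := fun s => ?_ }
    simp [qkzFamily, Nat.le_zero.1 (hr (s 0))]
  | succ r ih =>
    exact isQKZ_heckeFamily_recBase H hl
      (ih (antitone_sub hl 1) fun k => by have := hr k; omega)

theorem sum_distinctPerms_heckeT {t : K} {kap : Fin n → ℕ}
    {f : (Fin n → ℕ) → MvPolynomial (Fin n) K} (hf : IsHeckeFamily t kap f) (hl : Antitone kap)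
    (h : (Fin n → ℕ) → K) :
    ∑ s ∈ distinctPerms kap, h (act s kap) • heckeT t s (f kap) = orbitSum kap f 1 h := by
  rw [orbitSum, ← sum_distinctPerms hl]
  exact Finset.sum_congr rfl fun s hs => by rw [hf.heckeT_apply hl hs]; rfl

/-- Induction on the number m of remaining levels: multiplying the inner product by the next
monomial gives the base member of the lowered family, and the sum over σ then gives its weighted
orbit sum. -/
theorem xMon_mul_prod_levelOp (q t : K) {lam : Fin n → ℕ} (hl : Antitone lam) {r : ℕ}
    (hr : largest lam = r + 1) (m i : ℕ) (him : i + m = r) :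
    xMon K (trunc lam i) *
      ((List.range' i m).map fun j => levelOp q t lam (j + 1)).prod 1 =
      qkzFamily q t (m + 1) (fun k => lam k - i) fun k => lam k - i := by
  have hx : xMon K (trunc lam i) =
      varProd K (Finset.univ.filter fun k => 0 < (fun k => lam k - i) k) := by
    rw [xMon_eq (antitone_trunc hl i)]
    congr 1
    refine Finset.filter_congr fun k _ => ?_
    simp only [trunc]
    split_ifs <;> omega
  rw [qkzFamily, heckeFamily_of_antitone _ _ (antitone_sub hl i), recBase, hx]
  congr 1
  induction m generalizing i with
  | zero =>
    -- At i = r no operators remain and the lowered composition is zero, so the orbit sum has one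
    -- term, with coefficient 1.
    have h0 : (fun k => lam k - i - 1) = fun _ => 0 := by
      ext k
      have := le_largest lam k
      omega
    have horb : orbit (fun _ : Fin n => 0) = {fun _ => 0} := by
      ext nu
      rw [mem_orbit, Finset.mem_singleton]
      exact ⟨fun ⟨s, h⟩ => h.symm, fun h => ⟨1, h.symm⟩⟩
    have := recCoeff_sub_one q t fun k => lam k - i
    simp only [h0] at this
    rw [h0, orbitSum, horb, Finset.sum_singleton, this]
    simp [qkzFamily]
  | succ m ih =>
    have hsub : (fun k => lam k - i - 1) = fun k => lam k - (i + 1) := by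
      ext k; omega
    have hle : ∀ k, lam k - (i + 1) ≤ m + 1 := fun k => by
      have := le_largest lam k; omega
    have hx' : xMon K (trunc lam (i + 1)) =
        varProd K (Finset.univ.filter fun k => 0 < (fun k => lam k - (i + 1)) k) := by
      rw [xMon_eq (antitone_trunc hl _)]
      congr 1
      refine Finset.filter_congr fun k _ => ?_
      simp only [trunc]
      split_ifs <;> omega
    have hbase : xMon K (trunc lam (i + 1)) *
        ((List.range' (i + 1) m).map fun j => levelOp q t lam (j + 1)).prod 1 =
        qkzFamily q t (m + 1) (fun k => lam k - (i + 1)) fun k => lam k - (i + 1) := by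
      rw [ih (i + 1) (by omega) hx', qkzFamily,
        heckeFamily_of_antitone _ _ (antitone_sub hl _), recBase, hx']
    rw [List.range'_succ, List.map_cons, List.prod_cons, Module.End.mul_apply, levelOp,
      LinearMap.sum_apply, hsub, ← sum_distinctPerms_heckeT
        (isHeckeFamily_qkzFamily q t (m + 1) (antitone_sub hl _) hle) (antitone_sub hl _),
      distinctPerms_trunc]
    refine Finset.sum_congr rfl fun s _ => ?_
    rw [LinearMap.smul_apply, Module.End.mul_apply, LinearMap.mulLeft_apply, hbase,
      Nat.add_sub_cancel, coeffC_trunc q t lam i (by omega)]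

/-- The sum of the members of the family of `lam`. -/
noncomputable def orbitPoly (q t : K) (lam : Fin n → ℕ) : MvPolynomial (Fin n) K :=
  ∑ mu ∈ orbit lam, qkzFamily q t (largest lam) lam mu

theorem topOp_apply_eq_orbitPoly (q t : K) {lam : Fin n → ℕ} (hl : Antitone lam) :
    (topOp t lam * ((List.range (largest lam - 1)).map
      fun i => levelOp q t lam (i + 1)).prod) 1 = orbitPoly q t lam := by
  have hbase : xMon K lam * ((List.range (largest lam - 1)).map
      fun i => levelOp q t lam (i + 1)).prod 1 = qkzFamily q t (largest lam) lam lam := by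
    rcases Nat.eq_zero_or_pos (largest lam) with h0 | h0
    · have h : ∀ k, lam k = 0 := fun k => by have := le_largest lam k; omega
      rw [xMon_eq hl, h0]
      simp [qkzFamily, h, varProd]
    · obtain ⟨r, hr⟩ : ∃ r, largest lam = r + 1 := ⟨largest lam - 1, by omega⟩
      have e := xMon_mul_prod_levelOp q t hl hr r 0 (by omega)
      rw [hr, Nat.add_sub_cancel, List.range_eq_range']
      simpa only [trunc_zero, Nat.sub_zero] using e
  have hf := isHeckeFamily_qkzFamily q t (largest lam) hl (le_largest lam)
  have e := sum_distinctPerms_heckeT hf hl fun _ => 1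
  simp only [one_smul, orbitSum] at e
  rw [orbitPoly, Module.End.mul_apply, topOp, LinearMap.sum_apply]
  refine Eq.trans (Finset.sum_congr rfl fun s _ => ?_) e
  rw [Module.End.mul_apply, LinearMap.mulLeft_apply, hbase]

theorem coeff_orbitPoly_self (q t : K) {lam : Fin n → ℕ} (hl : Antitone lam) :
    coeff (Finsupp.equivFunOnFinite.symm lam) (orbitPoly q t lam) = 1 := by
  have hd : ¬Dominated lam lam := fun h => lt_irrefl _ h.sq_lt
  have hlead := hasLeadingTerms_qkzFamily q t (largest lam) hl (le_largest lam)
  rw [orbitPoly, coeff_sum, Finset.sum_eq_single lam]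
  · have := coeff_eq_zero_of_mem_expSpan (hlead lam (self_mem_orbit lam)) hd
    rw [coeff_sub, coeff_xPow, if_pos rfl] at this
    exact sub_eq_zero.1 this
  · intro mu hmu hne
    have := coeff_eq_zero_of_mem_expSpan (hlead mu hmu) hd
    rwa [coeff_sub, coeff_xPow, if_neg hne, sub_zero] at this
  · exact fun h => absurd (self_mem_orbit lam) h

theorem dominated_of_coeff_orbitPoly_ne_zero {q t : K} {lam : Fin n → ℕ} (hl : Antitone lam)
    {al : Fin n → ℕ} (hal : al ∉ orbit lam)
    (h : coeff (Finsupp.equivFunOnFinite.symm al) (orbitPoly q t lam) ≠ 0) : Dominated lam al := by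
  by_contra hd
  have hlead := hasLeadingTerms_qkzFamily q t (largest lam) hl (le_largest lam)
  refine h ?_
  rw [orbitPoly, coeff_sum]
  refine Finset.sum_eq_zero fun mu hmu => ?_
  have := coeff_eq_zero_of_mem_expSpan (hlead mu hmu) hd
  rwa [coeff_sub, coeff_xPow, if_neg, sub_zero] at this
  rintro rfl
  exact hal hmu

end Formula

/-! ### Symmetry of the orbit sum. -/

section Symmetry

variable {K : Type*} [Field K] {n : ℕ}

/-- The changed arrangement is absorbed into the coefficients, so T_i becomes an operator on
coefficient functions alone; the constant function 1 is sent to t. -/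
theorem IsHeckeFamily.heckeGen_orbitSum_one {t : K} {lam : Fin n → ℕ}
    {f : (Fin n → ℕ) → MvPolynomial (Fin n) K} (hf : IsHeckeFamily t lam f) (i : Fin (n - 1))
    (h : (Fin n → ℕ) → K) :
    heckeGen t i (orbitSum lam f 1 h) = orbitSum lam f 1 fun nu =>
      if nu (rgt i) ≤ nu (lft i) then t * h (nu ∘ simpleSwap i)
      else h (nu ∘ simpleSwap i) + (t - 1) * h nu := by
  have e := hf.heckeGen_orbitSum 1 i h
  rw [one_mul, ← mul_one (simpleSwap i), orbitSum_mul] at e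
  rw [e]
  refine orbitSum_congr fun nu _ => ?_
  simp only [simpleSwap_inv, Equiv.Perm.one_apply, Function.comp_apply, simpleSwap_lft,
    simpleSwap_rgt]
  congr 3
  exact congrArg h (comp_simpleSwap_comp_simpleSwap nu i)

theorem isSymmetric_of_rename_simpleSwap {f : MvPolynomial (Fin n) K}
    (h : ∀ i : Fin (n - 1), rename (simpleSwap i) f = f) : f.IsSymmetric := by
  intro s
  obtain ⟨w, rfl⟩ := exists_word s
  induction w with
  | nil => simp
  | cons i w ih =>
    rw [List.map_cons, List.prod_cons, Equiv.Perm.coe_mul, ← rename_rename, ih, h]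

theorem orbitPoly_eq (q t : K) (lam : Fin n → ℕ) :
    orbitPoly q t lam = orbitSum lam (qkzFamily q t (largest lam) lam) 1 fun _ => 1 := by
  simp [orbitPoly, orbitSum]

theorem isSymmetric_orbitPoly (q : K) {t : K} (ht : t ≠ 0) {lam : Fin n → ℕ} (hl : Antitone lam) :
    (orbitPoly q t lam).IsSymmetric := by
  refine isSymmetric_of_rename_simpleSwap fun i => rename_eq_of_heckeGen_eq_smul t ht ?_
  rw [orbitPoly_eq, (isHeckeFamily_qkzFamily q t _ hl (le_largest lam)).heckeGen_orbitSum_one,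
    ← orbitSum_smul]
  refine orbitSum_congr fun nu _ => ?_
  split_ifs <;> ring

end Symmetry

/-! ### The orbit sum as an eigenvector of a difference operator. -/

section Difference

variable {K : Type*} [Field K] {N : ℕ}

/-- `T_m ⋯ T_{N-1}`. -/
noncomputable def heckeTail (t : K) (m : Fin (N + 1)) :
    Module.End K (MvPolynomial (Fin (N + 1)) K) :=
  Fin.reverseInduction (motive := fun _ => Module.End K (MvPolynomial (Fin (N + 1)) K)) 1
    (fun i T => heckeGen (n := N + 1) t i * T) m

theorem heckeTail_last (t : K) : heckeTail t (Fin.last N) = 1 :=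
  Fin.reverseInduction_last

theorem heckeTail_castSucc (t : K) (i : Fin N) :
    heckeTail t i.castSucc = heckeGen (n := N + 1) t i * heckeTail t i.succ :=
  Fin.reverseInduction_castSucc i

/-- The difference operator `∑_m T_m ⋯ T_{N-1} ω`. -/
noncomputable def diffOp (q t : K) : Module.End K (MvPolynomial (Fin (N + 1)) K) :=
  (∑ m, heckeTail t m) * (cycOp q).toLinearMap

theorem diffOp_apply (q t : K) (f : MvPolynomial (Fin (N + 1)) K) :
    diffOp q t f = ∑ m, heckeTail t m (cycOp q f) := by
  rw [diffOp, Module.End.mul_apply, LinearMap.sum_apply]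
  rfl

/-- The weights with `∑_{x ≤ v ≤ r} stepWeight q r v = q ^ x`. -/
def stepWeight (q : K) (r v : ℕ) : K := if v < r then q ^ v - q ^ (v + 1) else q ^ v

theorem sum_stepWeight (q : K) {r x : ℕ} (h : x ≤ r) :
    ∑ v ∈ Finset.range (r + 1), (if x ≤ v then stepWeight q r v else 0) = q ^ x := by
  have hd : ∀ d, d ≤ r → ∑ v ∈ Finset.range d, (if x ≤ v then q ^ v - q ^ (v + 1) else 0) =
      if x ≤ d then q ^ x - q ^ d else 0 := by
    intro d
    induction d with
    | zero =>
      intro _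
      rw [Finset.sum_range_zero]
      split_ifs with hx
      · rw [Nat.le_zero.1 hx, sub_self]
      · rfl
    | succ d ih =>
      intro hd
      rw [Finset.sum_range_succ, ih (by omega)]
      rcases lt_trichotomy x (d + 1) with hx | hx | hx
      · rw [if_pos (by omega), if_pos (by omega), if_pos hx.le]
        ring
      · rw [if_neg (by omega), if_neg (by omega), if_pos hx.le, hx]
        ring
      · rw [if_neg (by omega), if_neg (by omega), if_neg (by omega), add_zero]
  rw [Finset.sum_range_succ, if_pos h, stepWeight, if_neg (lt_irrefl r)]
  have : ∑ v ∈ Finset.range r, (if x ≤ v then stepWeight q r v else 0) =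
      ∑ v ∈ Finset.range r, (if x ≤ v then q ^ v - q ^ (v + 1) else 0) :=
    Finset.sum_congr rfl fun v hv => by rw [stepWeight, if_pos (Finset.mem_range.1 hv)]
  rw [this, hd r le_rfl, if_pos h]
  ring

theorem sum_pow_card_filter_lt {ι : Type*} [LinearOrder ι] (t : K) (S : Finset ι) :
    (t - 1) * ∑ m ∈ S, t ^ (S.filter fun j => m < j).card = t ^ S.card - 1 := by
  induction S using Finset.induction_on_min with
  | empty => simp
  | insert a S ha ih =>
    have hn : a ∉ S := fun h => lt_irrefl _ (ha a h)
    have h1 : (insert a S).filter (fun j => a < j) = S := by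
      rw [Finset.filter_insert, if_neg (lt_irrefl a), Finset.filter_true_of_mem ha]
    have h2 : ∀ m ∈ S, (insert a S).filter (fun j => m < j) = S.filter fun j => m < j := by
      intro m hm
      rw [Finset.filter_insert, if_neg (ha m hm).not_gt]
    rw [Finset.sum_insert hn, h1, Finset.sum_congr rfl fun m hm => by rw [h2 m hm], mul_add, ih,
      Finset.card_insert_of_notMem hn, pow_succ]
    ring

/-- The coefficients of `T_m ⋯ T_{N-1} ω ∑ f_mu`. -/
noncomputable def tailCoeff (q t : K) (r : ℕ) (m : Fin (N + 1)) (nu : Fin (N + 1) → ℕ) : K :=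
  ∑ v ∈ Finset.range (r + 1), stepWeight q r v *
    if nu m ≤ v then t ^ Finset.card {j : Fin (N + 1) | m < j ∧ nu j ≤ v} else 0

/-- Writing q^x as a sum of step functions in x reduces this to one threshold v at a time, where
only the truth of the two inequalities ν_i ≤ v and ν_{i+1} ≤ v matters. -/
theorem tailCoeff_step (q t : K) (r : ℕ) (i : Fin N) (nu : Fin (N + 1) → ℕ) :
    (if nu i.succ ≤ nu i.castSucc then
      t * tailCoeff q t r i.succ (nu ∘ simpleSwap (n := N + 1) i)
      else tailCoeff q t r i.succ (nu ∘ simpleSwap (n := N + 1) i) +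
        (t - 1) * tailCoeff q t r i.succ nu) = tailCoeff q t r i.castSucc nu := by
  have h1 : ∀ v, Finset.card {j : Fin (N + 1) | i.castSucc < j ∧ nu j ≤ v} =
      Finset.card {j : Fin (N + 1) | i.succ < j ∧ nu j ≤ v} + if nu i.succ ≤ v then 1 else 0 := by
    intro v
    have : (Finset.univ.filter fun j => i.castSucc < j ∧ nu j ≤ v) =
        (insert i.succ (Finset.univ.filter fun j => i.succ < j)).filter fun j => nu j ≤ v := by
      ext k
      simp only [Finset.mem_insert, Finset.mem_filter, Finset.mem_univ, true_and,
        Fin.castSucc_lt_iff_succ_le, le_iff_eq_or_lt, eq_comm]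
    rw [this, card_filter_insert (by simp), Finset.filter_filter]
  have h2 : ∀ v, Finset.card {j : Fin (N + 1) | i.succ < j ∧
        (nu ∘ simpleSwap (n := N + 1) i) j ≤ v} =
      Finset.card {j : Fin (N + 1) | i.succ < j ∧ nu j ≤ v} := by
    intro v
    congr 1
    refine Finset.filter_congr fun j _ => and_congr_right fun hj => ?_
    rw [Function.comp_apply, simpleSwap_of_ne]
    · rw [lft_eq_castSucc]; exact ((Fin.castSucc_lt_succ).trans hj).ne'
    · rw [rgt_eq_succ]; exact hj.ne'
  have h3 : (nu ∘ simpleSwap (n := N + 1) i) i.succ = nu i.castSucc := by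
    rw [Function.comp_apply, ← rgt_eq_succ, simpleSwap_rgt, lft_eq_castSucc]
  simp only [tailCoeff, h1, h2, h3]
  split_ifs with hle
  · rw [Finset.mul_sum]
    refine Finset.sum_congr rfl fun v _ => ?_
    by_cases ha : nu i.castSucc ≤ v
    · rw [if_pos ha, if_pos ha, if_pos (hle.trans ha), pow_succ]
      ring
    · rw [if_neg ha, if_neg ha]
      ring
  · rw [Finset.mul_sum, ← Finset.sum_add_distrib]
    refine Finset.sum_congr rfl fun v _ => ?_
    by_cases hb : nu i.succ ≤ v
    · rw [if_pos hb, if_pos hb, if_pos (by omega), if_pos (by omega), pow_succ]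
      ring
    · rw [if_neg hb, if_neg hb, add_zero]
      ring

/-- The eigenvalue of `t ^ n` times the Macdonald operator belonging to `lam`. -/
noncomputable def eigVal (q t : K) {n : ℕ} (lam : Fin n → ℕ) : K :=
  ∑ v ∈ Finset.range (largest lam + 1),
    stepWeight q (largest lam) v * t ^ Finset.card {k : Fin n | lam k ≤ v}

/-- For each threshold v the sum over m is geometric, with value (t^c - 1)/(t - 1) for c the number
of entries at most v. This number is the same on the whole orbit, so every f_ν receives the same
coefficient. -/
theorem diffOp_orbitPoly {q t : K} (H : Generic q t) {lam : Fin (N + 1) → ℕ} (hl : Antitone lam) :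
    (t - 1) • diffOp q t (orbitPoly q t lam) = (eigVal q t lam - 1) • orbitPoly q t lam := by
  have hf := isQKZ_qkzFamily H (largest lam) hl (le_largest lam)
  set f := qkzFamily q t (largest lam) lam
  -- The cyclic relation gives f_ν the coefficient q^{ν_n}; this is `tailCoeff` at the last place,
  -- where no later places are counted.
  have hcyc : cycOp q (orbitPoly q t lam) =
      orbitSum lam f 1 (tailCoeff q t (largest lam) (Fin.last N)) := by
    rw [orbitPoly, map_sum, orbitSum, ← sum_orbit_comp lam (finRotate (N + 1)) fun nu =>
      tailCoeff q t (largest lam) (Fin.last N) nu • f (nu ∘ ⇑(1 : Equiv.Perm (Fin (N + 1))))]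
    refine Finset.sum_congr rfl fun nu hnu => ?_
    obtain ⟨s, rfl⟩ := mem_orbit.1 hnu
    have e : ((lam ∘ s) ∘ finRotate (N + 1)) (Fin.last N) = lam (s 0) := by
      simp
    have hc : ∀ v, (Finset.univ.filter fun j : Fin (N + 1) => Fin.last N < j ∧
        ((lam ∘ s) ∘ finRotate (N + 1)) j ≤ v) = ∅ := by
      intro v
      rw [Finset.filter_eq_empty_iff]
      rintro j - ⟨h, -⟩
      exact h.not_ge (Fin.le_last j)
    rw [hf.cyc, tailCoeff]
    simp only [hc, Finset.card_empty, pow_zero, e, mul_ite, mul_one, mul_zero]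
    rw [sum_stepWeight q (le_largest lam (s 0))]
    rfl
  have htail : ∀ m, heckeTail t m (cycOp q (orbitPoly q t lam)) =
      orbitSum lam f 1 (tailCoeff q t (largest lam) m) := by
    intro m
    induction m using Fin.reverseInduction with
    | last => rw [heckeTail_last, hcyc]; rfl
    | cast i ih =>
      rw [heckeTail_castSucc, Module.End.mul_apply, ih,
        hf.toIsHeckeFamily.heckeGen_orbitSum_one]
      exact orbitSum_congr fun nu _ => tailCoeff_step q t _ i nu
  rw [diffOp_apply, Finset.sum_congr rfl fun m _ => htail m, orbitPoly_eq, ← orbitSum_smul]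
  simp only [orbitSum]
  rw [Finset.sum_comm, Finset.smul_sum]
  refine Finset.sum_congr rfl fun nu hnu => ?_
  rw [← Finset.sum_smul, smul_smul]
  congr 1
  rw [mul_one]
  simp only [tailCoeff]
  rw [Finset.sum_comm, Finset.mul_sum]
  have hv : ∀ v, (t - 1) * ∑ m, stepWeight q (largest lam) v *
      (if nu m ≤ v then t ^ Finset.card {j : Fin (N + 1) | m < j ∧ nu j ≤ v} else 0) =
      stepWeight q (largest lam) v * t ^ Finset.card {k : Fin (N + 1) | lam k ≤ v} -
        stepWeight q (largest lam) v := by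
    intro v
    rw [← Finset.mul_sum, ← Finset.sum_filter, ← card_filter_orbit hnu (· ≤ v)]
    have e := sum_pow_card_filter_lt t (Finset.univ.filter fun k => nu k ≤ v)
    simp only [Finset.filter_filter] at e
    have e' : ∀ m, (Finset.univ.filter fun j => m < j ∧ nu j ≤ v) =
        Finset.univ.filter fun j => nu j ≤ v ∧ m < j :=
      fun m => Finset.filter_congr fun j _ => and_comm
    simp only [e']
    linear_combination stepWeight q (largest lam) v * e
  rw [Finset.sum_congr rfl fun v _ => hv v, Finset.sum_sub_distrib, eigVal]
  congr 1
  have := sum_stepWeight q (Nat.zero_le (largest lam))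
  simpa using this

end Difference

/-! ### Generating series and logarithmic derivatives. -/

section Series

variable {R : Type*} [CommRing R]

/-- The series `1 - x w`. -/
noncomputable def linSeries (x : R) : PowerSeries R := 1 - PowerSeries.C x * PowerSeries.X

/-- The geometric series. -/
noncomputable def geomSeries (x : R) : PowerSeries R := PowerSeries.mk fun k => x ^ k

theorem linSeries_mul_geomSeries (x : R) : linSeries x * geomSeries x = 1 := by
  ext k
  rw [linSeries, sub_mul, one_mul, mul_assoc, map_sub, PowerSeries.coeff_C_mul]
  cases k with
  | zero => simp [geomSeries]
  | succ k => simp [geomSeries, PowerSeries.coeff_succ_X_mul, PowerSeries.coeff_one, pow_succ, mul_comm]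

theorem X_mul_derivative_linSeries (x : R) :
    PowerSeries.X * PowerSeries.derivative R (linSeries x) = -(geomSeries x - 1) * linSeries x := by
  have h := linSeries_mul_geomSeries x
  have hd : PowerSeries.derivative R (linSeries x) = -PowerSeries.C x := by
    rw [linSeries, map_sub, PowerSeries.derivative_one, Derivation.leibniz, PowerSeries.derivative_X, PowerSeries.derivative_C]
    simp
  rw [hd]
  have : linSeries x = 1 - PowerSeries.C x * PowerSeries.X := rfl
  linear_combination h - this

theorem X_mul_derivative_prod_linSeries {ι : Type*} (S : Finset ι) (x : ι → R) :
    PowerSeries.X * PowerSeries.derivative R (∏ i ∈ S, linSeries (x i)) =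
      -(∑ i ∈ S, (geomSeries (x i) - 1)) * ∏ i ∈ S, linSeries (x i) := by
  classical
  induction S using Finset.induction_on with
  | empty => simp
  | insert a S ha ih =>
    rw [Finset.prod_insert ha, Finset.sum_insert ha, Derivation.leibniz, smul_eq_mul, smul_eq_mul]
    linear_combination linSeries (x a) * ih +
      (∏ i ∈ S, linSeries (x i)) * X_mul_derivative_linSeries (x a)

/-- As G has no constant term, the equation expresses k times the k-th coefficient through earlier
ones. -/
theorem eq_of_X_mul_derivative_eq [IsDomain R] [CharZero R] {f g G : PowerSeries R}
    (hf : PowerSeries.X * PowerSeries.derivative R f = G * f) (hg : PowerSeries.X * PowerSeries.derivative R g = G * g)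
    (hG : PowerSeries.coeff 0 G = 0) (h0 : PowerSeries.coeff 0 f = PowerSeries.coeff 0 g) : f = g := by
  rw [← sub_eq_zero]
  have hh : PowerSeries.X * PowerSeries.derivative R (f - g) = G * (f - g) := by rw [map_sub, mul_sub, hf, hg, mul_sub]
  ext k
  rw [map_zero]
  induction k using Nat.strong_induction_on with
  | _ k ih =>
  cases k with
  | zero => rw [map_sub, h0, sub_self]
  | succ k =>
    have e := congrArg (PowerSeries.coeff (k + 1)) hh
    rw [PowerSeries.coeff_succ_X_mul, PowerSeries.coeff_derivative, PowerSeries.coeff_mul, Finset.sum_eq_zero] at e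
    · refine (mul_eq_zero.1 e).resolve_right ?_
      exact_mod_cast Nat.succ_ne_zero k
    · intro p hp
      rw [Finset.HasAntidiagonal.mem_antidiagonal] at hp
      rcases Nat.eq_zero_or_pos p.1 with h | h
      · rw [h, hG, zero_mul]
      · rw [ih p.2 (by omega), mul_zero]

end Series

/-! ### The symmetric functions β_k. -/

section Beta

variable {K : Type*} [Field K]

/-- The coefficients of `exp (-∑ (1 - t ^ m) p_m w ^ m / m)`. -/
noncomputable def beta (t : K) : ℕ → SymFun K
  | 0 => 1
  | k + 1 => -((k + 1 : ℕ) : K)⁻¹ •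
      ∑ m : Fin (k + 1), (1 - t ^ (m.1 + 1)) • (X m.1 * beta t (k - m.1))
decreasing_by omega

theorem beta_zero (t : K) : beta t 0 = 1 := by rw [beta]

theorem smul_beta_succ [CharZero K] (t : K) (k : ℕ) : ((k + 1 : ℕ) : K) • beta t (k + 1) =
    -∑ m ∈ Finset.range (k + 1), (1 - t ^ (m + 1)) • (X m * beta t (k - m)) := by
  have h : ((k + 1 : ℕ) : K) ≠ 0 := by exact_mod_cast Nat.succ_ne_zero k
  rw [beta, smul_smul, mul_neg, mul_inv_cancel₀ h, neg_smul, one_smul,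
    Finset.sum_range fun m => (1 - t ^ (m + 1)) • (X m * beta t (k - m))]

variable [CharZero K]

/-- The recursion of β is the coefficient form of w B' = -(Σ_m (1 - t^m) p_m w^m) B; in n variables
the sum over m is a sum of geometric series. -/
theorem X_mul_derivative_mk_beta (t : K) (n : ℕ) :
    (PowerSeries.X : PowerSeries (MvPolynomial (Fin n) K)) *
        PowerSeries.derivative _ (PowerSeries.mk fun k => toVars n (beta t k)) =
      -(∑ i : Fin n, (geomSeries (MvPolynomial.X i) -
        geomSeries (MvPolynomial.C t * MvPolynomial.X i))) *
        PowerSeries.mk fun k => toVars n (beta t k) := by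
  ext1 k
  cases k with
  | zero => simp [geomSeries]
  | succ k =>
    have e := congrArg (toVars n) (smul_beta_succ t k)
    rw [map_smul, map_neg, map_sum] at e
    rw [PowerSeries.coeff_succ_X_mul, PowerSeries.coeff_derivative, PowerSeries.coeff_mk, neg_mul, map_neg, PowerSeries.coeff_mul,
      Finset.Nat.sum_antidiagonal_succ]
    have h0 : PowerSeries.coeff 0 (∑ i : Fin n, (geomSeries (MvPolynomial.X i) -
        geomSeries (MvPolynomial.C t * MvPolynomial.X i : MvPolynomial (Fin n) K))) = 0 := by
      simp [geomSeries]
    rw [h0, zero_mul, zero_add, Finset.Nat.sum_antidiagonal_eq_sum_range_succ_mk]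
    have e' : toVars n (beta t (k + 1)) * ((k : MvPolynomial (Fin n) K) + 1) =
        ((k + 1 : ℕ) : K) • toVars n (beta t (k + 1)) := by
      rw [smul_eq_C_mul, mul_comm]
      simp
    rw [e', e]
    congr 1
    refine Finset.sum_congr rfl fun m _ => ?_
    rw [PowerSeries.coeff_mk, map_smul, map_mul, smul_eq_C_mul, map_sum, ← mul_assoc]
    congr 1
    simp only [toVars, aeval_X, psum, geomSeries, map_sub, PowerSeries.coeff_mk, mul_pow]
    rw [Finset.sum_sub_distrib, ← Finset.mul_sum, map_one, map_pow]
    ring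

/-- Both sides satisfy the same first-order equation and have constant term 1; the β_k are thus the
coefficients of ∏ (1 - x_i w)/(1 - t x_i w). -/
theorem prod_linSeries_mul_mk_beta (t : K) (n : ℕ) :
    (∏ i : Fin n, linSeries (MvPolynomial.C t * MvPolynomial.X i : MvPolynomial (Fin n) K)) *
      PowerSeries.mk (fun k => toVars n (beta t k)) = ∏ i : Fin n, linSeries (MvPolynomial.X i) := by
  refine eq_of_X_mul_derivative_eq
    (G := -(∑ i : Fin n, (geomSeries (MvPolynomial.X i : MvPolynomial (Fin n) K) - 1))) ?_
    (X_mul_derivative_prod_linSeries _ _) (by simp [geomSeries]) ?_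
  · have h1 := X_mul_derivative_mk_beta t n
    have h2 := X_mul_derivative_prod_linSeries Finset.univ
      fun i : Fin n => (MvPolynomial.C t * MvPolynomial.X i : MvPolynomial (Fin n) K)
    rw [Derivation.leibniz, smul_eq_mul, smul_eq_mul]
    rw [Finset.sum_sub_distrib] at h1 h2 ⊢
    linear_combination PowerSeries.mk (fun k => toVars n (beta t k)) * h2 +
      (∏ i : Fin n, linSeries (MvPolynomial.C t * MvPolynomial.X i : MvPolynomial (Fin n) K)) * h1
  · have hb : PowerSeries.constantCoeff (PowerSeries.mk fun k => toVars n (beta t k)) = 1 := by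
      rw [← PowerSeries.coeff_zero_eq_constantCoeff_apply, PowerSeries.coeff_mk, beta_zero, map_one]
    rw [PowerSeries.coeff_zero_eq_constantCoeff_apply,
      PowerSeries.coeff_zero_eq_constantCoeff_apply, map_mul, map_prod, map_prod, hb]
    simp [linSeries]

/-- The series `t - x w`. -/
noncomputable def linSeriesT (t : K) {n : ℕ} (i : Fin n) :
    PowerSeries (MvPolynomial (Fin n) K) :=
  PowerSeries.C (C t) - PowerSeries.C (X i) * PowerSeries.X

/-- The preceding identity with w replaced by w/t, multiplied by t^n. -/
theorem prod_linSeries_mul_mk_smul_beta {t : K} (ht : t ≠ 0) (n : ℕ) :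
    (∏ i : Fin n, linSeries (MvPolynomial.X i : MvPolynomial (Fin n) K)) *
      PowerSeries.mk (fun k => (t ^ n * (t ^ k)⁻¹) • toVars n (beta t k)) =
      ∏ i : Fin n, linSeriesT t i := by
  have hresc : ∀ x : MvPolynomial (Fin n) K, PowerSeries.rescale (MvPolynomial.C t⁻¹) (linSeries x) =
      linSeries (MvPolynomial.C t⁻¹ * x) := by
    intro x
    ext1 k
    rw [PowerSeries.coeff_rescale, linSeries, linSeries]
    rcases k with _ | _ | k <;> simp [PowerSeries.coeff_one]
  have hb : PowerSeries.mk (fun k => (t ^ n * (t ^ k)⁻¹) • toVars n (beta t k)) =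
      PowerSeries.C (MvPolynomial.C (t ^ n)) * PowerSeries.rescale (MvPolynomial.C t⁻¹)
        (PowerSeries.mk fun k => toVars n (beta t k)) := by
    ext1 k
    rw [PowerSeries.coeff_mk, PowerSeries.coeff_C_mul, PowerSeries.coeff_rescale, PowerSeries.coeff_mk, smul_eq_C_mul, map_mul, ← inv_pow, map_pow,
      map_pow, mul_assoc]
  have e := congrArg (PowerSeries.rescale (MvPolynomial.C t⁻¹)) (prod_linSeries_mul_mk_beta t n)
  rw [map_mul, map_prod, map_prod] at e
  simp only [hresc, ← mul_assoc, ← map_mul, inv_mul_cancel₀ ht] at e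
  simp only [MvPolynomial.C_1, one_mul] at e
  rw [hb, mul_left_comm, e]
  have : PowerSeries.C (MvPolynomial.C (t ^ n)) = ∏ _i : Fin n, PowerSeries.C (MvPolynomial.C t : MvPolynomial (Fin n) K) := by
    simp
  rw [this, ← Finset.prod_mul_distrib]
  refine Finset.prod_congr rfl fun i _ => ?_
  rw [linSeries, linSeriesT, mul_sub, mul_one, ← mul_assoc, ← map_mul, ← mul_assoc, ← map_mul,
    mul_inv_cancel₀ ht, MvPolynomial.C_1, one_mul]

end Beta

/-! ### The operators T_m ⋯ T_{n-1} on powers of the last variable. -/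

section Tails

variable {K : Type*} [Field K] {n : ℕ}

/-- The coefficientwise action on power series. -/
noncomputable def seriesMap (T : Module.End K (MvPolynomial (Fin n) K))
    (f : PowerSeries (MvPolynomial (Fin n) K)) : PowerSeries (MvPolynomial (Fin n) K) :=
  PowerSeries.mk fun k => T (PowerSeries.coeff k f)

theorem seriesMap_heckeGen_mul (t : K) {i : Fin (n - 1)}
    {Q : PowerSeries (MvPolynomial (Fin n) K)}
    (hQ : PowerSeries.map (rename (simpleSwap i) : _ →ₐ[K] _).toRingHom Q = Q)
    (f : PowerSeries (MvPolynomial (Fin n) K)) :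
    seriesMap (heckeGen t i) (Q * f) = Q * seriesMap (heckeGen t i) f := by
  ext1 k
  rw [seriesMap, PowerSeries.coeff_mk, PowerSeries.coeff_mul, PowerSeries.coeff_mul, map_sum]
  refine Finset.sum_congr rfl fun p _ => ?_
  rw [heckeGen_mul_of_rename_eq, seriesMap, PowerSeries.coeff_mk]
  have := congrArg (PowerSeries.coeff p.1) hQ
  rwa [PowerSeries.coeff_map] at this

theorem map_rename_linSeries (i : Fin (n - 1)) (k : Fin n) :
    PowerSeries.map (rename (simpleSwap i) : _ →ₐ[K] _).toRingHom
      (linSeries (X k : MvPolynomial (Fin n) K)) = linSeries (X (simpleSwap i k)) := by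
  simp [linSeries]

theorem map_rename_linSeriesT (t : K) (i : Fin (n - 1)) (k : Fin n) :
    PowerSeries.map (rename (simpleSwap i) : _ →ₐ[K] _).toRingHom
      (linSeriesT t k) = linSeriesT t (simpleSwap i k) := by
  simp [linSeriesT]

theorem map_rename_prod_linSeries (i : Fin (n - 1)) :
    PowerSeries.map (rename (simpleSwap i) : _ →ₐ[K] _).toRingHom
      (∏ i, linSeries (X i : MvPolynomial (Fin n) K)) = ∏ i, linSeries (X i) := by
  rw [map_prod, ← Equiv.prod_comp (simpleSwap i)]
  exact Finset.prod_congr rfl fun k _ => by rw [map_rename_linSeries, simpleSwap_simpleSwap]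

theorem map_rename_prod (t : K) {i : Fin (n - 1)} {A B : Finset (Fin n)}
    (hA : ∀ k ∈ A, simpleSwap i k = k) (hB : ∀ k ∈ B, simpleSwap i k = k) :
    PowerSeries.map (rename (simpleSwap i) : _ →ₐ[K] _).toRingHom
      ((∏ k ∈ A, linSeries (X k : MvPolynomial (Fin n) K)) * ∏ k ∈ B, linSeriesT t k) =
      (∏ k ∈ A, linSeries (X k)) * ∏ k ∈ B, linSeriesT t k := by
  rw [map_mul, map_prod, map_prod,
    Finset.prod_congr rfl fun k hk => (map_rename_linSeries i k).trans (by rw [hA k hk]),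
    Finset.prod_congr rfl fun k hk => (map_rename_linSeriesT t i k).trans (by rw [hB k hk])]

theorem heckeGen_X_lft (t : K) (i : Fin (n - 1)) :
    heckeGen t i (X (lft i) : MvPolynomial (Fin n) K) = X (rgt i) := by
  have := heckeGen_X_lft_pow t i 0
  simpa using this

theorem seriesMap_linSeries (t : K) (i : Fin (n - 1)) :
    seriesMap (heckeGen t i) (linSeries (X (lft i) : MvPolynomial (Fin n) K)) =
      linSeriesT t (rgt i) := by
  ext1 k
  rw [seriesMap, PowerSeries.coeff_mk, linSeries, linSeriesT]
  rcases k with _ | _ | k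
  · simp [heckeGen_one, smul_eq_C_mul]
  · simp [PowerSeries.coeff_one, heckeGen_X_lft]
  · simp [PowerSeries.coeff_one]

variable {N : ℕ}

/-- T_i is linear over series invariant under s_i, and the only factor which is not invariant is 1 -
x_i w, which T_i takes to t - x_{i+1} w. -/
theorem prod_linSeries_mul_heckeTail (t : K) (m : Fin (N + 1)) :
    (∏ i, linSeries (X i : MvPolynomial (Fin (N + 1)) K)) *
      PowerSeries.mk (fun k => heckeTail t m (X (Fin.last N) ^ k)) =
      (∏ i with i < m, linSeries (X i)) * ∏ i with m < i, linSeriesT t i := by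
  induction m using Fin.reverseInduction with
  | last =>
    have h1 : (Finset.univ : Finset (Fin (N + 1))) =
        insert (Fin.last N) (Finset.univ.filter fun i => i < Fin.last N) := by
      ext k
      simpa [eq_comm] using (Fin.le_last k).eq_or_lt
    have h2 : (Finset.univ.filter fun i : Fin (N + 1) => Fin.last N < i) = ∅ := by
      rw [Finset.filter_eq_empty_iff]
      exact fun k _ h => h.not_ge (Fin.le_last k)
    have h3 := linSeries_mul_geomSeries (X (Fin.last N) : MvPolynomial (Fin (N + 1)) K)
    rw [h2, Finset.prod_empty, mul_one, heckeTail_last]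
    conv_lhs => rw [h1]
    rw [Finset.prod_insert (by simp)]
    simp only [Module.End.one_apply]
    rw [geomSeries] at h3
    linear_combination (∏ i with i < Fin.last N, linSeries (X i)) * h3
  | cast i ih =>
    have h1 : (Finset.univ.filter fun k : Fin (N + 1) => k < i.succ) =
        insert i.castSucc (Finset.univ.filter fun k => k < i.castSucc) := by
      ext k
      simp only [Finset.mem_insert, Finset.mem_filter, Finset.mem_univ, true_and]
      rw [← Fin.le_castSucc_iff, le_iff_eq_or_lt]
    have h2 : (Finset.univ.filter fun k : Fin (N + 1) => i.castSucc < k) =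
        insert i.succ (Finset.univ.filter fun k => i.succ < k) := by
      ext k
      simp only [Finset.mem_insert, Finset.mem_filter, Finset.mem_univ, true_and]
      rw [Fin.castSucc_lt_iff_succ_le, le_iff_eq_or_lt, eq_comm]
    have hmk : PowerSeries.mk (fun k => heckeTail t i.castSucc
        (X (Fin.last N) ^ k : MvPolynomial (Fin (N + 1)) K)) =
        seriesMap (heckeGen (n := N + 1) t i)
          (PowerSeries.mk fun k => heckeTail t i.succ (X (Fin.last N) ^ k)) := by
      ext1 k
      rw [seriesMap, PowerSeries.coeff_mk, PowerSeries.coeff_mk, PowerSeries.coeff_mk,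
        heckeTail_castSucc, Module.End.mul_apply]
    have hall := map_rename_prod_linSeries (K := K) (n := N + 1) i
    have hQ : PowerSeries.map (rename (simpleSwap (n := N + 1) i) : _ →ₐ[K] _).toRingHom
        ((∏ k with k < i.castSucc, linSeries (X k : MvPolynomial (Fin (N + 1)) K)) *
          ∏ k with i.succ < k, linSeriesT t k) =
        (∏ k with k < i.castSucc, linSeries (X k)) * ∏ k with i.succ < k, linSeriesT t k := by
      apply map_rename_prod
      · intro k hk
        rw [Finset.mem_filter] at hk
        rw [simpleSwap_of_ne]
        · rw [lft_eq_castSucc]; exact hk.2.ne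
        · rw [rgt_eq_succ]; exact (hk.2.trans Fin.castSucc_lt_succ).ne
      · intro k hk
        rw [Finset.mem_filter] at hk
        rw [simpleSwap_of_ne]
        · rw [lft_eq_castSucc]; exact (Fin.castSucc_lt_succ.trans hk.2).ne'
        · rw [rgt_eq_succ]; exact hk.2.ne'
    have hT := seriesMap_linSeries (n := N + 1) t i
    rw [lft_eq_castSucc, rgt_eq_succ] at hT
    rw [hmk, ← seriesMap_heckeGen_mul t hall, ih, h1, h2, Finset.prod_insert (by simp),
      Finset.prod_insert (by simp), mul_comm (linSeries _), mul_assoc, mul_comm (linSeries _),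
      ← mul_assoc, seriesMap_heckeGen_mul t hQ, hT]
    ring

theorem sum_heckeTail_pow [CharZero K] {t : K} (ht : t ≠ 0) (k : ℕ) :
    (t - 1) • ∑ m, heckeTail t m (X (Fin.last N) ^ k : MvPolynomial (Fin (N + 1)) K) =
      (t ^ (N + 1) * (t ^ k)⁻¹) • toVars (N + 1) (beta t k) - if k = 0 then 1 else 0 := by
  have h1 := prod_linSeries_mul_mk_smul_beta ht (N + 1)
  -- The sum over m telescopes: each factor 1 - x_i w is (t - x_i w) + (1 - t), and expanding the
  -- product in order yields the products just computed.
  have h2 := Finset.prod_add_ordered Finset.univ (fun i : Fin (N + 1) => linSeriesT t i)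
    fun _ => PowerSeries.C (C (1 - t))
  have h3 : ∀ i : Fin (N + 1), linSeriesT t i + PowerSeries.C (C (1 - t)) = linSeries (X i) := by
    intro i
    rw [linSeriesT, linSeries, map_sub, map_sub, C_1, map_one]
    ring
  simp only [h3] at h2
  have h0 : (∏ i, linSeries (X i : MvPolynomial (Fin (N + 1)) K)) ≠ 0 := by
    rw [Finset.prod_ne_zero_iff]
    intro i _ h
    have := congrArg PowerSeries.constantCoeff h
    simp [linSeries] at this
  have key : PowerSeries.C (C (t - 1)) * ∑ m, PowerSeries.mk
        (fun k => heckeTail t m (X (Fin.last N) ^ k : MvPolynomial (Fin (N + 1)) K)) =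
      PowerSeries.mk (fun k => (t ^ (N + 1) * (t ^ k)⁻¹) • toVars (N + 1) (beta t k)) - 1 := by
    apply mul_left_cancel₀ h0
    rw [mul_sub, h1, mul_one, mul_left_comm, Finset.mul_sum,
      Finset.sum_congr rfl fun m _ => prod_linSeries_mul_heckeTail t m]
    simp only [mul_assoc, ← Finset.mul_sum] at h2
    have h4 : PowerSeries.C (C (t - 1)) =
        -PowerSeries.C (C (1 - t) : MvPolynomial (Fin (N + 1)) K) := by
      rw [← map_neg, ← map_neg, neg_sub]
    rw [h4]
    linear_combination h2
  have e := congrArg (PowerSeries.coeff k) key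
  rw [PowerSeries.coeff_C_mul, map_sum, map_sub (PowerSeries.coeff k), PowerSeries.coeff_mk,
    PowerSeries.coeff_one] at e
  simp only [PowerSeries.coeff_mk] at e
  rw [smul_eq_C_mul, e]

end Tails

/-! ### An operator on symmetric functions independent of the number of variables. -/

section Operator

variable {K : Type*} [Field K]

/-- The substitution `p_k ↦ p_k + (q ^ k - 1) w ^ k`. -/
noncomputable def shiftHom (q : K) : SymFun K →ₐ[K] Polynomial (SymFun K) :=
  aeval fun k => Polynomial.C (X k) + Polynomial.C (C (q ^ (k + 1) - 1)) * Polynomial.X ^ (k + 1)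

theorem shiftHom_X (q : K) (k : ℕ) : shiftHom q (X k) = Polynomial.C (X k) +
    Polynomial.C (C (q ^ (k + 1) - 1)) * Polynomial.X ^ (k + 1) := aeval_X _ _

theorem shiftHom_C (q a : K) : shiftHom q (C a) = Polynomial.C (C a) := algHom_C _ _

/-- The linear map `∑ w ^ k G_k ↦ ∑ t ^ (-k) β_k G_k`. -/
noncomputable def betaPairing (t : K) : Polynomial (SymFun K) →ₗ[K] SymFun K :=
  Polynomial.lsum fun k => (t ^ k)⁻¹ • LinearMap.mulLeft K (beta t k)

theorem betaPairing_monomial (t : K) (k : ℕ) (G : SymFun K) :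
    betaPairing t (Polynomial.monomial k G) = (t ^ k)⁻¹ • (beta t k * G) := by
  rw [betaPairing, Polynomial.lsum_apply, Polynomial.sum_monomial_index]
  · rfl
  · exact map_zero _

theorem betaPairing_eq_sum (t : K) {P : Polynomial (SymFun K)} {M : ℕ} (h : P.natDegree < M) :
    betaPairing t P = ∑ k ∈ Finset.range M, (t ^ k)⁻¹ • (beta t k * P.coeff k) := by
  rw [betaPairing, Polynomial.lsum_apply, Polynomial.sum_over_range' _ _ M h]
  · rfl
  · exact fun n => map_zero _

/-- The Macdonald operator on symmetric functions. -/
noncomputable def macOp (q t : K) : SymFun K →ₗ[K] SymFun K :=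
  betaPairing t ∘ₗ (shiftHom q).toLinearMap

theorem macOp_apply (q t : K) (F : SymFun K) : macOp q t F = betaPairing t (shiftHom q F) := rfl

theorem coeff_zero_shiftHom (q : K) (F : SymFun K) : (shiftHom q F).coeff 0 = F := by
  induction F using MvPolynomial.induction_on with
  | C a => rw [shiftHom_C, Polynomial.coeff_C_zero]
  | add F G hF hG => rw [map_add, Polynomial.coeff_add, hF, hG]
  | mul_X F k hF => rw [map_mul, Polynomial.mul_coeff_zero, hF, shiftHom_X]; simp

end Operator

/-! ### Comparison of the two operators. -/

section Specialization

variable {K : Type*} [Field K] {N : ℕ}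

theorem toVars_X (n k : ℕ) : toVars n (X k : SymFun K) = psum (Fin n) K (k + 1) := aeval_X _ _

theorem isSymmetric_toVars (n : ℕ) (F : SymFun K) : (toVars n F).IsSymmetric := by
  intro s
  have h : (rename s : MvPolynomial (Fin n) K →ₐ[K] _).comp (toVars n) = toVars n := by
    apply MvPolynomial.algHom_ext
    intro k
    rw [AlgHom.comp_apply, toVars_X]
    exact psum_isSymmetric (Fin n) K (k + 1) s
  exact DFunLike.congr_fun h F

/-- On symmetric polynomials ω only multiplies one variable by q, which changes p_k by (q^k - 1)
x_n^k. -/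
theorem cycOp_toVars (q : K) (F : SymFun K) : cycOp q (toVars (N + 1) F) =
    Polynomial.eval₂ (toVars (N + 1)).toRingHom (X (Fin.last N)) (shiftHom q F) := by
  induction F using MvPolynomial.induction_on with
  | C a =>
    rw [shiftHom_C, Polynomial.eval₂_C]
    change _ = toVars (N + 1) (C a)
    rw [toVars, algHom_C, algebraMap_eq, cycOp_C]
  | add F G hF hG => rw [map_add, map_add, map_add, Polynomial.eval₂_add, hF, hG]
  | mul_X F k hF =>
    rw [map_mul, map_mul, map_mul, Polynomial.eval₂_mul, hF]
    congr 1
    rw [toVars_X, psum, map_sum, Fin.sum_univ_succ, map_pow, cycOp_X_zero]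
    simp only [map_pow, cycOp_X_succ]
    rw [shiftHom_X, Polynomial.eval₂_add, Polynomial.eval₂_mul,
      Polynomial.eval₂_C, Polynomial.eval₂_C, Polynomial.eval₂_X_pow]
    change _ = toVars (N + 1) (X k) + toVars (N + 1) (C _) * _
    rw [toVars_X, toVars, algHom_C, algebraMap_eq, psum, Fin.sum_univ_castSucc, map_sub, C_1,
      mul_pow, map_pow]
    ring

theorem heckeTail_mul_of_isSymmetric (t : K) {g : MvPolynomial (Fin (N + 1)) K}
    (hg : g.IsSymmetric) (m : Fin (N + 1)) (f : MvPolynomial (Fin (N + 1)) K) :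
    heckeTail t m (g * f) = g * heckeTail t m f := by
  induction m using Fin.reverseInduction with
  | last => rw [heckeTail_last]; rfl
  | cast i ih =>
    rw [heckeTail_castSucc, Module.End.mul_apply, Module.End.mul_apply, ih,
      heckeGen_mul_of_rename_eq t (hg _)]

/-- ω F is a polynomial in x_n with symmetric coefficients. These pass through the T_i, and the
powers of x_n are evaluated by `sum_heckeTail_pow`, whose correction at exponent 0 produces the
subtracted F. -/
theorem diffOp_toVars [CharZero K] (q : K) {t : K} (ht : t ≠ 0) (F : SymFun K) :
    (t - 1) • diffOp q t (toVars (N + 1) F) =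
      t ^ (N + 1) • toVars (N + 1) (macOp q t F) - toVars (N + 1) F := by
  have key : ∀ P : Polynomial (SymFun K), (t - 1) • ∑ m, heckeTail t m
      (Polynomial.eval₂ (toVars (N + 1)).toRingHom (X (Fin.last N)) P) =
      t ^ (N + 1) • toVars (N + 1) (betaPairing t P) - toVars (N + 1) (P.coeff 0) := by
    intro P
    induction P using Polynomial.induction_on' with
    | add P Q hP hQ =>
      simp only [Polynomial.eval₂_add, map_add, Finset.sum_add_distrib, smul_add, hP, hQ,
        Polynomial.coeff_add]
      ring
    | monomial k G =>
      rw [Polynomial.eval₂_monomial]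
      change (t - 1) • ∑ m, heckeTail t m (toVars (N + 1) G * _) = _
      rw [Finset.sum_congr rfl fun m _ =>
        heckeTail_mul_of_isSymmetric t (isSymmetric_toVars (N + 1) G) m _, ← Finset.mul_sum,
        ← mul_smul_comm, sum_heckeTail_pow ht, betaPairing_monomial, map_smul, map_mul, smul_smul,
        mul_sub, mul_smul_comm, mul_comm (toVars _ G), Polynomial.coeff_monomial]
      congr 1
      split_ifs <;> simp
  rw [diffOp_apply, cycOp_toVars, key, coeff_zero_shiftHom, macOp_apply]

end Specialization

/-! ### The Macdonald inner product and self-adjointness. -/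

section Form

variable {K : Type*} [Field K] (q t : K)

theorem macInner_eq_sum {F : SymFun K} {S : Finset (ℕ →₀ ℕ)} (h : F.support ⊆ S) (G : SymFun K) :
    macInner q t F G = ∑ e ∈ S, F.coeff e * G.coeff e * zqt q t e := by
  rw [macInner]
  refine Finset.sum_subset h fun e _ he => ?_
  rw [notMem_support_iff.1 he, zero_mul, zero_mul]

theorem macInner_comm (F G : SymFun K) : macInner q t F G = macInner q t G F := by
  classical
  rw [macInner_eq_sum q t (Finset.subset_union_left (s₂ := G.support)),
    macInner_eq_sum q t (Finset.subset_union_right (s₁ := F.support))]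
  exact Finset.sum_congr rfl fun e _ => by ring

theorem macInner_add_left (F F' G : SymFun K) :
    macInner q t (F + F') G = macInner q t F G + macInner q t F' G := by
  classical
  rw [macInner_eq_sum q t (support_add (p := F) (q := F')),
    macInner_eq_sum q t (Finset.subset_union_left (s₂ := F'.support)),
    macInner_eq_sum q t (Finset.subset_union_right (s₁ := F.support)), ← Finset.sum_add_distrib]
  exact Finset.sum_congr rfl fun e _ => by rw [coeff_add]; ring

theorem macInner_smul_left (c : K) (F G : SymFun K) :
    macInner q t (c • F) G = c * macInner q t F G := by
  rw [macInner_eq_sum q t (support_smul (a := c) (f := F)), macInner, Finset.mul_sum]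
  exact Finset.sum_congr rfl fun e _ => by rw [coeff_smul, smul_eq_mul]; ring

/-- The Macdonald inner product as a bilinear map. -/
noncomputable def macForm : SymFun K →ₗ[K] SymFun K →ₗ[K] K :=
  LinearMap.mk₂ K (macInner q t) (macInner_add_left q t)
    (fun c F G => by rw [macInner_smul_left, smul_eq_mul])
    (fun F G G' => by
      rw [macInner_comm, macInner_add_left, macInner_comm q t F, macInner_comm q t F])
    fun c F G => by rw [macInner_comm, macInner_smul_left, macInner_comm q t F, smul_eq_mul]

theorem macForm_apply (F G : SymFun K) : macForm q t F G = macInner q t F G := rfl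

theorem macForm_comm (F G : SymFun K) : macForm q t F G = macForm q t G F := macInner_comm q t F G

theorem macForm_monomial (e : ℕ →₀ ℕ) (a : K) (G : SymFun K) :
    macForm q t (monomial e a) G = a * G.coeff e * zqt q t e := by
  classical
  rw [macForm_apply, macInner_eq_sum q t (support_monomial_subset (s := e) (a := a)),
    Finset.sum_singleton, coeff_monomial, if_pos rfl]

theorem zqt_add_single (e : ℕ →₀ ℕ) (m : ℕ) : zqt q t (e + Finsupp.single m 1) =
    zqt q t e * (((m + 1 : ℕ) : K) * ((1 - q ^ (m + 1)) / (1 - t ^ (m + 1))) * (e m + 1)) := by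
  classical
  have h0 : ∀ k ∈ insert m e.support, ((k + 1 : ℕ) : K) ^ 0 * ((0 : ℕ).factorial : K) *
      ((1 - q ^ (k + 1)) / (1 - t ^ (k + 1))) ^ 0 = 1 := by simp
  have hs : (e + Finsupp.single m 1).support ⊆ insert m e.support := by
    intro k hk
    rw [Finset.mem_insert, Finsupp.mem_support_iff]
    by_contra hc
    push Not at hc
    rw [Finsupp.mem_support_iff, Finsupp.add_apply, hc.2, Finsupp.single_eq_of_ne hc.1] at hk
    exact hk rfl
  rw [zqt, zqt, Finsupp.prod_of_support_subset _ hs _ h0,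
    Finsupp.prod_of_support_subset _ (Finset.subset_insert m e.support) _ h0,
    ← Finset.mul_prod_erase _ _ (Finset.mem_insert_self m e.support),
    ← Finset.mul_prod_erase _ _ (Finset.mem_insert_self m e.support),
    Finset.prod_congr rfl fun k hk => by
      rw [Finsupp.add_apply, Finsupp.single_eq_of_ne (Finset.ne_of_mem_erase hk), add_zero],
    Finsupp.add_apply, Finsupp.single_eq_same, Nat.factorial_succ, pow_succ, pow_succ]
  push_cast
  ring

/-- Multiplication by a power sum is adjoint to a multiple of the derivative by it; the factorials
in the norms supply the exponent that differentiation brings down. -/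
theorem macForm_X_mul (m : ℕ) (F G : SymFun K) : macForm q t (X m * F) G =
    ((m + 1 : ℕ) : K) * ((1 - q ^ (m + 1)) / (1 - t ^ (m + 1))) *
      macForm q t F (pderiv m G) := by
  induction F using MvPolynomial.induction_on' with
  | add F F' hF hF' => rw [mul_add, map_add, LinearMap.add_apply, hF, hF', map_add,
      LinearMap.add_apply, mul_add]
  | monomial e a =>
    rw [X, monomial_mul, one_mul, add_comm, macForm_monomial, macForm_monomial, coeff_pderiv,
      zqt_add_single]
    ring

variable {q t}

theorem zqt_ne_zero [CharZero K] (hq : ∀ k, 0 < k → 1 - q ^ k ≠ 0)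
    (ht : ∀ k, 0 < k → 1 - t ^ k ≠ 0) (e : ℕ →₀ ℕ) : zqt q t e ≠ 0 := by
  rw [zqt, Finsupp.prod, Finset.prod_ne_zero_iff]
  intro k _
  refine mul_ne_zero (mul_ne_zero (pow_ne_zero _ ?_) ?_) (pow_ne_zero _ (div_ne_zero ?_ ?_))
  · exact_mod_cast Nat.succ_ne_zero k
  · exact_mod_cast Nat.factorial_ne_zero _
  · exact hq _ (Nat.succ_pos k)
  · exact ht _ (Nat.succ_pos k)

theorem eq_zero_of_macForm [CharZero K] (hq : ∀ k, 0 < k → 1 - q ^ k ≠ 0)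
    (ht : ∀ k, 0 < k → 1 - t ^ k ≠ 0) {F : SymFun K} (h : ∀ G, macForm q t G F = 0) : F = 0 := by
  ext e
  have := h (monomial e 1)
  rw [macForm_monomial, one_mul] at this
  exact (mul_eq_zero.1 this).resolve_right (zqt_ne_zero hq ht e)

theorem coeff_zero_beta [CharZero K] (t : K) (k : ℕ) : coeff 0 (beta t (k + 1)) = 0 := by
  have h : ((k + 1 : ℕ) : K) ≠ 0 := by exact_mod_cast Nat.succ_ne_zero k
  have e := congrArg (coeff 0) (smul_beta_succ t k)
  rw [coeff_smul, coeff_neg, coeff_sum, Finset.sum_eq_zero] at e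
  · rw [neg_zero, smul_eq_mul] at e
    exact (mul_eq_zero.1 e).resolve_left h
  · intro m _
    rw [coeff_smul, ← constantCoeff_eq, map_mul, constantCoeff_X, zero_mul, smul_zero]

/-- Differentiating the exponential by p_{m+1} multiplies it by -(1 - t^{m+1}) w^{m+1}/(m+1). On
coefficients this is an induction through the recursion of β. -/
theorem pderiv_beta [CharZero K] (t : K) (m k : ℕ) : ((m + 1 : ℕ) : K) • pderiv m (beta t k) =
    if m + 1 ≤ k then -(1 - t ^ (m + 1)) • beta t (k - (m + 1)) else 0 := by
  induction k using Nat.strong_induction_on with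
  | _ k ih =>
  cases k with
  | zero => rw [beta_zero, if_neg (by omega)]; simp
  | succ k =>
    have h : ((k + 1 : ℕ) : K) ≠ 0 := by exact_mod_cast Nat.succ_ne_zero k
    have hm : ((m + 1 : ℕ) : K) ≠ 0 := by exact_mod_cast Nat.succ_ne_zero m
    apply smul_right_injective _ h
    have e := congrArg (pderiv m) (smul_beta_succ t k)
    rw [Derivation.map_smul, map_neg, map_sum] at e
    simp only
    rw [smul_comm, e, smul_neg, Finset.smul_sum]
    have hterm : ∀ j ∈ Finset.range (k + 1), ((m + 1 : ℕ) : K) •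
        pderiv m ((1 - t ^ (j + 1)) • (X j * beta t (k - j))) =
        (if j = m then ((m + 1 : ℕ) : K) • (1 - t ^ (m + 1)) • beta t (k - m) else 0) +
        (1 - t ^ (j + 1)) • (X j * if m + 1 ≤ k - j then
          -(1 - t ^ (m + 1)) • beta t (k - j - (m + 1)) else 0) := by
      intro j hj
      rw [Derivation.map_smul, Derivation.leibniz, smul_eq_mul, smul_eq_mul, ← ih (k - j) (by omega)]
      by_cases hjm : j = m
      · subst hjm
        rw [if_pos rfl, pderiv_X_self, mul_one, mul_smul_comm, smul_add, smul_add, add_comm,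
          smul_comm ((j + 1 : ℕ) : K) (1 - t ^ (j + 1)) (X j * _)]
      · rw [if_neg hjm, pderiv_X_of_ne hjm, mul_zero, add_zero, zero_add, mul_smul_comm,
          smul_comm]
    rw [Finset.sum_congr rfl hterm, Finset.sum_add_distrib, Finset.sum_ite_eq']
    by_cases hk : m ≤ k
    swap
    · rw [if_neg (by rw [Finset.mem_range]; omega), if_neg (by omega), Finset.sum_eq_zero]
      · simp
      · intro j _
        rw [if_neg (by omega), mul_zero, smul_zero]
    rw [if_pos (by rw [Finset.mem_range]; omega), if_pos (by omega),
      show k + 1 - (m + 1) = k - m by omega]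
    have hrest : ∑ j ∈ Finset.range (k + 1), (1 - t ^ (j + 1)) • (X j * if m + 1 ≤ k - j then
          -(1 - t ^ (m + 1)) • beta t (k - j - (m + 1)) else 0) =
        (1 - t ^ (m + 1)) • ((k - m : ℕ) : K) • beta t (k - m) := by
      obtain ⟨d, rfl⟩ := Nat.exists_eq_add_of_le hk
      rw [Nat.add_sub_cancel_left]
      have hr : ∀ M, M = d → ∑ j ∈ Finset.range (m + d + 1),
          (1 - t ^ (j + 1)) • (X j * if m + 1 ≤ m + d - j then
            -(1 - t ^ (m + 1)) • beta t (m + d - j - (m + 1)) else 0) =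
          ∑ j ∈ Finset.range M, (1 - t ^ (j + 1)) • (X j *
            (-(1 - t ^ (m + 1)) • beta t (d - 1 - j))) := by
        rintro M rfl
        rw [← Finset.sum_subset (Finset.range_subset_range.2 (show M ≤ m + M + 1 by omega))]
        · refine Finset.sum_congr rfl fun j hj => ?_
          rw [Finset.mem_range] at hj
          rw [if_pos (by omega), show m + M - j - (m + 1) = M - 1 - j by omega]
        · intro j _ hj
          rw [Finset.mem_range] at hj
          rw [if_neg (by omega), mul_zero, smul_zero]
      rw [hr d rfl]
      cases d with
      | zero => simp
      | succ d =>
        rw [smul_beta_succ, ← Finset.sum_neg_distrib, Finset.smul_sum]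
        refine Finset.sum_congr rfl fun j _ => ?_
        rw [Nat.add_sub_cancel, mul_smul_comm, neg_smul, smul_neg, smul_neg, smul_comm]
    rw [hrest, smul_comm, ← smul_add, ← add_smul, ← Nat.cast_add,
      show m + 1 + (k - m) = k + 1 by omega, neg_smul, smul_neg, smul_comm]

/-- Extracting the coefficient of w^k after the shift is adjoint to multiplication by β_k. When F is
multiplied by p_m both sides acquire the same extra term: the norm m(1 - q^m)/(1 - t^m) times the
derivative of β_k is (q^m - 1) β_{k-m}. -/
theorem macForm_coeff_shiftHom [CharZero K] (H : Generic q t) (F : SymFun K) :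
    ∀ (k : ℕ) (G : SymFun K),
      macForm q t ((shiftHom q F).coeff k) G = macForm q t F (beta t k * G) := by
  induction F using MvPolynomial.induction_on with
  | C a =>
    intro k G
    rw [shiftHom_C, Polynomial.coeff_C]
    cases k with
    | zero => rw [if_pos rfl, beta_zero, one_mul]
    | succ k =>
      rw [if_neg (Nat.succ_ne_zero k), map_zero, LinearMap.zero_apply, C_apply, macForm_monomial,
        ← constantCoeff_eq, map_mul, constantCoeff_eq, coeff_zero_beta]
      ring
  | add F F' hF hF' =>
    intro k G
    rw [map_add, Polynomial.coeff_add, map_add, LinearMap.add_apply, hF, hF', map_add,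
      LinearMap.add_apply]
  | mul_X F m hF =>
    intro k G
    have hm : ((m + 1 : ℕ) : K) ≠ 0 := by exact_mod_cast Nat.succ_ne_zero m
    have ht := H.one_sub_t (m + 1) (Nat.succ_pos m)
    have e1 : (shiftHom q (F * X m)).coeff k = X m * (shiftHom q F).coeff k +
        (q ^ (m + 1) - 1) • if m + 1 ≤ k then (shiftHom q F).coeff (k - (m + 1)) else 0 := by
      rw [map_mul, shiftHom_X, mul_add, Polynomial.coeff_add, Polynomial.coeff_mul_C, mul_comm,
        mul_left_comm, Polynomial.coeff_C_mul, Polynomial.coeff_mul_X_pow', smul_eq_C_mul]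
    rw [e1, map_add, LinearMap.add_apply, macForm_X_mul, mul_comm F, macForm_X_mul, hF,
      Derivation.leibniz, map_add, smul_eq_mul, smul_eq_mul, mul_add]
    congr 1
    have e2 : pderiv m (beta t k) = ((m + 1 : ℕ) : K)⁻¹ • if m + 1 ≤ k then
        -(1 - t ^ (m + 1)) • beta t (k - (m + 1)) else 0 := by
      rw [← pderiv_beta, smul_smul, inv_mul_cancel₀ hm, one_smul]
    rw [e2]
    split_ifs
    · rw [map_smul, LinearMap.smul_apply, hF, mul_smul_comm, mul_smul_comm, map_smul, map_smul,
        mul_comm G]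
      simp only [smul_eq_mul]
      field_simp
      ring
    · simp

/-- `macOp` is a combination of the operators β_k β_k^*, each of which is self-adjoint. -/
theorem macForm_macOp [CharZero K] (H : Generic q t) (F G : SymFun K) :
    macForm q t (macOp q t F) G = macForm q t F (macOp q t G) := by
  obtain ⟨M, hF, hG⟩ : ∃ M, (shiftHom q F).natDegree < M ∧ (shiftHom q G).natDegree < M :=
    ⟨max (shiftHom q F).natDegree (shiftHom q G).natDegree + 1, by omega, by omega⟩
  rw [macOp_apply, macOp_apply, betaPairing_eq_sum t hF, betaPairing_eq_sum t hG, map_sum, map_sum,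
    LinearMap.sum_apply]
  refine Finset.sum_congr rfl fun k _ => ?_
  rw [map_smul, map_smul, LinearMap.smul_apply, macForm_comm, ← macForm_coeff_shiftHom H,
    ← macForm_coeff_shiftHom H, macForm_comm]

end Form

/-! ### Degrees. -/

section Grading

variable {K : Type*} [Field K]

/-- The degrees of the power sums. -/
def wt (k : ℕ) : ℕ := k + 1

theorem isWeightedHomogeneous_smul {f : SymFun K} {d : ℕ} (c : K)
    (h : IsWeightedHomogeneous wt f d) : IsWeightedHomogeneous wt (c • f) d := by
  rw [smul_eq_C_mul]
  exact h.C_mul c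

theorem isWeightedHomogeneous_beta (t : K) (k : ℕ) : IsWeightedHomogeneous wt (beta t k) k := by
  induction k using Nat.strong_induction_on with
  | _ k ih =>
  cases k with
  | zero => rw [beta_zero]; exact isWeightedHomogeneous_one K wt
  | succ k =>
    rw [beta]
    refine isWeightedHomogeneous_smul _ (IsWeightedHomogeneous.sum _ _ _ fun m _ =>
      isWeightedHomogeneous_smul _ ?_)
    have := (isWeightedHomogeneous_X K wt m.1).mul (ih (k - m.1) (by omega))
    have e : wt m.1 + (k - m.1) = k + 1 := by rw [wt]; omega
    rwa [e] at this

/-- Homogeneity of degree `d`, where `w` has degree `1`. -/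
def BiHomogeneous (P : Polynomial (SymFun K)) (d : ℕ) : Prop :=
  ∀ k e, coeff e (P.coeff k) ≠ 0 → Finsupp.weight wt e + k = d

theorem BiHomogeneous.add {P Q : Polynomial (SymFun K)} {d : ℕ} (hP : BiHomogeneous P d)
    (hQ : BiHomogeneous Q d) : BiHomogeneous (P + Q) d := by
  intro k e h
  rw [Polynomial.coeff_add, coeff_add] at h
  by_cases h1 : coeff e (P.coeff k) = 0
  · rw [h1, zero_add] at h
    exact hQ k e h
  · exact hP k e h1

theorem BiHomogeneous.mul {P Q : Polynomial (SymFun K)} {d d' : ℕ} (hP : BiHomogeneous P d)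
    (hQ : BiHomogeneous Q d') : BiHomogeneous (P * Q) (d + d') := by
  intro k e h
  rw [Polynomial.coeff_mul, coeff_sum] at h
  obtain ⟨x, hx, h⟩ := Finset.exists_ne_zero_of_sum_ne_zero h
  rw [coeff_mul] at h
  obtain ⟨y, hy, h⟩ := Finset.exists_ne_zero_of_sum_ne_zero h
  have h1 := hP _ _ (left_ne_zero_of_mul h)
  have h2 := hQ _ _ (right_ne_zero_of_mul h)
  rw [Finset.HasAntidiagonal.mem_antidiagonal] at hx hy
  rw [← hy, map_add]
  omega

theorem biHomogeneous_C {F : SymFun K} {d : ℕ} (h : IsWeightedHomogeneous wt F d) :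
    BiHomogeneous (Polynomial.C F) d := by
  intro k e he
  rw [Polynomial.coeff_C] at he
  split_ifs at he with hk
  · rw [hk, add_zero]
    exact h he
  · exact absurd (coeff_zero e) he

theorem biHomogeneous_X_pow (k : ℕ) :
    BiHomogeneous (Polynomial.X ^ k : Polynomial (SymFun K)) k := by
  classical
  intro j e he
  rw [Polynomial.coeff_X_pow] at he
  split_ifs at he with hj
  · rw [coeff_one] at he
    split_ifs at he with h0
    · rw [← h0, map_zero, zero_add, hj]
    · exact absurd rfl he
  · exact absurd (coeff_zero e) he

theorem biHomogeneous_shiftHom_X (q : K) (k : ℕ) :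
    BiHomogeneous (shiftHom q (X k)) (wt k) := by
  rw [shiftHom_X]
  refine (biHomogeneous_C (isWeightedHomogeneous_X K wt k)).add ?_
  have := (biHomogeneous_C (isWeightedHomogeneous_C wt (q ^ (k + 1) - 1))).mul
    (biHomogeneous_X_pow (K := K) (k + 1))
  rwa [zero_add] at this

theorem biHomogeneous_shiftHom_monomial (q : K) (e : ℕ →₀ ℕ) (a : K) :
    BiHomogeneous (shiftHom q (monomial e a)) (Finsupp.weight wt e) := by
  induction e using Finsupp.induction_linear generalizing a with
  | zero =>
    rw [← C_apply, shiftHom_C, map_zero]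
    exact biHomogeneous_C (isWeightedHomogeneous_C wt a)
  | add e e' he he' =>
    rw [← mul_one a, ← monomial_mul, map_mul, map_add]
    exact (he a).mul (he' 1)
  | single k n =>
    rw [← C_mul_X_pow_eq_monomial, map_mul, map_pow, shiftHom_C, Finsupp.weight_single]
    have hpow : BiHomogeneous (shiftHom q (X k) ^ n) (n • wt k) := by
      induction n with
      | zero =>
        rw [pow_zero, zero_smul, ← Polynomial.C_1]
        exact biHomogeneous_C (isWeightedHomogeneous_one K wt)
      | succ n ih =>
        rw [pow_succ, succ_nsmul]
        exact ih.mul (biHomogeneous_shiftHom_X q k)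
    have := (biHomogeneous_C (isWeightedHomogeneous_C wt a)).mul hpow
    rwa [zero_add] at this

theorem biHomogeneous_shiftHom (q : K) {F : SymFun K} {d : ℕ} (h : IsWeightedHomogeneous wt F d) :
    BiHomogeneous (shiftHom q F) d := by
  induction h using IsWeightedHomogeneous.induction_on with
  | zero => intro k e he; simp at he
  | add F G _ _ hF hG => rw [map_add]; exact hF.add hG
  | monomial e a he => rw [← he]; exact biHomogeneous_shiftHom_monomial q e a

theorem isWeightedHomogeneous_macOp (q t : K) {F : SymFun K} {d : ℕ}
    (h : IsWeightedHomogeneous wt F d) : IsWeightedHomogeneous wt (macOp q t F) d := by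
  intro e he
  rw [macOp_apply, betaPairing_eq_sum t (Nat.lt_succ_self _), coeff_sum] at he
  obtain ⟨k, -, he⟩ := Finset.exists_ne_zero_of_sum_ne_zero he
  rw [coeff_smul, smul_eq_mul] at he
  have he := right_ne_zero_of_mul he
  rw [coeff_mul] at he
  obtain ⟨y, hy, he⟩ := Finset.exists_ne_zero_of_sum_ne_zero he
  have h1 := isWeightedHomogeneous_beta t k (left_ne_zero_of_mul he)
  have h2 := biHomogeneous_shiftHom q h _ _ (right_ne_zero_of_mul he)
  rw [Finset.HasAntidiagonal.mem_antidiagonal] at hy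
  rw [← hy, map_add]
  omega

theorem isHomogeneous_psum (n k : ℕ) : (psum (Fin n) K k).IsHomogeneous k := by
  rw [psum]
  refine IsHomogeneous.sum _ _ _ fun i _ => ?_
  have := (isHomogeneous_X K i).pow k
  rwa [one_mul] at this

theorem isHomogeneous_toVars_monomial (n : ℕ) (e : ℕ →₀ ℕ) (a : K) :
    (toVars n (monomial e a)).IsHomogeneous (Finsupp.weight wt e) := by
  rw [toVars, aeval_monomial, algebraMap_eq, Finsupp.weight_apply, Finsupp.sum, Finsupp.prod]
  have h := IsHomogeneous.prod e.support (fun k => psum (Fin n) K (k + 1) ^ e k)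
    (fun k => e k • wt k) fun k _ => by
      have := (isHomogeneous_psum (K := K) n (k + 1)).pow (e k)
      rwa [mul_comm] at this
  have := (isHomogeneous_C (Fin n) a).mul h
  rwa [zero_add] at this

theorem isHomogeneous_toVars (n : ℕ) {F : SymFun K} {d : ℕ} (h : IsWeightedHomogeneous wt F d) :
    (toVars n F).IsHomogeneous d := by
  induction h using IsWeightedHomogeneous.induction_on with
  | zero => rw [map_zero]; exact isHomogeneous_zero _ _ _
  | add F G _ _ hF hG => rw [map_add]; exact hF.add hG
  | monomial e a he => rw [← he]; exact isHomogeneous_toVars_monomial n e a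

theorem toVars_weightedHomogeneousComponent (n d : ℕ) (F : SymFun K) :
    toVars n (weightedHomogeneousComponent wt d F) = homogeneousComponent d (toVars n F) := by
  induction F using MvPolynomial.induction_on' with
  | add F G hF hG => simp only [map_add, hF, hG]
  | monomial e a =>
    have h1 := isWeightedHomogeneous_monomial wt e a rfl
    have h2 := isHomogeneous_toVars_monomial n e a
    rw [weightedHomogeneousComponent_of_mem ((mem_weightedHomogeneousSubmodule _ _ _ _).2 h1),
      homogeneousComponent_of_mem h2]
    split_ifs
    · rfl
    · exact map_zero _

end Grading

/-! ### Power sums as free generators in low degree. -/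

section PowerSums

variable {K : Type*} [Field K]

/-- The kernels of the iterates stabilize; an element killed by f is f^n y for some y, and then y is
already in the kernel of f^n. -/
theorem injective_of_surjective_ringHom {A : Type*} [CommRing A] [IsNoetherianRing A]
    (f : A →+* A) (hf : Function.Surjective f) : Function.Injective f := by
  have hmono : Monotone fun n => RingHom.ker (f ^ n) := by
    refine monotone_nat_of_le_succ fun n x hx => ?_
    rw [RingHom.mem_ker] at hx ⊢
    rw [pow_succ', RingHom.mul_def, RingHom.comp_apply, hx, map_zero]
  obtain ⟨n, hn⟩ := monotone_stabilizes_iff_noetherian.2 ‹_› ⟨_, hmono⟩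
  rw [injective_iff_map_eq_zero]
  intro x hx
  have hsurj : Function.Surjective (f ^ n) := by
    rw [RingHom.coe_pow]
    exact hf.iterate n
  obtain ⟨y, rfl⟩ := hsurj x
  have h1 : y ∈ RingHom.ker (f ^ (n + 1)) := by
    rw [RingHom.mem_ker, pow_succ', RingHom.mul_def, RingHom.comp_apply, hx]
  have h2 : RingHom.ker (f ^ n) = RingHom.ker (f ^ (n + 1)) := hn (n + 1) (Nat.le_succ n)
  rwa [← h2, RingHom.mem_ker] at h1

/-- The substitution of the first `n` power sums. -/
noncomputable def psumHom (K : Type*) [Field K] (n : ℕ) :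
    MvPolynomial (Fin n) K →ₐ[K] symmetricSubalgebra (Fin n) K :=
  aeval fun i => ⟨psum (Fin n) K (i + 1), psum_isSymmetric (Fin n) K _⟩

theorem esymm_mem_range_psumHom [CharZero K] (n k : ℕ) (hk : k ≤ n) :
    (⟨esymm (Fin n) K k, esymm_isSymmetric (Fin n) K k⟩ : symmetricSubalgebra (Fin n) K) ∈
      (psumHom K n).range := by
  induction k using Nat.strong_induction_on with
  | _ k ih =>
  rcases Nat.eq_zero_or_pos k with rfl | h0
  · have : (⟨esymm (Fin n) K 0, esymm_isSymmetric (Fin n) K 0⟩ :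
        symmetricSubalgebra (Fin n) K) = 1 := Subtype.ext (by simp)
    rw [this]
    exact Subalgebra.one_mem _
  have hp : ∀ j, 0 < j → j ≤ n →
      (⟨psum (Fin n) K j, psum_isSymmetric (Fin n) K j⟩ : symmetricSubalgebra (Fin n) K) ∈
      (psumHom K n).range := by
    intro j h1 h2
    obtain ⟨i, rfl⟩ : ∃ i, j = i + 1 := ⟨j - 1, by omega⟩
    exact ⟨X ⟨i, by omega⟩, by rw [AlgHom.toRingHom_eq_coe, RingHom.coe_coe, psumHom, aeval_X]⟩
  have hk' : ((k : ℕ) : K) ≠ 0 := by exact_mod_cast h0.ne'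
  have hN : (⟨esymm (Fin n) K k, esymm_isSymmetric (Fin n) K k⟩ : symmetricSubalgebra (Fin n) K) =
      (k : K)⁻¹ • ((-1) ^ (k + 1) * ∑ a ∈ Finset.HasAntidiagonal.antidiagonal k with a.1 < k,
        (-1) ^ a.1 * ⟨esymm (Fin n) K a.1, esymm_isSymmetric (Fin n) K a.1⟩ *
          ⟨psum (Fin n) K a.2, psum_isSymmetric (Fin n) K a.2⟩) := by
    apply Subtype.ext
    have := mul_esymm_eq_sum (Fin n) K k
    simp only [SetLike.val_smul, MulMemClass.coe_mul, SubmonoidClass.coe_pow, NegMemClass.coe_neg,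
      OneMemClass.coe_one, AddSubmonoidClass.coe_finsetSum]
    rw [← this, smul_eq_C_mul, ← mul_assoc, ← C_eq_coe_nat, ← C_mul, inv_mul_cancel₀ hk', C_1,
      one_mul]
  rw [hN]
  refine Subalgebra.smul_mem _ (Subalgebra.mul_mem _ (Subalgebra.pow_mem _
    (Subalgebra.neg_mem _ (Subalgebra.one_mem _)) _) (Subalgebra.sum_mem _ fun a ha => ?_)) _
  rw [Finset.mem_filter, Finset.HasAntidiagonal.mem_antidiagonal] at ha
  exact Subalgebra.mul_mem _ (Subalgebra.mul_mem _ (Subalgebra.pow_mem _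
    (Subalgebra.neg_mem _ (Subalgebra.one_mem _)) _) (ih a.1 ha.2 (by omega)))
    (hp a.2 (by omega) (by omega))

theorem surjective_psumHom [CharZero K] (n : ℕ) : Function.Surjective (psumHom K n) := by
  intro f
  obtain ⟨p, rfl⟩ := esymmAlgHom_fin_surjective K le_rfl f
  rw [← AlgHom.mem_range]
  induction p using MvPolynomial.induction_on with
  | C r => rw [← algebraMap_eq, AlgHom.commutes]; exact Subalgebra.algebraMap_mem _ _
  | add p q hp hq => rw [map_add]; exact Subalgebra.add_mem _ hp hq
  | mul_X p i hp =>
    rw [map_mul]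
    refine Subalgebra.mul_mem _ hp ?_
    rw [esymmAlgHom, aeval_X]
    exact esymm_mem_range_psumHom n _ i.2

/-- By Newton's identities the power sums generate. Identifying symmetric polynomials with the
polynomial ring on the elementary ones gives a surjective endomorphism of a Noetherian ring. -/
theorem injective_psumHom [CharZero K] (n : ℕ) : Function.Injective (psumHom K n) := by
  have h := injective_of_surjective_ringHom
    (((esymmAlgEquiv (Fin n) K (Fintype.card_fin n)).symm.toAlgHom.comp (psumHom K n)).toRingHom)
    (fun y => by
      obtain ⟨x, hx⟩ := surjective_psumHom n (esymmAlgEquiv (Fin n) K (Fintype.card_fin n) y)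
      refine ⟨x, ?_⟩
      change (esymmAlgEquiv (Fin n) K (Fintype.card_fin n)).symm (psumHom K n x) = y
      rw [hx, AlgEquiv.symm_apply_apply])
  exact fun x y e => h (congrArg (esymmAlgEquiv (Fin n) K (Fintype.card_fin n)).symm e)

theorem toVars_rename (n : ℕ) (p : MvPolynomial (Fin n) K) :
    toVars n (rename Fin.val p) = (psumHom K n p).1 := by
  have h : (toVars n).comp (rename Fin.val) =
      (symmetricSubalgebra (Fin n) K).val.comp (psumHom K n) := by
    apply MvPolynomial.algHom_ext
    intro i
    rw [AlgHom.comp_apply, AlgHom.comp_apply, rename_X, toVars_X, psumHom, aeval_X]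
    rfl
  exact DFunLike.congr_fun h p

/-- In degree at most n only the first n power sums can occur, and these are algebraically
independent in n variables. -/
theorem eq_zero_of_toVars_eq_zero [CharZero K] {n d : ℕ} (hd : d ≤ n) {F : SymFun K}
    (hF : IsWeightedHomogeneous wt F d) (h : toVars n F = 0) : F = 0 := by
  obtain ⟨p, rfl⟩ := exists_rename_eq_of_vars_subset_range F (Fin.val : Fin n → ℕ)
    Fin.val_injective (by
      intro k hk
      rw [Finset.mem_coe, mem_vars_iff_mem_support] at hk
      obtain ⟨e, he, hk⟩ := hk
      have h1 := hF (mem_support_iff.1 he)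
      have h2 : wt k ≤ Finsupp.weight wt e :=
        Finsupp.le_weight_of_ne_zero' wt (Finsupp.mem_support_iff.1 hk)
      rw [wt] at h2
      exact ⟨⟨k, by omega⟩, rfl⟩)
  rw [toVars_rename] at h
  have : psumHom K n p = psumHom K n 0 := Subtype.ext (by rw [h, map_zero]; rfl)
  rw [injective_psumHom n this, map_zero]

theorem exists_toVars_eq [CharZero K] {n d : ℕ} {f : MvPolynomial (Fin n) K} (hf : f.IsSymmetric)
    (hd : f.IsHomogeneous d) : ∃ F : SymFun K, IsWeightedHomogeneous wt F d ∧ toVars n F = f := by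
  obtain ⟨p, hp⟩ := surjective_psumHom n ⟨f, hf⟩
  refine ⟨weightedHomogeneousComponent wt d (rename Fin.val p),
    weightedHomogeneousComponent_isWeightedHomogeneous _ _, ?_⟩
  rw [toVars_weightedHomogeneousComponent, toVars_rename, hp, homogeneousComponent_of_mem hd,
    if_pos rfl]

end PowerSums

/-! ### Partitions, exponent vectors and the dominance order. -/

section Partitions

/-- The `i`-th largest part of a partition (and `0` if there is none). -/
def rowLen {d : ℕ} (mu : d.Partition) (i : ℕ) : ℕ := (mu.parts.sort (· ≥ ·)).getD i 0

/-- The exponent vector in `n` variables with the largest parts of `mu`. -/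
def vec (n : ℕ) {d : ℕ} (mu : d.Partition) (i : Fin n) : ℕ := rowLen mu i

theorem getD_append_replicate_zero (l : List ℕ) (c i : ℕ) :
    (l ++ List.replicate c 0).getD i 0 = l.getD i 0 := by
  rcases lt_or_ge i l.length with h | h
  · rw [List.getD_append _ _ _ _ h]
  · rw [List.getD_append_right _ _ _ _ h, List.getD_eq_default _ _ h]
    rcases lt_or_ge (i - l.length) c with h' | h'
    · exact List.getD_replicate _ h'
    · exact List.getD_eq_default _ _ (by simpa using h')

theorem sum_take_eq_sum_getD (l : List ℕ) (k : ℕ) :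
    (l.take k).sum = ∑ i ∈ Finset.range k, l.getD i 0 := by
  induction l generalizing k with
  | nil => simp
  | cons a l ih =>
    cases k with
    | zero => simp
    | succ k =>
      rw [List.take_succ_cons, List.sum_cons, ih, Finset.sum_range_succ']
      simp [add_comm]

theorem partialSum_eq_sum_rowLen {d : ℕ} (mu : d.Partition) (k : ℕ) :
    partialSum mu k = ∑ i ∈ Finset.range k, rowLen mu i := sum_take_eq_sum_getD _ k

theorem rowLen_antitone {d : ℕ} (mu : d.Partition) : Antitone (rowLen mu) := by
  refine antitone_nat_of_succ_le fun i => ?_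
  rw [rowLen, rowLen]
  set l := mu.parts.sort (· ≥ ·)
  have hl : l.Pairwise (· ≥ ·) := Multiset.pairwise_sort _ _
  rcases lt_or_ge (i + 1) l.length with h | h
  · rw [List.getD_eq_getElem _ _ h, List.getD_eq_getElem _ _ (by omega)]
    exact List.pairwise_iff_getElem.1 hl i (i + 1) (by omega) h (by omega)
  · rw [List.getD_eq_default _ _ h]
    exact Nat.zero_le _

theorem vec_antitone (n : ℕ) {d : ℕ} (mu : d.Partition) : Antitone (vec n mu) :=
  fun _ _ h => rowLen_antitone mu h

theorem card_parts_le {d : ℕ} (mu : d.Partition) : mu.parts.card ≤ d := by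
  have := Multiset.card_nsmul_le_sum (s := mu.parts) (a := 1) fun x hx => mu.parts_pos hx
  rwa [mu.parts_sum, smul_eq_mul, mul_one] at this

theorem partition_ext {x y : Σ d : ℕ, d.Partition} (h : x.2.parts = y.2.parts) : x = y := by
  obtain ⟨d, mu⟩ := x
  obtain ⟨e, nu⟩ := y
  obtain rfl : d = e := by rw [← mu.parts_sum, ← nu.parts_sum, h]
  exact congrArg _ (Nat.Partition.ext h)

theorem parts_toPartition {n : ℕ} (al : Fin n → ℕ) :
    (toPartition al).2.parts = Multiset.filter (· ≠ 0) (List.ofFn al : Multiset ℕ) := by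
  rw [← Fin.univ_val_map]
  rfl

theorem fst_toPartition {n : ℕ} (al : Fin n → ℕ) : (toPartition al).1 = ∑ k, al k := rfl

theorem toPartition_comp_perm {n : ℕ} (al : Fin n → ℕ) (s : Equiv.Perm (Fin n)) :
    toPartition (al ∘ s) = toPartition al := by
  apply partition_ext
  rw [parts_toPartition, parts_toPartition, Multiset.coe_eq_coe.2 (s.ofFn_comp_perm al)]

theorem ofFn_eq_of_antitone {n : ℕ} {al : Fin n → ℕ} (h : Antitone al) :
    ∃ c, List.ofFn al = (toPartition al).2.parts.sort (· ≥ ·) ++ List.replicate c 0 := by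
  refine ⟨Multiset.count 0 (List.ofFn al : Multiset ℕ), ?_⟩
  refine List.Perm.eq_of_pairwise' (r := (· ≥ ·)) ?_ ?_ ?_
  · exact (List.sortedGE_ofFn_iff.2 h).pairwise
  · refine List.pairwise_append.2 ⟨Multiset.pairwise_sort _ _, ?_, ?_⟩
    · exact List.pairwise_replicate.2 (Or.inr le_rfl)
    · intro a _ b hb
      rw [List.eq_of_mem_replicate hb]
      exact Nat.zero_le _
  · rw [← Multiset.coe_eq_coe, ← Multiset.coe_add, Multiset.sort_eq, parts_toPartition,
      Multiset.coe_replicate, ← Multiset.filter_eq', add_comm]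
    exact (Multiset.filter_add_not (· = 0) _).symm

theorem vec_toPartition {n : ℕ} {al : Fin n → ℕ} (h : Antitone al) :
    vec n (toPartition al).2 = al := by
  obtain ⟨c, hc⟩ := ofFn_eq_of_antitone h
  ext i
  rw [vec, rowLen, ← getD_append_replicate_zero _ c, ← hc,
    List.getD_eq_getElem _ _ (by simp), List.getElem_ofFn]

theorem toPartition_vec {n d : ℕ} (mu : d.Partition) (h : mu.parts.card ≤ n) :
    toPartition (vec n mu) = ⟨d, mu⟩ := by
  apply partition_ext
  rw [parts_toPartition]
  have e : List.ofFn (vec n mu) = mu.parts.sort (· ≥ ·) ++ List.replicate (n - mu.parts.card) 0 := by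
    refine List.ext_getElem (by simp; omega) fun i h1 h2 => ?_
    rw [List.getElem_ofFn, vec, rowLen, ← getD_append_replicate_zero _ (n - mu.parts.card),
      List.getD_eq_getElem _ _ h2]
  rw [e, ← Multiset.coe_add, Multiset.sort_eq, Multiset.filter_add, Multiset.filter_eq_self.2,
    Multiset.filter_eq_nil.2, add_zero]
  · intro a ha h0
    exact h0 (List.eq_of_mem_replicate ha)
  · exact fun a ha => (mu.parts_pos ha).ne'

theorem exists_antitone_comp {n : ℕ} (al : Fin n → ℕ) :
    ∃ s : Equiv.Perm (Fin n), Antitone (al ∘ s) :=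
  ⟨Tuple.sort (OrderDual.toDual ∘ al), fun _ _ h => Tuple.monotone_sort (OrderDual.toDual ∘ al) h⟩

theorem toPartition_eq_iff {n : ℕ} {al be : Fin n → ℕ} :
    toPartition al = toPartition be ↔ al ∈ orbit be := by
  rw [mem_orbit]
  constructor
  · intro h
    obtain ⟨s, hs⟩ := exists_antitone_comp al
    obtain ⟨u, hu⟩ := exists_antitone_comp be
    have e : al ∘ s = be ∘ u := by
      rw [← vec_toPartition hs, ← vec_toPartition hu, toPartition_comp_perm, toPartition_comp_perm, h]
    refine ⟨u * s⁻¹, funext fun i => ?_⟩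
    have := congrFun e (s⁻¹ i)
    simpa using this.symm
  · rintro ⟨s, rfl⟩
    exact toPartition_comp_perm be s

theorem sum_fin_lt_vec {n d : ℕ} (mu : d.Partition) {k : ℕ} (hk : k ≤ n) :
    headSum (vec n mu) k = partialSum mu k := by
  rw [partialSum_eq_sum_rowLen, headSum]
  refine Finset.sum_bij (fun i _ => i.1) ?_ ?_ ?_ ?_
  · intro i hi
    simpa using hi
  · exact fun _ _ _ _ h => Fin.ext h
  · intro i hi
    have hi := Finset.mem_range.1 hi
    exact ⟨⟨i, by omega⟩, by simpa using hi, rfl⟩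
  · exact fun _ _ => rfl

theorem partialSum_toPartition {n : ℕ} {al : Fin n → ℕ} (h : Antitone al) {k : ℕ} (hk : k ≤ n) :
    partialSum (toPartition al).2 k = headSum al k := by
  rw [← sum_fin_lt_vec _ hk, vec_toPartition h]

theorem partialSum_eq_of_le {d : ℕ} (mu : d.Partition) {k : ℕ} (hk : d ≤ k) :
    partialSum mu k = d := by
  have : (mu.parts.sort (· ≥ ·)).length ≤ k := by
    rw [Multiset.length_sort]; exact (card_parts_le mu).trans hk
  rw [partialSum, List.take_of_length_le this, ← Multiset.sum_coe, Multiset.sort_eq, mu.parts_sum]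

theorem partition_eq_of_partialSum {d : ℕ} {mu nu : d.Partition}
    (h : ∀ k, k ≤ d → partialSum mu k = partialSum nu k) : mu = nu := by
  have h' : ∀ k, partialSum mu k = partialSum nu k := fun k => by
    rcases le_total k d with hk | hk
    · exact h k hk
    · rw [partialSum_eq_of_le mu hk, partialSum_eq_of_le nu hk]
  have hr : ∀ i, rowLen mu i = rowLen nu i := fun i => by
    have h1 := h' (i + 1)
    have h2 := h' i
    simp only [partialSum_eq_sum_rowLen, Finset.sum_range_succ] at h1 h2
    omega
  have e : (⟨d, mu⟩ : Σ d : ℕ, d.Partition) = ⟨d, nu⟩ := by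
    rw [← toPartition_vec mu (card_parts_le mu), ← toPartition_vec nu (card_parts_le nu)]
    congr 1
    exact funext fun i => hr i
  exact eq_of_heq (Sigma.mk.inj e).2

/-- The strict dominance order on all partitions; partitions of different integers are
incomparable. -/
def DomRel (x y : Σ d : ℕ, d.Partition) : Prop :=
  x.1 = y.1 ∧ x ≠ y ∧ ∀ k, partialSum x.2 k ≤ partialSum y.2 k

theorem domRel_mk_iff {d : ℕ} {mu lam : d.Partition} : DomRel ⟨d, mu⟩ ⟨d, lam⟩ ↔ DomLT mu lam := by
  rw [DomRel, DomLT]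
  simp

/-- The sum of the partial sums of a partition. -/
def height (x : Σ d : ℕ, d.Partition) : ℕ := ∑ k ∈ Finset.range (x.1 + 1), partialSum x.2 k

theorem DomRel.height_lt {x y : Σ d : ℕ, d.Partition} (h : DomRel x y) : height x < height y := by
  obtain ⟨d, mu⟩ := x
  obtain ⟨e, nu⟩ := y
  obtain ⟨h1, h2, h3⟩ := h
  obtain rfl : d = e := h1
  refine lt_of_le_of_ne (Finset.sum_le_sum fun k _ => h3 k) fun he => h2 ?_
  have := (Finset.sum_eq_sum_iff_of_le fun k _ => h3 k).1 he
  exact congrArg _ (partition_eq_of_partialSum fun k hk =>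
    this k (Finset.mem_range.2 (Nat.lt_succ_of_le hk)))

theorem DomRel.trans {x y z : Σ d : ℕ, d.Partition} (h : DomRel x y) (h' : DomRel y z) :
    DomRel x z :=
  ⟨h.1.trans h'.1, fun e => by
    have := h.height_lt.trans h'.height_lt
    rw [e] at this
    exact lt_irrefl _ this, fun k => (h.2.2 k).trans (h'.2.2 k)⟩

theorem finite_domRel (y : Σ d : ℕ, d.Partition) : {x | DomRel x y}.Finite := by
  refine (Set.finite_range fun mu : y.1.Partition => (⟨y.1, mu⟩ : Σ d : ℕ, d.Partition)).subset ?_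
  rintro ⟨d, mu⟩ ⟨h, -⟩
  obtain rfl : d = y.1 := h
  exact ⟨mu, rfl⟩

/-- The partial sums of the sorted `al` are sums of `al` over suitable sets of places, and the
strict inequality of squares excludes a rearrangement. Beyond n parts the partial sums are constant.
-/
theorem Dominated.domRel {n : ℕ} {lam al : Fin n → ℕ} (hl : Antitone lam) (h : Dominated lam al) :
    DomRel (toPartition al) (toPartition lam) := by
  obtain ⟨s, hs⟩ := exists_antitone_comp al
  refine ⟨h.sum_eq, fun e => ?_, fun k => ?_⟩
  · have := sum_eq_of_mem_orbit (toPartition_eq_iff.1 e) (· ^ 2)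
    have := h.sq_lt
    omega
  · have key : ∀ k, k ≤ n → partialSum (toPartition al).2 k ≤ partialSum (toPartition lam).2 k := by
      intro k hk
      rw [← toPartition_comp_perm al s, partialSum_toPartition hs hk, partialSum_toPartition hl hk]
      have hc : ((Finset.univ.filter fun i : Fin n => i.1 < k).map s.toEmbedding).card = k := by
        rw [Finset.card_map, Fin.card_filter_val_lt, min_eq_right hk]
      have := h.sum_le ((Finset.univ.filter fun i : Fin n => i.1 < k).map s.toEmbedding)
      rwa [hc, Finset.sum_map] at this
    rcases le_total k n with hk | hk
    · exact key k hk
    · have : ∀ be : Fin n → ℕ, partialSum (toPartition be).2 k = partialSum (toPartition be).2 n := by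
        intro be
        have hlen : ((toPartition be).2.parts.sort (· ≥ ·)).length ≤ n := by
          rw [Multiset.length_sort, parts_toPartition]
          refine (Multiset.card_le_card (Multiset.filter_le _ _)).trans ?_
          simp
        rw [partialSum, partialSum, List.take_of_length_le hlen,
          List.take_of_length_le (hlen.trans hk)]
      rw [this, this]
      exact key n le_rfl

end Partitions

/-! ### Monomial coefficients of symmetric functions. -/

section Coefficients

variable {K : Type*} [Field K]

theorem killCompl_X_of_notMem_range {n m : ℕ} {f : Fin n → Fin m} (hf : Function.Injective f)
    {j : Fin m} (hj : j ∉ Set.range f) : killCompl hf (X j : MvPolynomial (Fin m) K) = 0 := by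
  rw [killCompl, aeval_X, dif_neg hj]

theorem killCompl_toVars {n m : ℕ} {f : Fin n → Fin m} (hf : Function.Injective f)
    (F : SymFun K) : killCompl hf (toVars m F) = toVars n F := by
  classical
  have h : (killCompl hf).comp (toVars (K := K) m) = toVars n := by
    apply MvPolynomial.algHom_ext
    intro k
    rw [AlgHom.comp_apply, toVars_X, toVars_X, psum, psum, map_sum,
      ← Finset.sum_subset (Finset.subset_univ (Finset.univ.image f)),
      Finset.sum_image fun a _ b _ h => hf h]
    · refine Finset.sum_congr rfl fun i _ => ?_
      rw [map_pow, ← rename_X f, killCompl_rename_app]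
    · intro j _ hj
      rw [map_pow, killCompl_X_of_notMem_range hf, zero_pow (Nat.succ_ne_zero k)]
      simpa using hj
  exact DFunLike.congr_fun h F

theorem coeff_killCompl_eq {n m : ℕ} {f : Fin n → Fin m} (hf : Function.Injective f)
    (p : MvPolynomial (Fin m) K) (s : Fin n →₀ ℕ) :
    coeff s (killCompl hf p) = coeff (s.mapDomain f) p := by
  classical
  induction p using MvPolynomial.induction_on' with
  | add p q hp hq => rw [map_add, coeff_add, coeff_add, hp, hq]
  | monomial u a =>
    by_cases hu : (u.support : Set (Fin m)) ⊆ Set.range f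
    · obtain ⟨v, rfl⟩ : ∃ v : Fin n →₀ ℕ, v.mapDomain f = u :=
        ⟨u.comapDomain f hf.injOn, Finsupp.mapDomain_comapDomain f hf u hu⟩
      rw [killCompl_monomial_mapDomain, coeff_monomial, coeff_monomial]
      simp only [(Finsupp.mapDomain_injective hf).eq_iff]
    · rw [killCompl_monomial_eq_zero_of_not_subset hf a hu, coeff_zero, coeff_monomial, if_neg]
      rintro rfl
      refine hu fun j hj => ?_
      have := Finsupp.mapDomain_support hj
      obtain ⟨i, -, rfl⟩ := Finset.mem_image.1 this
      exact ⟨i, rfl⟩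

/-- Extension by zero along an injection preserves the partition. -/
theorem toPartition_mapDomain {n m : ℕ} {f : Fin n → Fin m} (hf : Function.Injective f)
    (s : Fin n →₀ ℕ) : toPartition (s.mapDomain f) = toPartition s := by
  classical
  apply partition_ext
  rw [parts_toPartition, parts_toPartition, ← Fin.univ_val_map, ← Fin.univ_val_map,
    Multiset.filter_map, Multiset.filter_map]
  have h1 : Multiset.filter ((· ≠ 0) ∘ ⇑(s.mapDomain f)) (Finset.univ : Finset (Fin m)).val =
      (Finset.univ.filter fun j => s.mapDomain f j ≠ 0).val := rfl
  have h2 : Multiset.filter ((· ≠ 0) ∘ ⇑s) (Finset.univ : Finset (Fin n)).val =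
      (Finset.univ.filter fun j => s j ≠ 0).val := rfl
  have h3 : (Finset.univ.filter fun j => s.mapDomain f j ≠ 0) =
      (Finset.univ.filter fun j => s j ≠ 0).map ⟨f, hf⟩ := by
    ext j
    simp only [Finset.mem_filter, Finset.mem_univ, true_and, Finset.mem_map,
      Function.Embedding.coeFn_mk]
    constructor
    · intro hj
      have := Finsupp.mapDomain_support (Finsupp.mem_support_iff.2 hj)
      obtain ⟨i, hi, rfl⟩ := Finset.mem_image.1 this
      exact ⟨i, Finsupp.mem_support_iff.1 hi, rfl⟩
    · rintro ⟨i, hi, rfl⟩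
      rwa [Finsupp.mapDomain_apply hf]
  rw [h1, h2, h3, Finset.map_val, Multiset.map_map]
  refine Multiset.map_congr rfl fun i _ => ?_
  rw [Function.comp_apply, Function.Embedding.coeFn_mk, Finsupp.mapDomain_apply hf]

theorem coeff_comp_perm {n : ℕ} {p : MvPolynomial (Fin n) K} (hp : p.IsSymmetric)
    {s u : Fin n →₀ ℕ} (h : toPartition s = toPartition u) : coeff s p = coeff u p := by
  obtain ⟨w, hw⟩ := mem_orbit.1 (toPartition_eq_iff.1 h)
  have e : u = s.mapDomain w := by
    ext i
    obtain ⟨j, rfl⟩ := w.surjective i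
    rw [Finsupp.mapDomain_apply w.injective, ← hw, Function.comp_apply]
  conv_rhs => rw [e, ← hp w]
  rw [coeff_rename_mapDomain _ w.injective]

/-- Both coefficients are read in n + m variables, the n variables embedded at the beginning and the
m variables at the end; there symmetry identifies them. -/
theorem coeff_toVars_eq {n m : ℕ} (F : SymFun K) {s : Fin n →₀ ℕ} {u : Fin m →₀ ℕ}
    (h : toPartition s = toPartition u) : coeff s (toVars n F) = coeff u (toVars m F) := by
  rw [← killCompl_toVars (Fin.castAdd_injective n m), coeff_killCompl_eq,
    ← killCompl_toVars (Fin.natAdd_injective m n), coeff_killCompl_eq]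
  apply coeff_comp_perm (isSymmetric_toVars _ F)
  rw [toPartition_mapDomain (Fin.castAdd_injective n m),
    toPartition_mapDomain (Fin.natAdd_injective m n), h]

/-- The coefficient of the monomial symmetric function of `x` in a symmetric function. -/
noncomputable def mcoef (F : SymFun K) (x : Σ d : ℕ, d.Partition) : K :=
  coeff (Finsupp.equivFunOnFinite.symm (vec (x.1 + 1) x.2)) (toVars (x.1 + 1) F)

theorem coeff_toVars {n : ℕ} (F : SymFun K) (s : Fin n →₀ ℕ) :
    coeff s (toVars n F) = mcoef F (toPartition s) := by
  apply coeff_toVars_eq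
  exact (toPartition_vec _ ((card_parts_le _).trans (Nat.le_succ _))).symm

theorem toPartition_symm_vec (x : Σ d : ℕ, d.Partition) :
    toPartition (Finsupp.equivFunOnFinite.symm (vec (x.1 + 1) x.2)) = x :=
  toPartition_vec x.2 ((card_parts_le _).trans (Nat.le_succ _))

theorem mcoef_smul (c : K) (F : SymFun K) (x : Σ d : ℕ, d.Partition) :
    mcoef (c • F) x = c * mcoef F x := by
  rw [mcoef, map_smul, coeff_smul, mcoef, smul_eq_mul]

theorem mcoef_sub (F G : SymFun K) (x : Σ d : ℕ, d.Partition) :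
    mcoef (F - G) x = mcoef F x - mcoef G x := by
  rw [mcoef, map_sub, coeff_sub, mcoef, mcoef]

theorem eq_zero_of_mcoef [CharZero K] {F : SymFun K} (h : ∀ x, mcoef F x = 0) : F = 0 := by
  have h0 : ∀ n, toVars n F = 0 := fun n => by
    ext s
    rw [coeff_toVars, h, coeff_zero]
  have hd : ∀ d, weightedHomogeneousComponent wt d F = 0 := fun d =>
    eq_zero_of_toVars_eq_zero le_rfl (weightedHomogeneousComponent_isWeightedHomogeneous _ _)
      (by rw [toVars_weightedHomogeneousComponent, h0, map_zero])
  rw [← finsum_weightedHomogeneousComponent wt F]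
  simp only [hd, finsum_zero]

theorem mcoef_eq_zero_of_homogeneous {F : SymFun K} {d : ℕ} (hF : IsWeightedHomogeneous wt F d)
    {x : Σ d : ℕ, d.Partition} (hx : x.1 ≠ d) : mcoef F x = 0 := by
  have h := isHomogeneous_toVars (x.1 + 1) hF
  by_contra hne
  have := h hne
  refine hx ?_
  rw [← this, Finsupp.weight_apply, Finsupp.sum_fintype _ _ (by simp)]
  conv_lhs => rw [← toPartition_symm_vec x, fst_toPartition]
  simp

theorem parts_toPartition_eq_map_support {n : ℕ} (s : Fin n →₀ ℕ) :
    (toPartition s).2.parts = s.support.val.map s := by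
  classical
  rw [parts_toPartition, ← Fin.univ_val_map, Multiset.filter_map]
  have h : s.support = Finset.univ.filter fun i => s i ≠ 0 := by
    ext i; simp
  rw [h]
  rfl

theorem coeff_msymm {n d : ℕ} (mu : d.Partition) (s : Fin n →₀ ℕ) [Decidable (toPartition s = ⟨d, mu⟩)] :
    coeff s (msymm (Fin n) K mu) = if toPartition s = ⟨d, mu⟩ then 1 else 0 := by
  have hmon : ∀ a : Multiset (Fin n), (a.map (X : Fin n → MvPolynomial (Fin n) K)).prod =
      monomial (Multiset.toFinsupp a) 1 := by
    intro a
    induction a using Multiset.induction_on with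
    | empty => simp
    | cons i a ih =>
      rw [Multiset.map_cons, Multiset.prod_cons, ih, ← Multiset.singleton_add, map_add,
        Multiset.toFinsupp_singleton, X, monomial_mul, one_mul]
  have hp : ∀ a : Sym (Fin n) d, (Nat.Partition.ofSym a).parts =
      (toPartition (Multiset.toFinsupp a.1)).2.parts := by
    intro a
    rw [parts_toPartition_eq_map_support, Multiset.toFinsupp_support]
    rfl
  rw [msymm, coeff_sum]
  simp only [hmon, coeff_monomial]
  split_ifs with h
  · have hc : (Finsupp.toMultiset s).card = d := by
      rw [Finsupp.card_toMultiset, Finsupp.sum_fintype _ _ fun _ => rfl]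
      exact congrArg Sigma.fst h
    have hs : Nat.Partition.ofSym (Sym.mk (Finsupp.toMultiset s) hc) = mu := by
      apply Nat.Partition.ext
      refine (hp _).trans ?_
      change (toPartition (Multiset.toFinsupp (Finsupp.toMultiset s))).2.parts = _
      rw [Finsupp.toMultiset_toFinsupp, h]
    rw [Finset.sum_eq_single ⟨Sym.mk (Finsupp.toMultiset s) hc, hs⟩]
    · rw [if_pos (Finsupp.toMultiset_toFinsupp s)]
    · intro b _ hb
      rw [if_neg]
      rintro rfl
      refine hb (Subtype.ext (Subtype.ext ?_))
      exact (Multiset.toFinsupp_toMultiset _).symm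
    · exact fun h => absurd (Finset.mem_univ _) h
  · refine Finset.sum_eq_zero fun b _ => if_neg ?_
    rintro rfl
    refine h (partition_ext ?_)
    rw [← hp, b.2]

end Coefficients

/-! ### Consequences of the algebraic independence of q and t. -/

section Independence

variable {K : Type*} [Field K] [CharZero K] {q t : K}

theorem one_sub_mul_ne_zero (h : AlgebraicIndependent ℚ ![q, t]) {a b : ℕ} (hab : 0 < a + b) :
    1 - q ^ a * t ^ b ≠ 0 := by
  intro h0
  have hp : (1 - X 0 ^ a * X 1 ^ b : MvPolynomial (Fin 2) ℚ) = 0 := by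
    apply (algebraicIndependent_iff.1 h)
    simpa using h0
  have := congrArg (eval fun _ => (2 : ℚ)) hp
  rw [map_sub, map_mul, map_pow, map_pow, eval_X, eval_X, map_one, map_zero, ← pow_add,
    sub_eq_zero] at this
  exact (one_lt_pow₀ (by norm_num : (1 : ℚ) < 2) hab.ne').ne this

theorem generic_of_algebraicIndependent (h : AlgebraicIndependent ℚ ![q, t]) : Generic q t where
  q_ne := h.ne_zero 0
  t_ne := h.ne_zero 1
  one_sub_t k hk := by
    have := one_sub_mul_ne_zero h (a := 0) (b := k) (by omega)
    rwa [pow_zero, one_mul] at this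
  one_sub_qt v k hv := one_sub_mul_ne_zero h (by omega)

theorem one_sub_q_pow_ne_zero (h : AlgebraicIndependent ℚ ![q, t]) {k : ℕ} (hk : 0 < k) :
    1 - q ^ k ≠ 0 := by
  have := one_sub_mul_ne_zero h (a := k) (b := 0) (by omega)
  rwa [pow_zero, mul_one] at this

theorem exponents_eq_of_sum_eq (h : AlgebraicIndependent ℚ ![q, t]) {R : ℕ} {a b : ℕ → ℕ}
    (hab : ∑ v ∈ Finset.range R, q ^ v * t ^ a v = ∑ v ∈ Finset.range R, q ^ v * t ^ b v) {v : ℕ}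
    (hv : v < R) : a v = b v := by
  have hp : (∑ v ∈ Finset.range R, X 0 ^ v * X 1 ^ a v -
      ∑ v ∈ Finset.range R, X 0 ^ v * X 1 ^ b v : MvPolynomial (Fin 2) ℚ) = 0 := by
    apply (algebraicIndependent_iff.1 h)
    simp [hab]
  -- Keeping q as an indeterminate and setting t = 2 makes the coefficient of q^v a power of 2,
  -- which determines its exponent.
  have := congrArg (aeval ![(Polynomial.X : Polynomial ℚ), Polynomial.C 2]) hp
  simp only [map_sub, map_sum, map_mul, map_pow, aeval_X, map_zero, Matrix.cons_val_zero,
    Matrix.cons_val_one, sub_eq_zero] at this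
  simp only [← Polynomial.C_pow, mul_comm (Polynomial.X ^ _)] at this
  have := congrArg (fun p => Polynomial.coeff p v) this
  simp only [Polynomial.finsetSum_coeff, Polynomial.coeff_C_mul_X_pow, Finset.sum_ite_eq,
    Finset.mem_range, hv, if_true] at this
  exact Nat.pow_right_injective le_rfl (by exact_mod_cast this)

end Independence

/-! ### The eigenvalues separate partitions. -/

section Eigenvalues

variable {K : Type*} [Field K]

/-- The number of parts of a partition which are larger than `v`. -/
def numGT (x : Σ d : ℕ, d.Partition) (v : ℕ) : ℕ := (x.2.parts.filter (v < ·)).card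

theorem numGT_toPartition {n : ℕ} (al : Fin n → ℕ) (v : ℕ) :
    numGT (toPartition al) v = Finset.card {k : Fin n | v < al k} := by
  rw [numGT, parts_toPartition, ← Fin.univ_val_map, Multiset.filter_filter, Multiset.filter_map,
    Multiset.card_map, Finset.card, Finset.filter_val]
  congr 1
  refine Multiset.filter_congr fun i _ => ?_
  simp only [Function.comp_apply]
  omega

theorem numGT_eq_zero (x : Σ d : ℕ, d.Partition) {v : ℕ} (hv : x.1 ≤ v) : numGT x v = 0 := by
  rw [numGT, Multiset.card_eq_zero, Multiset.filter_eq_nil]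
  intro a ha
  have := Multiset.le_sum_of_mem ha
  rw [x.2.parts_sum] at this
  omega

theorem numGT_le (x : Σ d : ℕ, d.Partition) (v : ℕ) : numGT x v ≤ x.1 :=
  (Multiset.card_le_card (Multiset.filter_le _ _)).trans (card_parts_le x.2)

theorem numGT_eq_count_add (x : Σ d : ℕ, d.Partition) (v : ℕ) :
    numGT x v = x.2.parts.count (v + 1) + numGT x (v + 1) := by
  rw [numGT, numGT, ← Multiset.filter_add_not (· = v + 1) (x.2.parts.filter (v < ·)),
    Multiset.card_add, Multiset.filter_filter, Multiset.filter_filter, Multiset.count,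
    Multiset.countP_eq_card_filter]
  congr 2 <;> refine Multiset.filter_congr fun i _ => ?_ <;> omega

theorem eq_of_numGT {x y : Σ d : ℕ, d.Partition} (h : ∀ v, numGT x v = numGT y v) : x = y := by
  refine partition_ext (Multiset.ext.2 fun a => ?_)
  cases a with
  | zero =>
    rw [Multiset.count_eq_zero_of_notMem fun h => (x.2.parts_pos h).ne' rfl,
      Multiset.count_eq_zero_of_notMem fun h => (y.2.parts_pos h).ne' rfl]
  | succ v =>
    have h1 := numGT_eq_count_add x v
    have h2 := numGT_eq_count_add y v
    rw [h, h] at h1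
    omega

/-- The eigenvalue of `macOp` at a Macdonald symmetric function. -/
noncomputable def macEigVal (q t : K) (x : Σ d : ℕ, d.Partition) : K :=
  ∑ v ∈ Finset.range (x.1 + 1), stepWeight q x.1 v * t⁻¹ ^ numGT x v

theorem sum_stepWeight_mul_succ (q : K) (R : ℕ) (f : ℕ → K) (h : f (R + 1) = f R) :
    ∑ v ∈ Finset.range (R + 1 + 1), stepWeight q (R + 1) v * f v =
      ∑ v ∈ Finset.range (R + 1), stepWeight q R v * f v := by
  rw [Finset.sum_range_succ, Finset.sum_range_succ, Finset.sum_range_succ]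
  have : ∀ v ∈ Finset.range R, stepWeight q (R + 1) v * f v = stepWeight q R v * f v := by
    intro v hv
    have hv := Finset.mem_range.1 hv
    rw [stepWeight, stepWeight, if_pos hv, if_pos (hv.trans (Nat.lt_succ_self R))]
  rw [Finset.sum_congr rfl this]
  simp only [stepWeight, lt_irrefl, if_false, Nat.lt_succ_self, if_true, h]
  ring

theorem sum_stepWeight_mul_eq (q : K) {r R : ℕ} (hR : r ≤ R) (f : ℕ → K)
    (h : ∀ v, r ≤ v → f v = f r) :
    ∑ v ∈ Finset.range (R + 1), stepWeight q R v * f v =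
      ∑ v ∈ Finset.range (r + 1), stepWeight q r v * f v := by
  induction R, hR using Nat.le_induction with
  | base => rfl
  | succ R hR ih =>
    rw [sum_stepWeight_mul_succ, ih]
    rw [h _ hR, h _ (by omega)]

/-- Counting the parts larger than v instead of the others splits off t^n and leaves a quantity of
the partition alone. The range of v may be enlarged since the weights telescope beyond the largest
part. -/
theorem eigVal_eq (q : K) {t : K} (ht : t ≠ 0) {n : ℕ} (al : Fin n → ℕ) :
    eigVal q t al = t ^ n * macEigVal q t (toPartition al) := by
  have hle : largest al ≤ (toPartition al).1 := by
    rw [largest]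
    refine Finset.sup_le fun k _ => ?_
    rw [fst_toPartition]
    exact Finset.single_le_sum (f := al) (fun _ _ => Nat.zero_le _) (Finset.mem_univ k)
  have hz : ∀ v, largest al ≤ v → numGT (toPartition al) v = 0 := by
    intro v hv
    rw [numGT_toPartition, Finset.card_eq_zero, Finset.filter_eq_empty_iff]
    intro k _
    have := le_largest al k
    omega
  rw [macEigVal, sum_stepWeight_mul_eq q hle (fun v => t⁻¹ ^ numGT (toPartition al) v)
    fun v hv => by rw [hz v hv, hz _ le_rfl], eigVal, Finset.mul_sum]
  refine Finset.sum_congr rfl fun v _ => ?_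
  have hc : Finset.card {k : Fin n | v < al k} + Finset.card {k : Fin n | al k ≤ v} = n := by
    have := Finset.card_filter_add_card_filter_not (s := (Finset.univ : Finset (Fin n)))
      (fun k => v < al k)
    simpa using this
  rw [numGT_toPartition, inv_pow]
  have e : t ^ n = t ^ Finset.card {k : Fin n | v < al k} * t ^ Finset.card {k : Fin n | al k ≤ v} := by
    rw [← pow_add, hc]
  rw [e]
  field_simp

theorem macEigVal_injective [CharZero K] {q t : K} (h : AlgebraicIndependent ℚ ![q, t]) :
    Function.Injective (macEigVal q t) := by
  intro x y hxy
  have H := generic_of_algebraicIndependent h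
  set R := x.1 + y.1
  -- A common range for both partitions, with denominators cleared by t^R. The final term is the
  -- same for all partitions, and the rest is 1 - q times a polynomial from which the numbers of
  -- large parts can be read off.
  have key : ∀ z : Σ d : ℕ, d.Partition, z.1 ≤ R → t ^ R * macEigVal q t z =
      (1 - q) * ∑ v ∈ Finset.range R, q ^ v * t ^ (R - numGT z v) + t ^ R * q ^ R := by
    intro z hz
    rw [macEigVal, ← sum_stepWeight_mul_eq q hz (fun v => t⁻¹ ^ numGT z v)
      fun v hv => by rw [numGT_eq_zero z hv, numGT_eq_zero z le_rfl], Finset.sum_range_succ,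
      numGT_eq_zero z hz, stepWeight, if_neg (lt_irrefl R), pow_zero, mul_one, mul_add,
      Finset.mul_sum, Finset.mul_sum]
    congr 1
    refine Finset.sum_congr rfl fun v hv => ?_
    rw [stepWeight, if_pos (Finset.mem_range.1 hv), inv_pow,
      ← pow_sub_mul_pow t ((numGT_le z v).trans hz)]
    have := pow_ne_zero (numGT z v) H.t_ne
    field_simp
    ring
  have h1 := key x (Nat.le_add_right _ _)
  have h2 := key y (Nat.le_add_left _ _)
  rw [hxy, h2] at h1
  have hq : 1 - q ≠ 0 := by simpa using one_sub_q_pow_ne_zero h one_pos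
  have h3 := mul_left_cancel₀ hq (add_right_cancel h1)
  refine eq_of_numGT fun v => ?_
  rcases lt_or_ge v R with hv | hv
  · have := exponents_eq_of_sum_eq h h3 hv
    have hx := (numGT_le x v).trans (Nat.le_add_right x.1 y.1)
    have hy := (numGT_le y v).trans (Nat.le_add_left y.1 x.1)
    omega
  · rw [numGT_eq_zero x ((Nat.le_add_right _ _).trans hv),
      numGT_eq_zero y ((Nat.le_add_left _ _).trans hv)]

end Eigenvalues

/-! ### Unitriangular families. -/

section Triangularity

variable {K : Type*} [Field K]

/-- `F` is the sum of `m_x` and of multiples of the `m_y` with `y < x`. -/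
def Unitriangular (F : SymFun K) (x : Σ d : ℕ, d.Partition) : Prop :=
  mcoef F x = 1 ∧ ∀ y, y ≠ x → mcoef F y ≠ 0 → DomRel y x

theorem unitriangular_iff {F : SymFun K} {d : ℕ} {lam : d.Partition}
    [DecidablePred fun mu : d.Partition => DomLT mu lam] :
    (∃ c : d.Partition → K, ∀ N : ℕ, toVars N F = msymm (Fin N) K lam +
      ∑ mu : d.Partition with DomLT mu lam, c mu • msymm (Fin N) K mu) ↔
    Unitriangular F ⟨d, lam⟩ := by
  classical
  have hcoef : ∀ (c : d.Partition → K) (N : ℕ) (s : Fin N →₀ ℕ),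
      coeff s (msymm (Fin N) K lam +
        ∑ mu : d.Partition with DomLT mu lam, c mu • msymm (Fin N) K mu) =
      (if toPartition s = ⟨d, lam⟩ then 1 else 0) +
        ∑ mu : d.Partition with DomLT mu lam, c mu * if toPartition s = ⟨d, mu⟩ then 1 else 0 := by
    intro c N s
    simp only [coeff_add, coeff_sum, coeff_smul, coeff_msymm, smul_eq_mul]
  constructor
  · rintro ⟨c, hc⟩
    have hm : ∀ x, mcoef F x = (if x = ⟨d, lam⟩ then 1 else 0) +
        ∑ mu : d.Partition with DomLT mu lam, c mu * if x = ⟨d, mu⟩ then 1 else 0 := by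
      intro x
      rw [mcoef, hc, hcoef, toPartition_symm_vec]
    constructor
    · rw [hm, if_pos rfl, Finset.sum_eq_zero, add_zero]
      intro mu hmu
      rw [if_neg, mul_zero]
      intro e
      exact (Finset.mem_filter.1 hmu).2.1 (eq_of_heq (Sigma.mk.inj e).2).symm
    · intro y hy hne
      rw [hm, if_neg hy, zero_add] at hne
      obtain ⟨mu, hmu, hne⟩ := Finset.exists_ne_zero_of_sum_ne_zero hne
      obtain rfl : y = ⟨d, mu⟩ := by
        by_contra h
        rw [if_neg h, mul_zero] at hne
        exact hne rfl
      exact domRel_mk_iff.2 (Finset.mem_filter.1 hmu).2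
  · rintro ⟨h1, h2⟩
    refine ⟨fun mu => mcoef F ⟨d, mu⟩, fun N => ?_⟩
    ext s
    rw [hcoef, coeff_toVars]
    generalize toPartition s = x
    by_cases hx : x = ⟨d, lam⟩
    · subst hx
      rw [h1, if_pos rfl, Finset.sum_eq_zero, add_zero]
      intro mu hmu
      rw [if_neg, mul_zero]
      intro e
      exact (Finset.mem_filter.1 hmu).2.1 (eq_of_heq (Sigma.mk.inj e).2).symm
    · rw [if_neg hx, zero_add]
      by_cases h0 : mcoef F x = 0
      · rw [h0, Finset.sum_eq_zero]
        intro mu _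
        split_ifs with e
        · rw [← e, h0, zero_mul]
        · exact mul_zero _
      · have hd := h2 x hx h0
        obtain ⟨e, mu⟩ := x
        obtain rfl : e = d := hd.1
        have hmu : mu ∈ Finset.univ.filter fun mu : e.Partition => DomLT mu lam :=
          Finset.mem_filter.2 ⟨Finset.mem_univ _, domRel_mk_iff.1 hd⟩
        rw [Finset.sum_eq_single_of_mem mu hmu, if_pos rfl, mul_one]
        intro nu _ hne
        rw [if_neg, mul_zero]
        intro e
        exact hne (eq_of_heq (Sigma.mk.inj e).2).symm

/-- Elimination from the top: subtracting a multiple of Q_x for x of maximal height in the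
down-closed set S removes the coefficient at x and creates none outside S. -/
theorem mem_span_of_unitriangular [CharZero K] {Q : (Σ d : ℕ, d.Partition) → SymFun K}
    (hQ : ∀ x, Unitriangular (Q x) x) (S : Finset (Σ d : ℕ, d.Partition))
    (hS : ∀ x ∈ S, ∀ y, DomRel y x → y ∈ S) {F : SymFun K} (hF : ∀ x ∉ S, mcoef F x = 0) :
    F ∈ Submodule.span K (Q '' S) := by
  classical
  induction h : S.card generalizing S F with
  | zero =>
    rw [Finset.card_eq_zero] at h
    subst h
    rw [eq_zero_of_mcoef fun x => hF x (Finset.notMem_empty x)]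
    exact Submodule.zero_mem _
  | succ m ih =>
    obtain ⟨x, hx, hmax⟩ := Finset.exists_max_image S height
      (Finset.card_pos.1 (by rw [h]; exact Nat.succ_pos m))
    have key : F - mcoef F x • Q x ∈ Submodule.span K (Q '' (S.erase x)) := by
      refine ih (S.erase x) ?_ ?_ (by rw [Finset.card_erase_of_mem hx, h]; rfl)
      · intro y hy z hz
        have hyS := (Finset.mem_erase.1 hy).2
        refine Finset.mem_erase.2 ⟨fun e => ?_, hS y hyS z hz⟩
        have := hmax y hyS
        rw [← e] at this
        exact absurd this (not_le.2 hz.height_lt)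
      · intro y hy
        rw [mcoef_sub, mcoef_smul]
        by_cases hyx : y = x
        · rw [hyx, (hQ x).1, mul_one, sub_self]
        have hyS : y ∉ S := fun h => hy (Finset.mem_erase.2 ⟨hyx, h⟩)
        have : mcoef (Q x) y = 0 := by
          by_contra h0
          exact hyS (hS x hx y ((hQ x).2 y hyx h0))
        rw [hF y hyS, this, mul_zero, sub_zero]
    rw [← sub_add_cancel F (mcoef F x • Q x)]
    refine Submodule.add_mem _ (Submodule.span_mono (Set.image_mono ?_) key)
      (Submodule.smul_mem _ _ (Submodule.subset_span ⟨x, hx, rfl⟩))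
    exact Finset.coe_subset.2 (Finset.erase_subset x S)

theorem span_range_eq_top_of_unitriangular [CharZero K] {Q : (Σ d : ℕ, d.Partition) → SymFun K}
    (hQ : ∀ x, Unitriangular (Q x) x) : Submodule.span K (Set.range Q) = ⊤ := by
  classical
  rw [eq_top_iff]
  intro F _
  induction F using MvPolynomial.induction_on' with
  | add F G hF hG => exact Submodule.add_mem _ (hF trivial) (hG trivial)
  | monomial e a =>
    have h := isWeightedHomogeneous_monomial wt e a rfl
    refine Submodule.span_mono (Set.image_subset_range Q _) (mem_span_of_unitriangular hQ
      (Finset.univ.image fun mu : (Finsupp.weight wt e).Partition => ⟨_, mu⟩) ?_ ?_)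
    · rintro x hx ⟨d, nu⟩ hy
      obtain ⟨mu, -, rfl⟩ := Finset.mem_image.1 hx
      obtain rfl : d = Finsupp.weight wt e := hy.1
      exact Finset.mem_image_of_mem _ (Finset.mem_univ _)
    · rintro ⟨d, nu⟩ hx
      refine mcoef_eq_zero_of_homogeneous h fun hd => hx ?_
      obtain rfl : d = Finsupp.weight wt e := hd
      exact Finset.mem_image_of_mem _ (Finset.mem_univ _)

theorem isHomogeneous_orbitPoly (q t : K) {n : ℕ} {lam : Fin n → ℕ} (hl : Antitone lam) :
    (orbitPoly q t lam).IsHomogeneous (∑ k, lam k) := by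
  intro s hs
  have hw : Finsupp.weight (1 : Fin n → ℕ) s = ∑ k, s k := by
    rw [Finsupp.weight_apply, Finsupp.sum_fintype _ _ (by simp)]
    simp
  rw [hw]
  by_cases ho : (s : Fin n → ℕ) ∈ orbit lam
  · exact sum_eq_of_mem_orbit ho id
  · refine (dominated_of_coeff_orbitPoly_ne_zero (q := q) (t := t) hl ho ?_).sum_eq
    rwa [Finsupp.equivFunOnFinite_symm_coe]

end Triangularity

/-! ### Existence and uniqueness of the Macdonald family. -/

section Existence

variable {K : Type*} [Field K] [CharZero K] {q t : K}

/-- One variable more than the degree: specialization loses nothing in this degree, and the number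
of variables is positive, as the cyclic operator requires. -/
theorem exists_macdonald (q : K) (ht : t ≠ 0) (x : Σ d : ℕ, d.Partition) :
    ∃ F : SymFun K, IsWeightedHomogeneous wt F x.1 ∧
      toVars (x.1 + 1) F = orbitPoly q t (vec (x.1 + 1) x.2) := by
  have hv := vec_antitone (x.1 + 1) x.2
  have hd := isHomogeneous_orbitPoly q t hv
  have hx : ∑ k, vec (x.1 + 1) x.2 k = x.1 := congrArg Sigma.fst (toPartition_symm_vec x)
  rw [hx] at hd
  exact exists_toVars_eq (isSymmetric_orbitPoly q ht hv) hd

/-- The Macdonald symmetric function, lifted from sufficiently many variables. -/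
noncomputable def macdonald (q : K) (ht : t ≠ 0) (x : Σ d : ℕ, d.Partition) : SymFun K :=
  Classical.choose (exists_macdonald q ht x)

theorem isWeightedHomogeneous_macdonald (q : K) (ht : t ≠ 0) (x : Σ d : ℕ, d.Partition) :
    IsWeightedHomogeneous wt (macdonald q ht x) x.1 :=
  (Classical.choose_spec (exists_macdonald q ht x)).1

theorem toVars_macdonald (q : K) (ht : t ≠ 0) (x : Σ d : ℕ, d.Partition) :
    toVars (x.1 + 1) (macdonald q ht x) = orbitPoly q t (vec (x.1 + 1) x.2) :=
  (Classical.choose_spec (exists_macdonald q ht x)).2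

theorem unitriangular_macdonald (q : K) (ht : t ≠ 0) (x : Σ d : ℕ, d.Partition) :
    Unitriangular (macdonald q ht x) x := by
  have hv := vec_antitone (x.1 + 1) x.2
  constructor
  · rw [mcoef, toVars_macdonald, coeff_orbitPoly_self q t hv]
  · intro y hy hne
    have hd : y.1 = x.1 := by
      by_contra hd
      exact hne (mcoef_eq_zero_of_homogeneous (isWeightedHomogeneous_macdonald q ht x) hd)
    have hxv : toPartition (vec (x.1 + 1) x.2) = x := toPartition_symm_vec x
    have hyv : toPartition (vec (x.1 + 1) y.2) = y :=
      toPartition_vec y.2 ((card_parts_le _).trans (by omega))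
    have hc : coeff (Finsupp.equivFunOnFinite.symm (vec (x.1 + 1) y.2))
        (orbitPoly q t (vec (x.1 + 1) x.2)) = mcoef (macdonald q ht x) y := by
      rw [← toVars_macdonald q ht, coeff_toVars]
      exact congrArg _ hyv
    have ho : vec (x.1 + 1) y.2 ∉ orbit (vec (x.1 + 1) x.2) := by
      rw [← toPartition_eq_iff, hxv, hyv]
      exact hy
    have := (dominated_of_coeff_orbitPoly_ne_zero hv ho (by rwa [hc])).domRel hv
    rwa [hxv, hyv] at this

theorem macOp_macdonald (H : Generic q t) (x : Σ d : ℕ, d.Partition) :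
    macOp q t (macdonald q H.t_ne x) = macEigVal q t x • macdonald q H.t_ne x := by
  have hh := isWeightedHomogeneous_macdonald q H.t_ne x
  have hv := vec_antitone (x.1 + 1) x.2
  rw [← sub_eq_zero]
  refine eq_zero_of_toVars_eq_zero (n := x.1 + 1) (Nat.le_succ x.1)
    ((isWeightedHomogeneous_macOp q t hh).sub (isWeightedHomogeneous_smul _ hh)) ?_
  have h1 := diffOp_toVars (N := x.1) q H.t_ne (macdonald q H.t_ne x)
  have h2 := diffOp_orbitPoly H hv
  rw [toVars_macdonald, h2, sub_smul, one_smul, sub_left_inj, eigVal_eq q H.t_ne,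
    toPartition_vec x.2 ((card_parts_le _).trans (Nat.le_succ _)), mul_smul] at h1
  rw [map_sub, map_smul, toVars_macdonald, sub_eq_zero]
  exact (smul_right_injective _ (pow_ne_zero _ H.t_ne) h1).symm

/-- Eigenvectors of a self-adjoint operator for different eigenvalues are orthogonal. -/
theorem macForm_macdonald (h : AlgebraicIndependent ℚ ![q, t]) (ht : t ≠ 0)
    {x y : Σ d : ℕ, d.Partition} (hxy : x ≠ y) :
    macForm q t (macdonald q ht x) (macdonald q ht y) = 0 := by
  have H := generic_of_algebraicIndependent h
  have := macForm_macOp H (macdonald q ht x) (macdonald q ht y)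
  rw [macOp_macdonald H, macOp_macdonald H, map_smul, map_smul, LinearMap.smul_apply, smul_eq_mul,
    smul_eq_mul, ← sub_eq_zero, ← sub_mul] at this
  exact (mul_eq_zero.1 this).resolve_left
    (sub_ne_zero.2 fun e => hxy (macEigVal_injective h e))

theorem isMacdonaldFamily_macdonald (h : AlgebraicIndependent ℚ ![q, t]) (ht : t ≠ 0) :
    IsMacdonaldFamily q t (macdonald q ht) where
  triangular _ _ := by
    classical
    exact unitriangular_iff.2 (unitriangular_macdonald q ht _)
  orthogonal _ _ hxy := macForm_macdonald h ht hxy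

/-- Induction along dominance. The difference G of the two candidates lies in the span of the
strictly lower members, where both families agree already. It is orthogonal to these by the
orthogonality of each family, and to all other members because of its span; the form is
nondegenerate. -/
theorem IsMacdonaldFamily.eq_macdonald (h : AlgebraicIndependent ℚ ![q, t]) (ht : t ≠ 0)
    {P : (Σ d : ℕ, d.Partition) → SymFun K} (hP : IsMacdonaldFamily q t P)
    (x : Σ d : ℕ, d.Partition) : P x = macdonald q ht x := by
  have H := generic_of_algebraicIndependent h
  induction hx : height x using Nat.strong_induction_on generalizing x with
  | _ m ih =>
  subst hx
  have hu : Unitriangular (P x) x := by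
    classical
    exact unitriangular_iff.1 (hP.triangular x.1 x.2)
  have hu' := unitriangular_macdonald q ht x
  have hS := finite_domRel x
  set G := P x - macdonald q ht x with hG
  have hspan : G ∈ Submodule.span K (macdonald q ht '' hS.toFinset) := by
    refine mem_span_of_unitriangular (unitriangular_macdonald q ht) _ ?_ ?_
    · intro y hy z hz
      rw [Set.Finite.mem_toFinset] at hy ⊢
      exact hz.trans hy
    · intro y hy
      rw [Set.Finite.mem_toFinset] at hy
      rw [hG, mcoef_sub]
      by_cases hyx : y = x
      · rw [hyx, hu.1, hu'.1, sub_self]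
      rw [not_not.1 fun h0 => hy (hu.2 y hyx h0), not_not.1 fun h0 => hy (hu'.2 y hyx h0), sub_self]
  have horth : ∀ y, macForm q t (macdonald q ht y) G = 0 := by
    intro y
    by_cases hy : DomRel y x
    · have e1 : macForm q t (macdonald q ht y) (P x) = 0 := by
        rw [← ih _ hy.height_lt y rfl]
        exact hP.orthogonal _ _ hy.2.1
      rw [hG, map_sub, e1, macForm_macdonald h ht hy.2.1, sub_self]
    · have : Submodule.span K (macdonald q ht '' hS.toFinset) ≤
          LinearMap.ker (macForm q t (macdonald q ht y)) := by
        refine Submodule.span_le.2 ?_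
        rintro _ ⟨z, hz, rfl⟩
        rw [Finset.mem_coe, Set.Finite.mem_toFinset] at hz
        rw [SetLike.mem_coe, LinearMap.mem_ker]
        refine macForm_macdonald h ht ?_
        rintro rfl
        exact hy hz
      exact this hspan
  rw [← sub_eq_zero]
  refine eq_zero_of_macForm (fun k hk => one_sub_q_pow_ne_zero h hk) H.one_sub_t fun F => ?_
  have htop : Submodule.span K (Set.range (macdonald q ht)) ≤
      LinearMap.ker ((macForm q t).flip G) := by
    refine Submodule.span_le.2 ?_
    rintro _ ⟨y, rfl⟩
    exact horth y
  rw [span_range_eq_top_of_unitriangular (unitriangular_macdonald q ht)] at htop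
  exact htop (Submodule.mem_top (x := F))

end Existence

/-! ### Descent to an arbitrary number of variables. -/

section Formula

variable {K : Type*} [Field K] [CharZero K] {q t : K}

/-- The orbit sum is the specialization of some combination of the Macdonald functions. Each of
these specializes into the eigenspace of its own eigenvalue, possibly to zero, and different
eigenspaces are independent; so only the multiple belonging to `lam` survives, and the coefficient
of x^λ shows that it is 1. -/
theorem toVars_macdonald_succ (h : AlgebraicIndependent ℚ ![q, t]) (ht : t ≠ 0) {N : ℕ}
    {lam : Fin (N + 1) → ℕ} (hl : Antitone lam) :
    toVars (N + 1) (macdonald q ht (toPartition lam)) = orbitPoly q t lam := by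
  have H := generic_of_algebraicIndependent h
  set x := toPartition lam with hx
  set D := (t - 1) • diffOp (N := N) q t with hD
  set ev : (Σ d : ℕ, d.Partition) → K := fun y => t ^ (N + 1) * macEigVal q t y - 1 with hev
  have hevi : Function.Injective ev := fun y z e =>
    macEigVal_injective h (mul_left_cancel₀ (pow_ne_zero _ ht) (sub_left_inj.1 e))
  have hm : ∀ y, toVars (N + 1) (macdonald q ht y) ∈ Module.End.eigenspace D (ev y) := by
    intro y
    rw [Module.End.mem_eigenspace_iff, hD, LinearMap.smul_apply, diffOp_toVars q ht,
      macOp_macdonald H, map_smul, hev, sub_smul, one_smul, mul_smul]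
  have ho : orbitPoly q t lam ∈ Module.End.eigenspace D (ev x) := by
    rw [Module.End.mem_eigenspace_iff, hD, LinearMap.smul_apply, diffOp_orbitPoly H hl,
      eigVal_eq q ht]
  obtain ⟨F, -, hF⟩ := exists_toVars_eq (isSymmetric_orbitPoly q ht hl)
    (isHomogeneous_orbitPoly q t hl)
  have hFs : F ∈ Submodule.span K (insert (macdonald q ht x) (macdonald q ht '' {y | y ≠ x})) := by
    have : insert (macdonald q ht x) (macdonald q ht '' {y | y ≠ x}) =
        Set.range (macdonald q ht) := by
      rw [← Set.image_insert_eq, ← Set.image_univ]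
      congr 1
      ext y
      simpa using em (y = x)
    rw [this, span_range_eq_top_of_unitriangular (unitriangular_macdonald q ht)]
    exact Submodule.mem_top
  obtain ⟨a, G, hG, e⟩ := Submodule.mem_span_insert.1 hFs
  -- G collects the members other than x; its specialization lies in the sum of the other
  -- eigenspaces and, by `hGe`, in the eigenspace of x as well, hence vanishes.
  have hGs : toVars (N + 1) G ∈ ⨆ j, ⨆ _ : j ≠ ev x, Module.End.eigenspace D j := by
    have : Submodule.span K (macdonald q ht '' {y | y ≠ x}) ≤
        (⨆ j, ⨆ _ : j ≠ ev x, Module.End.eigenspace D j).comap (toVars (N + 1)).toLinearMap := by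
      refine Submodule.span_le.2 ?_
      rintro _ ⟨y, hy, rfl⟩
      exact Submodule.mem_iSup_of_mem (ev y)
        (Submodule.mem_iSup_of_mem (fun e => hy (hevi e)) (hm y))
    exact this hG
  have hGe : toVars (N + 1) G = orbitPoly q t lam - a • toVars (N + 1) (macdonald q ht x) := by
    rw [← hF, e, map_add, map_smul, add_sub_cancel_left]
  have h0 : toVars (N + 1) G = 0 := by
    refine Submodule.disjoint_def.1 (Module.End.eigenspaces_iSupIndep D (ev x)) _ ?_ hGs
    rw [hGe]
    exact Submodule.sub_mem _ ho (Submodule.smul_mem _ _ (hm x))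
  rw [h0, eq_comm, sub_eq_zero] at hGe
  have hc := congrArg (coeff (Finsupp.equivFunOnFinite.symm lam)) hGe
  have hcx : mcoef (macdonald q ht x) (toPartition (Finsupp.equivFunOnFinite.symm lam)) = 1 :=
    (unitriangular_macdonald q ht x).1
  rw [coeff_orbitPoly_self q t hl, coeff_smul, coeff_toVars, hcx, smul_eq_mul, mul_one] at hc
  rw [hGe, ← hc, one_smul]

theorem toVars_macdonald_toPartition (h : AlgebraicIndependent ℚ ![q, t]) (ht : t ≠ 0) {n : ℕ}
    {lam : Fin n → ℕ} (hl : Antitone lam) :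
    toVars n (macdonald q ht (toPartition lam)) = orbitPoly q t lam := by
  cases n with
  | succ N => exact toVars_macdonald_succ h ht hl
  -- Without variables there is no cyclic operator; the only monomial is 1, with coefficient 1 on
  -- both sides.
  | zero =>
    ext s
    have hs : s = Finsupp.equivFunOnFinite.symm lam := Subsingleton.elim _ _
    rw [hs, coeff_orbitPoly_self q t hl, coeff_toVars]
    exact (unitriangular_macdonald q ht (toPartition lam)).1

end Formula

end MacdonaldFormula

theorem mainTheorem1 {K : Type*} [Field K] [CharZero K] (q t : K)
    (hqt : AlgebraicIndependent ℚ ![q, t]) :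
    (∃! P : (Σ d : ℕ, d.Partition) → MacdonaldFormula.SymFun K,
      MacdonaldFormula.IsMacdonaldFamily q t P) ∧
    ∀ P : (Σ d : ℕ, d.Partition) → MacdonaldFormula.SymFun K,
      MacdonaldFormula.IsMacdonaldFamily q t P →
      ∀ (n : ℕ) (lam : Fin n → ℕ), Antitone lam →
        MacdonaldFormula.toVars n (P (MacdonaldFormula.toPartition lam)) =
          (MacdonaldFormula.topOp t lam *
            ((List.range (MacdonaldFormula.largest lam - 1)).map
              (fun i => MacdonaldFormula.levelOp q t lam (i + 1))).prod) 1 := by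
  have ht : t ≠ 0 := (MacdonaldFormula.generic_of_algebraicIndependent hqt).t_ne
  refine ⟨⟨MacdonaldFormula.macdonald q ht,
    MacdonaldFormula.isMacdonaldFamily_macdonald hqt ht,
    fun P hP => funext fun x => hP.eq_macdonald hqt ht x⟩, fun P hP n lam hl => ?_⟩
  rw [hP.eq_macdonald hqt ht, MacdonaldFormula.toVars_macdonald_toPartition hqt ht hl,
    MacdonaldFormula.topOp_apply_eq_orbitPoly q t hl]
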